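/- **Signature.** Fix base types $O$ (among them $\mathit{Bool}$), constants $c$ of base type (among them distinct $\mathsf{true},\mathsf{false}:\mathit{Bool}$), operators $\mathit{op}:(\overline O)\to O$ (among them a conjunction $\&$ on $\mathit{Bool}$) with an interpretation $\delta$ on constants that respects their types, and tables $t$ with a flat bag type $[R]$, where row types $R=\langle\overline{\ell:O}\rangle$ are records of base types. Record labels are always pairwise distinct. *Queries* $q$ are the first-order terms $$q::=x\mid c\mid \mathit{op}(\overline q)\mid \mathsf{if}\,q\,q'\mid\langle\overline{\ell=q}\rangle\mid q.\ell\mid[\,]\mid[q]\mid q\uplus q'\mid\mathsf{for}(x\leftarrow q)\,q'\mid\mathsf{table}\,t$$ (with a one-armed conditional on bags) with their usual typing. Fix a set $\Omega$ of pairs $(q,V)$ of a query and a first-order value such that $(q,V)\in\Omega$ and $\vdash q:[R]$ imply $\vdash V:[R]$. **Eff.** Effects are $X,E\in\{\mathsf{pl},\mathsf{db}\}$, types are $A,B::=O\mid\langle\overline{\ell:A}\rangle\mid[A]\mid A\to^E B$, and terms extend the query syntax (with $\mathsf{for}(x^A\leftarrow M)\,N$) by $\lambda^Ex^A.M$, $M\,N$,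 $\mathsf{rec}\,f^{A\to^{\mathsf{pl}}B}\,x^A.M$, $\mathsf{fold}\,L\,M\,N$ and $\mathsf{query}\,M$. In the judgement $\Gamma\vdash M:A\,!\,X$: the body of $\lambda^E$ is typed at effect $E$ and the abstraction at any effect; $M\,N$ has the effect of the function type of $M$; $\mathsf{table}\,t$ has effect $\mathsf{db}$; $\mathsf{fold}$ has effect $\mathsf{pl}$ with all its parts ($N:A\to^{\mathsf{pl}}B\to^{\mathsf{pl}}B$); $\mathsf{query}\,M:[R]\,!\,\mathsf{pl}$ if $M:[R]\,!\,\mathsf{db}$; the body of $\mathsf{rec}$ has effect $\mathsf{pl}$ and $\mathsf{rec}$ itself any effect; the other rules are the usual ones, at any one effect. **Quot.** Types are $O\mid\langle\overline{\ell:A}\rangle\mid[A]\mid A\to B\mid\mathsf{Quote}\,A$. Terms are those of Eff with the effect annotations removed, together with quotation $\langle @M@\rangle$, antiquotation $(\%M)$ and $\mathsf{lift}\,M$. A *quotation value* $Q$ is a term without $\mathsf{rec},\mathsf{fold},\mathsf{query},\mathsf{lift}$, quotation and antiquotation. **Semantics.** Values are constants, abstractions, recursive functions, records of values, bags $[V_1]\uplus(\cdots\uplus([V_n]\uplus[\,]))$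 of values and, in Quot, $\langle @Q@\rangle$. Evaluation is left-to-right call-by-value, by silent steps: $\mathit{op}(\overline c)\to\delta(\mathit{op},\overline c)$; $(\lambda x.M)V\to M[x:=V]$; $(\mathsf{rec}\,f\,x.M)V\to M[f:=\mathsf{rec}\,f\,x.M,\,x:=V]$; $\langle\overline{\ell=V}\rangle.\ell_i\to V_i$; $\mathsf{if}\,\mathsf{true}\,M\to M$; $\mathsf{if}\,\mathsf{false}\,M\to[\,]$; $[\,]\uplus V\to V$; $([V]\uplus V')\uplus V''\to[V]\uplus(V'\uplus V'')$; $\mathsf{for}(x\leftarrow[\,])N\to[\,]$; $\mathsf{for}(x\leftarrow[V]\uplus W)N\to N[x:=V]\uplus\mathsf{for}(x\leftarrow W)N$; $\mathsf{fold}\,[\,]\,M\,N\to M$; $\mathsf{fold}\,([V]\uplus W)\,M\,N\to N\,V\,(\mathsf{fold}\,W\,M\,N)$; and $[V]\to[V]\uplus[\,]$ where $[V]$ is not the left operand of $\uplus$. Evaluation takes place in all operands of $\mathit{op}$, records, applications, projections, singletons and unions, and in the first operand of $\mathsf{if},\mathsf{for},\mathsf{fold}$. Quot moreover evaluates under $\mathsf{lift}$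 and $\mathsf{query}$, has $\mathsf{lift}\,c\to\langle @c@\rangle$, and inside a quotation evaluates the antiquoted terms from left to right (also under binders) and replaces $(\%\langle @Q@\rangle)$ by $Q$. The only visible steps are, for $(q,V)\in\Omega$, $$\mathsf{query}\,M\xrightarrow{(q,V)}V\ \text{ in Eff, if } |M|=q,\qquad \mathsf{query}\,\langle @Q@\rangle\xrightarrow{(q,V)}V\ \text{ in Quot, if } |Q|=q.$$ Here $|M|=q$ means that $M$ rewrites, in any context, to a normal form $M'$ of the first group of rules below, that $M'$ rewrites to a normal form of the second group, and that the latter is $q$ up to the type annotations on bound variables (bound variables are renamed to avoid capture). First group: $(\lambda x.M)N\leadsto M[x:=N]$; $\langle\overline{\ell=M}\rangle.\ell_i\leadsto M_i$; $\mathsf{for}(x\leftarrow[M])N\leadsto N[x:=M]$; $\mathsf{for}(y\leftarrow\mathsf{for}(x\leftarrow L)M)N\leadsto\mathsf{for}(x\leftarrow L)\,\mathsf{for}(y\leftarrow M)N$; $\mathsf{for}(x\leftarrow\mathsf{if}\,L\,M)N\leadsto\mathsf{if}\,L\,(\mathsf{for}(x\leftarrow M)N)$; $\mathsf{for}(x\leftarrow[\,])N\leadsto[\,]$;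 $\mathsf{for}(x\leftarrow L\uplus M)N\leadsto(\mathsf{for}(x\leftarrow L)N)\uplus(\mathsf{for}(x\leftarrow M)N)$; $\mathsf{if}\,\mathsf{true}\,M\leadsto M$; $\mathsf{if}\,\mathsf{false}\,M\leadsto[\,]$. Second group: $\mathsf{for}(x\leftarrow L)(M\uplus N)\hookrightarrow(\mathsf{for}(x\leftarrow L)M)\uplus(\mathsf{for}(x\leftarrow L)N)$; $\mathsf{for}(x\leftarrow L)[\,]\hookrightarrow[\,]$; $\mathsf{if}\,L\,(M\uplus N)\hookrightarrow(\mathsf{if}\,L\,M)\uplus(\mathsf{if}\,L\,N)$; $\mathsf{if}\,L\,[\,]\hookrightarrow[\,]$; $\mathsf{if}\,L\,(\mathsf{if}\,M\,N)\hookrightarrow\mathsf{if}\,(L\,\&\,M)\,N$; $\mathsf{if}\,L\,(\mathsf{for}(x\leftarrow M)N)\hookrightarrow\mathsf{for}(x\leftarrow M)(\mathsf{if}\,L\,N)$. **Traces.** For a state $x$ of a labelled transition system, $Tr(x)$ is the set of all finite and infinite words of visible labels of the finite and infinite runs from $x$. States $x,y$ of two systems over the same labels are *trace-equivalent*, $x\eqsim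 y$, if $Tr(x)=Tr(y)$. **Splicing translation.** On types, $[\![-]\!]_X$ preserves the structure (dropping effects), except that $[\![A\to^{\mathsf{db}}B]\!]_{\mathsf{pl}}=\mathsf{Quote}([\![A]\!]_{\mathsf{db}}\to[\![B]\!]_{\mathsf{db}})$ and $[\![A\to^{\mathsf{pl}}B]\!]_{\mathsf{db}}=\langle\rangle$. Reification is $\downarrow_O(M)=(\%\,\mathsf{lift}\,M)$, $\downarrow_{A\to^{\mathsf{pl}}B}(M)=\langle\rangle$, $\downarrow_{A\to^{\mathsf{db}}B}(M)=(\%M)$, $\downarrow_{\langle\overline{\ell:A}\rangle}(M)=\langle\overline{\ell=\downarrow_A(M.\ell)}\rangle$, $\downarrow_{[A]}(M)=(\%\,\mathsf{fold}\,M\,\langle @[\,]@\rangle\,(\lambda x.\lambda y.\langle @[\downarrow_A(x)]\uplus(\%y)@\rangle))$. Let $\mathsf{let}\,x=M\,\mathsf{in}\,N$ stand for $(\lambda x.N)M$. For a map $\rho$ from variables to pairs $A\,!\,X$ (type and effect at which the variable was bound; $\varepsilon$ is the empty map), $[\![-]\!]^\rho_X$ preserves the structure of terms, except: - if $\rho(x)=A\,!\,Y$,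 then $[\![x]\!]^\rho_X$ is $x$ if $X=Y$, the term $(\%x_{\mathsf{db}})$ if $Y=\mathsf{pl}$, $X=\mathsf{db}$, and the diverging term $(\mathsf{rec}\,f\,x.f\,x)\langle\rangle$ if $Y=\mathsf{db}$, $X=\mathsf{pl}$; - at target $\mathsf{pl}$, under every $x^A$ bound by $\lambda^{\mathsf{pl}}$, $\mathsf{for}$ or $\mathsf{rec}$ (there also for the function variable) the translated body is preceded by $\mathsf{let}\,x_{\mathsf{db}}=\langle @\downarrow_A(x)@\rangle\,\mathsf{in}$, and $\rho$ is extended by $x\mapsto A\,!\,\mathsf{pl}$; - under $\lambda^{\mathsf{db}}x^A$, and under $\mathsf{for}(x^A\leftarrow\cdot)$ at target $\mathsf{db}$, $\rho$ is extended by $x\mapsto A\,!\,\mathsf{db}$; - $[\![\lambda^{\mathsf{db}}x^A.M]\!]^\rho_{\mathsf{db}}=\lambda x.[\![M]\!]_{\mathsf{db}}^{\rho[x\mapsto A!\mathsf{db}]}$ and $[\![\lambda^{\mathsf{db}}x^A.M]\!]^\rho_{\mathsf{pl}}=\langle @\lambda x.[\![M]\!]_{\mathsf{db}}^{\rho[x\mapsto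 A!\mathsf{db}]}@\rangle$; - $[\![\lambda^{\mathsf{pl}}x^A.M]\!]^\rho_{\mathsf{db}}=[\![\mathsf{rec}\,f\,x.M]\!]^\rho_{\mathsf{db}}=\langle\rangle$; - $[\![\mathsf{query}\,M]\!]^\rho_{\mathsf{pl}}=\mathsf{query}\,\langle @[\![M]\!]^\rho_{\mathsf{db}}@\rangle$. **Corollary.** For every closed Eff term $M$ with $\vdash M:A\,!\,\mathsf{pl}$, $$M\eqsim[\![M]\!]^{\varepsilon}_{\mathsf{pl}}.$$ -/

import Mathlib

namespace LIQ

/-! ## Labelled transition systems and traces -/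

/-- A labelled transition system with states `X`; a transition carries `none` (the silent action)
or a visible label in `L`. -/
structure LTS (X L : Type) where
  tr : X → Option L → X → Prop

/-- Finite and infinite words. -/
inductive Word (L : Type) : Type
  | fin (w : List L)
  | inf (w : ℕ → L)

namespace LTS

variable {X Y L : Type}

/-- Finitely many silent transitions. -/
def Silent (T : LTS X L) : X → X → Prop :=
  Relation.ReflTransGen fun x y => T.tr x none y

/-- A transition preceded and followed by finitely many silent transitions. -/
def Weak (T : LTS X L) (x : X) (a : Option L) (y : X) : Prop :=
  ∃ x' y', T.Silent x x' ∧ T.tr x' a y' ∧ T.Silent y' y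

/-- Finite runs of weak transitions, with the list of their actions. -/
inductive FinRun (T : LTS X L) : X → List (Option L) → X → Prop
  | nil (x : X) : FinRun T x [] x
  | cons {x y z : X} {a : Option L} {as : List (Option L)} :
      T.Weak x a y → FinRun T y as z → FinRun T x (a :: as) z

/-- `w` is the concatenation of the visible labels of the infinite sequence of actions `a`. -/
def IsVisiblePart (a : ℕ → Option L) : Word L → Prop
  | .fin w => ∃ n, (∀ i, n ≤ i → a i = none) ∧
      w = ((List.range n).map a).reduceOption
  | .inf w => ∃ p : ℕ → ℕ, StrictMono p ∧ (∀ k, a (p k) = some (w k)) ∧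
      ∀ i, i ∉ Set.range p → a i = none

/-- The set of traces of all finite and all infinite runs from `x`. -/
def traces (T : LTS X L) (x : X) : Set (Word L) :=
  {w | (∃ as y, T.FinRun x as y ∧ w = .fin as.reduceOption) ∨
       (∃ (s : ℕ → X) (a : ℕ → Option L), s 0 = x ∧
          (∀ i, T.Weak (s i) (a i) (s (i + 1))) ∧ IsVisiblePart a w)}

/-- Trace equivalence of a state of one system and a state of another, over the same labels. -/
def TraceEquiv (T : LTS X L) (x : X) (U : LTS Y L) (y : Y) : Prop :=
  T.traces x = U.traces y

end LTS

/-! ## Signatures -/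

/-- Base types, constants, primitive operators and database tables, with their types. The types
contain `bool`, whose constants include `tt` and `ff`, and there is an operator `conj` of
conjunction. A table `t` has pairwise distinct column labels `col t` and columns of base type. -/
structure Signature where
  Base : Type
  Const : Type
  Op : Type
  Table : Type
  bool : Base
  constTy : Const → Base
  tt : Const
  ff : Const
  tt_ty : constTy tt = bool
  ff_ty : constTy ff = bool
  tt_ne_ff : tt ≠ ff
  arity : Op → ℕ
  argTy : (o : Op) → Fin (arity o) → Base
  resTy : Op → Base
  conj : Op
  conj_arity : arity conj = 2
  conj_argTy : ∀ i, argTy conj i = bool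
  conj_resTy : resTy conj = bool
  width : Table → ℕ
  col : (t : Table) → Fin (width t) ↪ String
  colTy : (t : Table) → Fin (width t) → Base

/-- An interpretation of the operators on constants respects the types of the operators. -/
def OpTypeSafe (S : Signature) (δ : (o : S.Op) → (Fin (S.arity o) → S.Const) → S.Const) : Prop :=
  ∀ (o : S.Op) (c : Fin (S.arity o) → S.Const),
    (∀ i, S.constTy (c i) = S.argTy o i) → S.constTy (δ o c) = S.resTy o

/-- Variables are de Bruijn indices; a renaming under one binder. -/
def upRen (r : ℕ → ℕ) : ℕ → ℕ
  | 0 => 0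
  | n + 1 => r n + 1

/-! ## Queries of the nested relational calculus -/

/-- Types of queries and of their results. Record labels are pairwise distinct. -/
inductive NTy (S : Signature) : Type
  | base (O : S.Base)
  | rcd {n : ℕ} (l : Fin n ↪ String) (A : Fin n → NTy S)
  | bag (A : NTy S)

/-- Row types: records of base types. -/
def NTy.row {S : Signature} {n : ℕ} (l : Fin n ↪ String) (O : Fin n → S.Base) : NTy S :=
  .rcd l fun i => .base (O i)

/-- First-order queries; `bind q r` is the comprehension `for (x ← q) r`, binding index `0` in
`r`, and `cond q r` is the one-armed conditional. -/
inductive Query (S : Signature) : Type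
  | var (i : ℕ)
  | const (c : S.Const)
  | op (o : S.Op) (q : Fin (S.arity o) → Query S)
  | cond (q r : Query S)
  | record {n : ℕ} (l : Fin n ↪ String) (q : Fin n → Query S)
  | proj (q : Query S) (l : String)
  | empty
  | sing (q : Query S)
  | union (q r : Query S)
  | bind (q r : Query S)
  | table (t : S.Table)

/-- Typing of queries. -/
inductive Query.HasTy {S : Signature} : List (NTy S) → Query S → NTy S → Prop
  | var {Γ i A} : Γ[i]? = some A → HasTy Γ (.var i) A
  | const {Γ c} : HasTy Γ (.const c) (.base (S.constTy c))
  | op {Γ o q} : (∀ i, HasTy Γ (q i) (.base (S.argTy o i))) →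
      HasTy Γ (.op o q) (.base (S.resTy o))
  | cond {Γ q r A} : HasTy Γ q (.base S.bool) → HasTy Γ r (.bag A) →
      HasTy Γ (.cond q r) (.bag A)
  | record {Γ n} {l : Fin n ↪ String} {q A} : (∀ i, HasTy Γ (q i) (A i)) →
      HasTy Γ (.record l q) (.rcd l A)
  | proj {Γ q n} {l : Fin n ↪ String} {A} (i : Fin n) : HasTy Γ q (.rcd l A) →
      HasTy Γ (.proj q (l i)) (A i)
  | empty {Γ A} : HasTy Γ .empty (.bag A)
  | sing {Γ q A} : HasTy Γ q A → HasTy Γ (.sing q) (.bag A)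
  | union {Γ q r A} : HasTy Γ q (.bag A) → HasTy Γ r (.bag A) → HasTy Γ (.union q r) (.bag A)
  | bind {Γ q r A B} : HasTy Γ q (.bag A) → HasTy (A :: Γ) r (.bag B) →
      HasTy Γ (.bind q r) (.bag B)
  | table {Γ t} : HasTy Γ (.table t) (.bag (.row (S.col t) (S.colTy t)))

/-- Values that the database may return. -/
inductive NVal (S : Signature) : Type
  | const (c : S.Const)
  | record {n : ℕ} (l : Fin n ↪ String) (V : Fin n → NVal S)
  | bag {n : ℕ} (V : Fin n → NVal S)

/-- Typing of database values. -/
inductive NVal.HasTy {S : Signature} : NVal S → NTy S → Prop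
  | const {c} : HasTy (.const c) (.base (S.constTy c))
  | record {n} {l : Fin n ↪ String} {V A} : (∀ i, HasTy (V i) (A i)) →
      HasTy (.record l V) (.rcd l A)
  | bag {n} {V : Fin n → NVal S} {A} : (∀ i, HasTy (V i) A) → HasTy (.bag V) (.bag A)

/-- A set of possible query/response pairs respects types at all flat bag types. -/
def ResponseTypeSafe (S : Signature) (Ω : Set (Query S × NVal S)) : Prop :=
  ∀ (q : Query S) (V : NVal S), (q, V) ∈ Ω →
    ∀ (n : ℕ) (l : Fin n ↪ String) (O : Fin n → S.Base),
      Query.HasTy [] q (.bag (.row l O)) → NVal.HasTy V (.bag (.row l O))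

/-! ## The calculus Eff -/

/-- Ground effects: `pl` for the programming language, `db` for the database. -/
inductive Effect : Type
  | pl
  | db

/-- Types of Eff; `fn A E B` is the type of functions from `A` to `B` with effect `E`. -/
inductive ETy (S : Signature) : Type
  | base (O : S.Base)
  | rcd {n : ℕ} (l : Fin n ↪ String) (A : Fin n → ETy S)
  | bag (A : ETy S)
  | fn (A : ETy S) (E : Effect) (B : ETy S)

/-- Row types: records of base types. -/
def ETy.row {S : Signature} {n : ℕ} (l : Fin n ↪ String) (O : Fin n → S.Base) : ETy S :=
  .rcd l fun i => .base (O i)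

/-- Terms of Eff. `lam` binds index `0`; `bind A M N` is `for (x : A ← M) N` and binds index `0`
in `N`; `fix A B M` is the recursive function from `A` to `B` whose body `M` has the argument as
index `0` and the function itself as index `1`. -/
inductive ETm (S : Signature) : Type
  | var (i : ℕ)
  | const (c : S.Const)
  | op (o : S.Op) (M : Fin (S.arity o) → ETm S)
  | lam (E : Effect) (A : ETy S) (M : ETm S)
  | app (M N : ETm S)
  | cond (L M : ETm S)
  | record {n : ℕ} (l : Fin n ↪ String) (M : Fin n → ETm S)
  | proj (M : ETm S) (l : String)
  | empty
  | sing (M : ETm S)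
  | union (M N : ETm S)
  | bind (A : ETy S) (M N : ETm S)
  | fix (A B : ETy S) (M : ETm S)
  | fold (L M N : ETm S)
  | query (M : ETm S)
  | table (t : S.Table)

namespace ETm

variable {S : Signature}

/-- Typing of Eff: `HasTy Γ M A X` means that `M` has type `A` and effect `X` in context `Γ`. -/
inductive HasTy : List (ETy S) → ETm S → ETy S → Effect → Prop
  | var {Γ i A X} : Γ[i]? = some A → HasTy Γ (.var i) A X
  | const {Γ c X} : HasTy Γ (.const c) (.base (S.constTy c)) X
  | op {Γ o M X} : (∀ i, HasTy Γ (M i) (.base (S.argTy o i)) X) →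
      HasTy Γ (.op o M) (.base (S.resTy o)) X
  | lam {Γ E A B M X} : HasTy (A :: Γ) M B E → HasTy Γ (.lam E A M) (.fn A E B) X
  | app {Γ M N A B X} : HasTy Γ M (.fn A X B) X → HasTy Γ N A X → HasTy Γ (.app M N) B X
  | cond {Γ L M A X} : HasTy Γ L (.base S.bool) X → HasTy Γ M (.bag A) X →
      HasTy Γ (.cond L M) (.bag A) X
  | record {Γ n} {l : Fin n ↪ String} {M A X} : (∀ i, HasTy Γ (M i) (A i) X) →
      HasTy Γ (.record l M) (.rcd l A) X
  | proj {Γ M n} {l : Fin n ↪ String} {A X} (i : Fin n) : HasTy Γ M (.rcd l A) X →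
      HasTy Γ (.proj M (l i)) (A i) X
  | empty {Γ A X} : HasTy Γ .empty (.bag A) X
  | sing {Γ M A X} : HasTy Γ M A X → HasTy Γ (.sing M) (.bag A) X
  | union {Γ M N A X} : HasTy Γ M (.bag A) X → HasTy Γ N (.bag A) X →
      HasTy Γ (.union M N) (.bag A) X
  | bind {Γ M N A B X} : HasTy Γ M (.bag A) X → HasTy (A :: Γ) N (.bag B) X →
      HasTy Γ (.bind A M N) (.bag B) X
  | table {Γ t} : HasTy Γ (.table t) (.bag (.row (S.col t) (S.colTy t))) .db
  | query {Γ M n} {l : Fin n ↪ String} {O : Fin n → S.Base} :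
      HasTy Γ M (.bag (.row l O)) .db → HasTy Γ (.query M) (.bag (.row l O)) .pl
  | fix {Γ A B M X} : HasTy (A :: .fn A .pl B :: Γ) M B .pl →
      HasTy Γ (.fix A B M) (.fn A .pl B) X
  | fold {Γ L M N A B} : HasTy Γ L (.bag A) .pl → HasTy Γ M B .pl →
      HasTy Γ N (.fn A .pl (.fn B .pl B)) .pl → HasTy Γ (.fold L M N) B .pl

/-- Renaming of variables. -/
def rename : (ℕ → ℕ) → ETm S → ETm S
  | r, var i => var (r i)
  | _, const c => const c
  | r, op o M => op o fun i => rename r (M i)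
  | r, lam E A M => lam E A (rename (upRen r) M)
  | r, app M N => app (rename r M) (rename r N)
  | r, cond L M => cond (rename r L) (rename r M)
  | r, record l M => record l fun i => rename r (M i)
  | r, proj M l => proj (rename r M) l
  | _, empty => empty
  | r, sing M => sing (rename r M)
  | r, union M N => union (rename r M) (rename r N)
  | r, bind A M N => bind A (rename r M) (rename (upRen r) N)
  | r, fix A B M => fix A B (rename (upRen (upRen r)) M)
  | r, fold L M N => fold (rename r L) (rename r M) (rename r N)
  | r, query M => query (rename r M)
  | _, table t => table t

/-- A substitution under one binder. -/
def up (s : ℕ → ETm S) : ℕ → ETm S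
  | 0 => var 0
  | n + 1 => rename Nat.succ (s n)

/-- Capture-avoiding simultaneous substitution. -/
def subst : (ℕ → ETm S) → ETm S → ETm S
  | s, var i => s i
  | _, const c => const c
  | s, op o M => op o fun i => subst s (M i)
  | s, lam E A M => lam E A (subst (up s) M)
  | s, app M N => app (subst s M) (subst s N)
  | s, cond L M => cond (subst s L) (subst s M)
  | s, record l M => record l fun i => subst s (M i)
  | s, proj M l => proj (subst s M) l
  | _, empty => empty
  | s, sing M => sing (subst s M)
  | s, union M N => union (subst s M) (subst s N)
  | s, bind A M N => bind A (subst s M) (subst (up s) N)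
  | s, fix A B M => fix A B (subst (up (up s)) M)
  | s, fold L M N => fold (subst s L) (subst s M) (subst s N)
  | s, query M => query (subst s M)
  | _, table t => table t

/-- The substitution of `V` for index `0`. -/
def one (V : ETm S) : ℕ → ETm S
  | 0 => V
  | n + 1 => var n

/-- The substitution of `V` for index `0` and `F` for index `1`. -/
def two (V F : ETm S) : ℕ → ETm S
  | 0 => V
  | 1 => F
  | n + 2 => var n

/-- Conjunction. -/
def conj (L M : ETm S) : ETm S :=
  op S.conj fun i => if i.val = 0 then L else M

/-- Symbolic reduction rules (first stage of normalisation). -/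
inductive SymRule : ETm S → ETm S → Prop
  | beta (E A M N) : SymRule (app (lam E A M) N) (subst (one N) M)
  | proj {n} (l : Fin n ↪ String) (M : Fin n → ETm S) (i : Fin n) :
      SymRule (proj (record l M) (l i)) (M i)
  | forSing (A M N) : SymRule (bind A (sing M) N) (subst (one M) N)
  | forFor (A B L M N) : SymRule (bind B (bind A L M) N)
      (bind A L (bind B M (rename (upRen Nat.succ) N)))
  | forCond (A L M N) : SymRule (bind A (cond L M) N) (cond L (bind A M N))
  | forEmpty (A N) : SymRule (bind A empty N) empty
  | forUnion (A L M N) : SymRule (bind A (union L M) N) (union (bind A L N) (bind A M N))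
  | condTrue (M) : SymRule (cond (const S.tt) M) M
  | condFalse (M) : SymRule (cond (const S.ff) M) empty

/-- Ad hoc reduction rules (second stage of normalisation). -/
inductive AdhocRule : ETm S → ETm S → Prop
  | forUnion (A L M N) : AdhocRule (bind A L (union M N)) (union (bind A L M) (bind A L N))
  | forEmpty (A L) : AdhocRule (bind A L empty) empty
  | condUnion (L M N) : AdhocRule (cond L (union M N)) (union (cond L M) (cond L N))
  | condEmpty (L) : AdhocRule (cond L empty) empty
  | condCond (L M N) : AdhocRule (cond L (cond M N)) (cond (conj L M) N)
  | condFor (A L M N) : AdhocRule (cond L (bind A M N)) (bind A M (cond (rename Nat.succ L) N))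

/-- One step of the rules `R` anywhere in a term. -/
inductive Rewrite (R : ETm S → ETm S → Prop) : ETm S → ETm S → Prop
  | rule {M N} : R M N → Rewrite R M N
  | op {o} {M : Fin (S.arity o) → ETm S} {i N} : Rewrite R (M i) N →
      Rewrite R (.op o M) (.op o (Function.update M i N))
  | lam {E A M M'} : Rewrite R M M' → Rewrite R (.lam E A M) (.lam E A M')
  | appL {M M' N} : Rewrite R M M' → Rewrite R (.app M N) (.app M' N)
  | appR {M N N'} : Rewrite R N N' → Rewrite R (.app M N) (.app M N')
  | condL {L L' M} : Rewrite R L L' → Rewrite R (.cond L M) (.cond L' M)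
  | condR {L M M'} : Rewrite R M M' → Rewrite R (.cond L M) (.cond L M')
  | record {n} {l : Fin n ↪ String} {M : Fin n → ETm S} {i N} : Rewrite R (M i) N →
      Rewrite R (.record l M) (.record l (Function.update M i N))
  | proj {M M' l} : Rewrite R M M' → Rewrite R (.proj M l) (.proj M' l)
  | sing {M M'} : Rewrite R M M' → Rewrite R (.sing M) (.sing M')
  | unionL {M M' N} : Rewrite R M M' → Rewrite R (.union M N) (.union M' N)
  | unionR {M N N'} : Rewrite R N N' → Rewrite R (.union M N) (.union M N')
  | bindL {A M M' N} : Rewrite R M M' → Rewrite R (.bind A M N) (.bind A M' N)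
  | bindR {A M N N'} : Rewrite R N N' → Rewrite R (.bind A M N) (.bind A M N')
  | fix {A B M M'} : Rewrite R M M' → Rewrite R (.fix A B M) (.fix A B M')
  | foldL {L L' M N} : Rewrite R L L' → Rewrite R (.fold L M N) (.fold L' M N)
  | foldM {L M M' N} : Rewrite R M M' → Rewrite R (.fold L M N) (.fold L M' N)
  | foldR {L M N N'} : Rewrite R N N' → Rewrite R (.fold L M N) (.fold L M N')
  | query {M M'} : Rewrite R M M' → Rewrite R (.query M) (.query M')

/-- `IsQuery M q`: the term `M` is the query `q`, up to type annotations on bound variables. -/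
inductive IsQuery : ETm S → Query S → Prop
  | var (i) : IsQuery (.var i) (.var i)
  | const (c) : IsQuery (.const c) (.const c)
  | op {o M q} : (∀ i, IsQuery (M i) (q i)) → IsQuery (.op o M) (.op o q)
  | cond {L M q r} : IsQuery L q → IsQuery M r → IsQuery (.cond L M) (.cond q r)
  | record {n} {l : Fin n ↪ String} {M q} : (∀ i, IsQuery (M i) (q i)) →
      IsQuery (.record l M) (.record l q)
  | proj {M q l} : IsQuery M q → IsQuery (.proj M l) (.proj q l)
  | empty : IsQuery .empty .empty
  | sing {M q} : IsQuery M q → IsQuery (.sing M) (.sing q)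
  | union {M N q r} : IsQuery M q → IsQuery N r → IsQuery (.union M N) (.union q r)
  | bind {A M N q r} : IsQuery M q → IsQuery N r → IsQuery (.bind A M N) (.bind q r)
  | table (t) : IsQuery (.table t) (.table t)

/-- `Norm M q`: the query `q` is a normal form of `M`, obtained by rewriting `M` to a normal form
with the symbolic rules and then that term to a normal form with the ad hoc rules. -/
def Norm (M : ETm S) (q : Query S) : Prop :=
  ∃ M' N : ETm S,
    Relation.ReflTransGen (Rewrite SymRule) M M' ∧ (∀ P, ¬ Rewrite SymRule M' P) ∧
    Relation.ReflTransGen (Rewrite AdhocRule) M' N ∧ (∀ P, ¬ Rewrite AdhocRule N P) ∧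
    IsQuery N q

/-- The shape of a bag value: empty or a union. -/
def IsBagShape : ETm S → Prop
  | empty => True
  | union _ _ => True
  | _ => False

/-- Values. Bag values are `[V₁] ⊎ ([V₂] ⊎ (⋯ ⊎ []))`. -/
inductive IsVal : ETm S → Prop
  | const (c) : IsVal (.const c)
  | lam (E A M) : IsVal (.lam E A M)
  | fix (A B M) : IsVal (.fix A B M)
  | record {n} (l : Fin n ↪ String) {V : Fin n → ETm S} : (∀ i, IsVal (V i)) →
      IsVal (.record l V)
  | nil : IsVal .empty
  | cons {V W} : IsVal V → IsVal W → IsBagShape W → IsVal (.union (.sing V) W)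

/-- A singleton whose element is a value. -/
def IsValSing (M : ETm S) : Prop := ∃ V, IsVal V ∧ M = sing V

/-- The term that denotes a database value. -/
def ofVal : NVal S → ETm S
  | .const c => const c
  | .record l V => record l fun i => ofVal (V i)
  | .bag V => (List.ofFn fun i => ofVal (V i)).foldr (fun M N => union (sing M) N) empty

/-- The small-step semantics of Eff, for an interpretation `δ` of the operators and a set `Ω` of
query/response pairs. A singleton `[V]` that is not the left operand of a union steps to the bag
value `[V] ⊎ []`. -/
inductive Step (δ : (o : S.Op) → (Fin (S.arity o) → S.Const) → S.Const)
    (Ω : Set (Query S × NVal S)) : ETm S → Option (Query S × NVal S) → ETm S → Prop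
  | delta (o c) : Step δ Ω (.op o fun i => .const (c i)) none (.const (δ o c))
  | beta {E A M V} : IsVal V → Step δ Ω (.app (.lam E A M) V) none (subst (one V) M)
  | unroll {A B M V} : IsVal V →
      Step δ Ω (.app (.fix A B M) V) none (subst (two V (.fix A B M)) M)
  | projRecord {n} {l : Fin n ↪ String} {V : Fin n → ETm S} (i : Fin n) : (∀ j, IsVal (V j)) →
      Step δ Ω (.proj (.record l V) (l i)) none (V i)
  | condTrue (M) : Step δ Ω (.cond (.const S.tt) M) none M
  | condFalse (M) : Step δ Ω (.cond (.const S.ff) M) none .empty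
  | singEta {V} : IsVal V → Step δ Ω (.sing V) none (.union (.sing V) .empty)
  | unionNil {V} : IsVal V → Step δ Ω (.union .empty V) none V
  | unionCons {V V' V''} : IsVal (.union (.sing V) V') → IsVal V'' →
      Step δ Ω (.union (.union (.sing V) V') V'') none (.union (.sing V) (.union V' V''))
  | forNil (A N) : Step δ Ω (.bind A .empty N) none .empty
  | forCons {A V W N} : IsVal (.union (.sing V) W) →
      Step δ Ω (.bind A (.union (.sing V) W) N) none (.union (subst (one V) N) (.bind A W N))
  | foldNil (M N) : Step δ Ω (.fold .empty M N) none M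
  | foldCons {V W M N} : IsVal (.union (.sing V) W) →
      Step δ Ω (.fold (.union (.sing V) W) M N) none (.app (.app N V) (.fold W M N))
  | runQuery {M q V} : Norm M q → (q, V) ∈ Ω → Step δ Ω (.query M) (some (q, V)) (ofVal V)
  | op {o} {M : Fin (S.arity o) → ETm S} {i a N} : (∀ j, j < i → IsVal (M j)) →
      Step δ Ω (M i) a N → Step δ Ω (.op o M) a (.op o (Function.update M i N))
  | appL {M M' N a} : Step δ Ω M a M' → Step δ Ω (.app M N) a (.app M' N)
  | appR {V N N' a} : IsVal V → Step δ Ω N a N' → Step δ Ω (.app V N) a (.app V N')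
  | record {n} {l : Fin n ↪ String} {M : Fin n → ETm S} {i a N} : (∀ j, j < i → IsVal (M j)) →
      Step δ Ω (M i) a N → Step δ Ω (.record l M) a (.record l (Function.update M i N))
  | proj {M M' l a} : Step δ Ω M a M' → Step δ Ω (.proj M l) a (.proj M' l)
  | sing {M M' a} : Step δ Ω M a M' → Step δ Ω (.sing M) a (.sing M')
  | unionL {M M' N a} : ¬ IsValSing M → Step δ Ω M a M' →
      Step δ Ω (.union M N) a (.union M' N)
  | unionR {V N N' a} : IsVal V ∨ IsValSing V → Step δ Ω N a N' →
      Step δ Ω (.union V N) a (.union V N')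
  | bind {A M M' N a} : Step δ Ω M a M' → Step δ Ω (.bind A M N) a (.bind A M' N)
  | cond {L L' M a} : Step δ Ω L a L' → Step δ Ω (.cond L M) a (.cond L' M)
  | fold {L L' M N a} : Step δ Ω L a L' → Step δ Ω (.fold L M N) a (.fold L' M N)

/-- The labelled transition system of Eff. -/
def lts (δ : (o : S.Op) → (Fin (S.arity o) → S.Const) → S.Const) (Ω : Set (Query S × NVal S)) :
    LTS (ETm S) (Query S × NVal S) where
  tr := Step δ Ω

end ETm

/-! ## The calculus Quot -/

/-- Types of Quot; `quot A` is the type of closed quoted query terms of type `A`. -/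
inductive QTy (S : Signature) : Type
  | base (O : S.Base)
  | rcd {n : ℕ} (l : Fin n ↪ String) (A : Fin n → QTy S)
  | bag (A : QTy S)
  | fn (A B : QTy S)
  | quot (A : QTy S)

/-- The empty record type. -/
def QTy.unit {S : Signature} : QTy S := .rcd (Function.Embedding.ofIsEmpty) Fin.elim0

/-- Terms of Quot, with the binding conventions of Eff; host and query terms share one syntax, and
one numbering of the variables. -/
inductive QTm (S : Signature) : Type
  | var (i : ℕ)
  | const (c : S.Const)
  | op (o : S.Op) (M : Fin (S.arity o) → QTm S)
  | lam (A : QTy S) (M : QTm S)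
  | app (M N : QTm S)
  | cond (L M : QTm S)
  | record {n : ℕ} (l : Fin n ↪ String) (M : Fin n → QTm S)
  | proj (M : QTm S) (l : String)
  | empty
  | sing (M : QTm S)
  | union (M N : QTm S)
  | bind (A : QTy S) (M N : QTm S)
  | fix (A B : QTy S) (M : QTm S)
  | fold (L M N : QTm S)
  | query (M : QTm S)
  | table (t : S.Table)
  | quote (M : QTm S)
  | antiquote (M : QTm S)
  | lift (M : QTm S)

/-- The two levels of Quot at which evaluation takes place. -/
inductive Level : Type
  | host
  | quoted

namespace QTm

variable {S : Signature}

/-- Renaming of variables. -/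
def rename : (ℕ → ℕ) → QTm S → QTm S
  | r, var i => var (r i)
  | _, const c => const c
  | r, op o M => op o fun i => rename r (M i)
  | r, lam A M => lam A (rename (upRen r) M)
  | r, app M N => app (rename r M) (rename r N)
  | r, cond L M => cond (rename r L) (rename r M)
  | r, record l M => record l fun i => rename r (M i)
  | r, proj M l => proj (rename r M) l
  | _, empty => empty
  | r, sing M => sing (rename r M)
  | r, union M N => union (rename r M) (rename r N)
  | r, bind A M N => bind A (rename r M) (rename (upRen r) N)
  | r, fix A B M => fix A B (rename (upRen (upRen r)) M)
  | r, fold L M N => fold (rename r L) (rename r M) (rename r N)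
  | r, query M => query (rename r M)
  | _, table t => table t
  | r, quote M => quote (rename r M)
  | r, antiquote M => antiquote (rename r M)
  | r, lift M => lift (rename r M)

/-- A substitution under one binder. -/
def up (s : ℕ → QTm S) : ℕ → QTm S
  | 0 => var 0
  | n + 1 => rename Nat.succ (s n)

/-- Capture-avoiding simultaneous substitution. -/
def subst : (ℕ → QTm S) → QTm S → QTm S
  | s, var i => s i
  | _, const c => const c
  | s, op o M => op o fun i => subst s (M i)
  | s, lam A M => lam A (subst (up s) M)
  | s, app M N => app (subst s M) (subst s N)
  | s, cond L M => cond (subst s L) (subst s M)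
  | s, record l M => record l fun i => subst s (M i)
  | s, proj M l => proj (subst s M) l
  | _, empty => empty
  | s, sing M => sing (subst s M)
  | s, union M N => union (subst s M) (subst s N)
  | s, bind A M N => bind A (subst s M) (subst (up s) N)
  | s, fix A B M => fix A B (subst (up (up s)) M)
  | s, fold L M N => fold (subst s L) (subst s M) (subst s N)
  | s, query M => query (subst s M)
  | _, table t => table t
  | s, quote M => quote (subst s M)
  | s, antiquote M => antiquote (subst s M)
  | s, lift M => lift (subst s M)

/-- The substitution of `V` for index `0`. -/
def one (V : QTm S) : ℕ → QTm S
  | 0 => V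
  | n + 1 => var n

/-- The substitution of `V` for index `0` and `F` for index `1`. -/
def two (V F : QTm S) : ℕ → QTm S
  | 0 => V
  | 1 => F
  | n + 2 => var n

/-- The empty record. -/
def unit : QTm S := record (Function.Embedding.ofIsEmpty) Fin.elim0

/-- `let x : A = M in N`, binding index `0` in `N`. -/
def letIn (A : QTy S) (M N : QTm S) : QTm S := app (lam A N) M

/-- Conjunction. -/
def conj (L M : QTm S) : QTm S :=
  op S.conj fun i => if i.val = 0 then L else M

/-- Symbolic reduction rules (first stage of normalisation). -/
inductive SymRule : QTm S → QTm S → Prop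
  | beta (A M N) : SymRule (app (lam A M) N) (subst (one N) M)
  | proj {n} (l : Fin n ↪ String) (M : Fin n → QTm S) (i : Fin n) :
      SymRule (proj (record l M) (l i)) (M i)
  | forSing (A M N) : SymRule (bind A (sing M) N) (subst (one M) N)
  | forFor (A B L M N) : SymRule (bind B (bind A L M) N)
      (bind A L (bind B M (rename (upRen Nat.succ) N)))
  | forCond (A L M N) : SymRule (bind A (cond L M) N) (cond L (bind A M N))
  | forEmpty (A N) : SymRule (bind A empty N) empty
  | forUnion (A L M N) : SymRule (bind A (union L M) N) (union (bind A L N) (bind A M N))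
  | condTrue (M) : SymRule (cond (const S.tt) M) M
  | condFalse (M) : SymRule (cond (const S.ff) M) empty

/-- Ad hoc reduction rules (second stage of normalisation). -/
inductive AdhocRule : QTm S → QTm S → Prop
  | forUnion (A L M N) : AdhocRule (bind A L (union M N)) (union (bind A L M) (bind A L N))
  | forEmpty (A L) : AdhocRule (bind A L empty) empty
  | condUnion (L M N) : AdhocRule (cond L (union M N)) (union (cond L M) (cond L N))
  | condEmpty (L) : AdhocRule (cond L empty) empty
  | condCond (L M N) : AdhocRule (cond L (cond M N)) (cond (conj L M) N)
  | condFor (A L M N) : AdhocRule (cond L (bind A M N)) (bind A M (cond (rename Nat.succ L) N))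

/-- One step of the rules `R` anywhere in a term. -/
inductive Rewrite (R : QTm S → QTm S → Prop) : QTm S → QTm S → Prop
  | rule {M N} : R M N → Rewrite R M N
  | op {o} {M : Fin (S.arity o) → QTm S} {i N} : Rewrite R (M i) N →
      Rewrite R (.op o M) (.op o (Function.update M i N))
  | lam {A M M'} : Rewrite R M M' → Rewrite R (.lam A M) (.lam A M')
  | appL {M M' N} : Rewrite R M M' → Rewrite R (.app M N) (.app M' N)
  | appR {M N N'} : Rewrite R N N' → Rewrite R (.app M N) (.app M N')
  | condL {L L' M} : Rewrite R L L' → Rewrite R (.cond L M) (.cond L' M)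
  | condR {L M M'} : Rewrite R M M' → Rewrite R (.cond L M) (.cond L M')
  | record {n} {l : Fin n ↪ String} {M : Fin n → QTm S} {i N} : Rewrite R (M i) N →
      Rewrite R (.record l M) (.record l (Function.update M i N))
  | proj {M M' l} : Rewrite R M M' → Rewrite R (.proj M l) (.proj M' l)
  | sing {M M'} : Rewrite R M M' → Rewrite R (.sing M) (.sing M')
  | unionL {M M' N} : Rewrite R M M' → Rewrite R (.union M N) (.union M' N)
  | unionR {M N N'} : Rewrite R N N' → Rewrite R (.union M N) (.union M N')
  | bindL {A M M' N} : Rewrite R M M' → Rewrite R (.bind A M N) (.bind A M' N)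
  | bindR {A M N N'} : Rewrite R N N' → Rewrite R (.bind A M N) (.bind A M N')
  | fix {A B M M'} : Rewrite R M M' → Rewrite R (.fix A B M) (.fix A B M')
  | foldL {L L' M N} : Rewrite R L L' → Rewrite R (.fold L M N) (.fold L' M N)
  | foldM {L M M' N} : Rewrite R M M' → Rewrite R (.fold L M N) (.fold L M' N)
  | foldR {L M N N'} : Rewrite R N N' → Rewrite R (.fold L M N) (.fold L M N')
  | query {M M'} : Rewrite R M M' → Rewrite R (.query M) (.query M')
  | quote {M M'} : Rewrite R M M' → Rewrite R (.quote M) (.quote M')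
  | antiquote {M M'} : Rewrite R M M' → Rewrite R (.antiquote M) (.antiquote M')
  | lift {M M'} : Rewrite R M M' → Rewrite R (.lift M) (.lift M')

/-- `IsQuery M q`: the term `M` is the query `q`, up to type annotations on bound variables. -/
inductive IsQuery : QTm S → Query S → Prop
  | var (i) : IsQuery (.var i) (.var i)
  | const (c) : IsQuery (.const c) (.const c)
  | op {o M q} : (∀ i, IsQuery (M i) (q i)) → IsQuery (.op o M) (.op o q)
  | cond {L M q r} : IsQuery L q → IsQuery M r → IsQuery (.cond L M) (.cond q r)
  | record {n} {l : Fin n ↪ String} {M q} : (∀ i, IsQuery (M i) (q i)) →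
      IsQuery (.record l M) (.record l q)
  | proj {M q l} : IsQuery M q → IsQuery (.proj M l) (.proj q l)
  | empty : IsQuery .empty .empty
  | sing {M q} : IsQuery M q → IsQuery (.sing M) (.sing q)
  | union {M N q r} : IsQuery M q → IsQuery N r → IsQuery (.union M N) (.union q r)
  | bind {A M N q r} : IsQuery M q → IsQuery N r → IsQuery (.bind A M N) (.bind q r)
  | table (t) : IsQuery (.table t) (.table t)

/-- `Norm M q`: the query `q` is a normal form of `M`, obtained by rewriting `M` to a normal form
with the symbolic rules and then that term to a normal form with the ad hoc rules. -/
def Norm (M : QTm S) (q : Query S) : Prop :=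
  ∃ M' N : QTm S,
    Relation.ReflTransGen (Rewrite SymRule) M M' ∧ (∀ P, ¬ Rewrite SymRule M' P) ∧
    Relation.ReflTransGen (Rewrite AdhocRule) M' N ∧ (∀ P, ¬ Rewrite AdhocRule N P) ∧
    IsQuery N q

/-- Quotation values: query terms without antiquotation. -/
inductive IsQuotVal : QTm S → Prop
  | var (i) : IsQuotVal (.var i)
  | const (c) : IsQuotVal (.const c)
  | op {o M} : (∀ i, IsQuotVal (M i)) → IsQuotVal (.op o M)
  | lam {A M} : IsQuotVal M → IsQuotVal (.lam A M)
  | app {M N} : IsQuotVal M → IsQuotVal N → IsQuotVal (.app M N)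
  | cond {L M} : IsQuotVal L → IsQuotVal M → IsQuotVal (.cond L M)
  | record {n} {l : Fin n ↪ String} {M : Fin n → QTm S} : (∀ i, IsQuotVal (M i)) →
      IsQuotVal (.record l M)
  | proj {M l} : IsQuotVal M → IsQuotVal (.proj M l)
  | empty : IsQuotVal .empty
  | sing {M} : IsQuotVal M → IsQuotVal (.sing M)
  | union {M N} : IsQuotVal M → IsQuotVal N → IsQuotVal (.union M N)
  | bind {A M N} : IsQuotVal M → IsQuotVal N → IsQuotVal (.bind A M N)
  | table (t) : IsQuotVal (.table t)

/-- The shape of a bag value: empty or a union. -/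
def IsBagShape : QTm S → Prop
  | empty => True
  | union _ _ => True
  | _ => False

/-- Values. Bag values are `[V₁] ⊎ ([V₂] ⊎ (⋯ ⊎ []))`. -/
inductive IsVal : QTm S → Prop
  | const (c) : IsVal (.const c)
  | lam (A M) : IsVal (.lam A M)
  | fix (A B M) : IsVal (.fix A B M)
  | record {n} (l : Fin n ↪ String) {V : Fin n → QTm S} : (∀ i, IsVal (V i)) →
      IsVal (.record l V)
  | nil : IsVal .empty
  | cons {V W} : IsVal V → IsVal W → IsBagShape W → IsVal (.union (.sing V) W)
  | quote {M} : IsQuotVal M → IsVal (.quote M)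

/-- A singleton whose element is a value. -/
def IsValSing (M : QTm S) : Prop := ∃ V, IsVal V ∧ M = sing V

/-- The term that denotes a database value. -/
def ofVal : NVal S → QTm S
  | .const c => const c
  | .record l V => record l fun i => ofVal (V i)
  | .bag V => (List.ofFn fun i => ofVal (V i)).foldr (fun M N => union (sing M) N) empty

/-- The small-step semantics of Quot. `Step δ Ω .host` is the reduction relation of host terms.
`Step δ Ω .quoted` is what happens below a quotation: its congruence rules (names starting with
`q`) are the quotation contexts, and lead to the leftmost antiquotation, which is evaluated by
host steps until it is a quotation value, and then spliced in. -/
inductive Step (δ : (o : S.Op) → (Fin (S.arity o) → S.Const) → S.Const)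
    (Ω : Set (Query S × NVal S)) : Level → QTm S → Option (Query S × NVal S) → QTm S → Prop
  | delta (o c) : Step δ Ω .host (.op o fun i => .const (c i)) none (.const (δ o c))
  | beta {A M V} : IsVal V → Step δ Ω .host (.app (.lam A M) V) none (subst (one V) M)
  | unroll {A B M V} : IsVal V →
      Step δ Ω .host (.app (.fix A B M) V) none (subst (two V (.fix A B M)) M)
  | projRecord {n} {l : Fin n ↪ String} {V : Fin n → QTm S} (i : Fin n) : (∀ j, IsVal (V j)) →
      Step δ Ω .host (.proj (.record l V) (l i)) none (V i)
  | condTrue (M) : Step δ Ω .host (.cond (.const S.tt) M) none M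
  | condFalse (M) : Step δ Ω .host (.cond (.const S.ff) M) none .empty
  | singEta {V} : IsVal V → Step δ Ω .host (.sing V) none (.union (.sing V) .empty)
  | unionNil {V} : IsVal V → Step δ Ω .host (.union .empty V) none V
  | unionCons {V V' V''} : IsVal (.union (.sing V) V') → IsVal V'' →
      Step δ Ω .host (.union (.union (.sing V) V') V'') none (.union (.sing V) (.union V' V''))
  | forNil (A N) : Step δ Ω .host (.bind A .empty N) none .empty
  | forCons {A V W N} : IsVal (.union (.sing V) W) →
      Step δ Ω .host (.bind A (.union (.sing V) W) N) none
        (.union (subst (one V) N) (.bind A W N))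
  | foldNil (M N) : Step δ Ω .host (.fold .empty M N) none M
  | foldCons {V W M N} : IsVal (.union (.sing V) W) →
      Step δ Ω .host (.fold (.union (.sing V) W) M N) none (.app (.app N V) (.fold W M N))
  | runQuery {M q V} : IsQuotVal M → Norm M q → (q, V) ∈ Ω →
      Step δ Ω .host (.query (.quote M)) (some (q, V)) (ofVal V)
  | liftConst (c) : Step δ Ω .host (.lift (.const c)) none (.quote (.const c))
  | op {o} {M : Fin (S.arity o) → QTm S} {i a N} : (∀ j, j < i → IsVal (M j)) →
      Step δ Ω .host (M i) a N → Step δ Ω .host (.op o M) a (.op o (Function.update M i N))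
  | lift {M M' a} : Step δ Ω .host M a M' → Step δ Ω .host (.lift M) a (.lift M')
  | appL {M M' N a} : Step δ Ω .host M a M' → Step δ Ω .host (.app M N) a (.app M' N)
  | appR {V N N' a} : IsVal V → Step δ Ω .host N a N' →
      Step δ Ω .host (.app V N) a (.app V N')
  | record {n} {l : Fin n ↪ String} {M : Fin n → QTm S} {i a N} : (∀ j, j < i → IsVal (M j)) →
      Step δ Ω .host (M i) a N →
      Step δ Ω .host (.record l M) a (.record l (Function.update M i N))
  | proj {M M' l a} : Step δ Ω .host M a M' → Step δ Ω .host (.proj M l) a (.proj M' l)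
  | sing {M M' a} : Step δ Ω .host M a M' → Step δ Ω .host (.sing M) a (.sing M')
  | unionL {M M' N a} : ¬ IsValSing M → Step δ Ω .host M a M' →
      Step δ Ω .host (.union M N) a (.union M' N)
  | unionR {V N N' a} : IsVal V ∨ IsValSing V → Step δ Ω .host N a N' →
      Step δ Ω .host (.union V N) a (.union V N')
  | bind {A M M' N a} : Step δ Ω .host M a M' →
      Step δ Ω .host (.bind A M N) a (.bind A M' N)
  | cond {L L' M a} : Step δ Ω .host L a L' → Step δ Ω .host (.cond L M) a (.cond L' M)
  | fold {L L' M N a} : Step δ Ω .host L a L' →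
      Step δ Ω .host (.fold L M N) a (.fold L' M N)
  | query {M M' a} : Step δ Ω .host M a M' → Step δ Ω .host (.query M) a (.query M')
  | quote {M M' a} : Step δ Ω .quoted M a M' → Step δ Ω .host (.quote M) a (.quote M')
  | antiquote {M M' a} : Step δ Ω .host M a M' →
      Step δ Ω .quoted (.antiquote M) a (.antiquote M')
  | splice {M} : IsQuotVal M → Step δ Ω .quoted (.antiquote (.quote M)) none M
  | qOp {o} {M : Fin (S.arity o) → QTm S} {i a N} : (∀ j, j < i → IsQuotVal (M j)) →
      Step δ Ω .quoted (M i) a N → Step δ Ω .quoted (.op o M) a (.op o (Function.update M i N))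
  | qLam {A M M' a} : Step δ Ω .quoted M a M' → Step δ Ω .quoted (.lam A M) a (.lam A M')
  | qAppL {M M' N a} : Step δ Ω .quoted M a M' → Step δ Ω .quoted (.app M N) a (.app M' N)
  | qAppR {M N N' a} : IsQuotVal M → Step δ Ω .quoted N a N' →
      Step δ Ω .quoted (.app M N) a (.app M N')
  | qRecord {n} {l : Fin n ↪ String} {M : Fin n → QTm S} {i a N} :
      (∀ j, j < i → IsQuotVal (M j)) → Step δ Ω .quoted (M i) a N →
      Step δ Ω .quoted (.record l M) a (.record l (Function.update M i N))
  | qProj {M M' l a} : Step δ Ω .quoted M a M' → Step δ Ω .quoted (.proj M l) a (.proj M' l)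
  | qSing {M M' a} : Step δ Ω .quoted M a M' → Step δ Ω .quoted (.sing M) a (.sing M')
  | qUnionL {M M' N a} : Step δ Ω .quoted M a M' →
      Step δ Ω .quoted (.union M N) a (.union M' N)
  | qUnionR {M N N' a} : IsQuotVal M → Step δ Ω .quoted N a N' →
      Step δ Ω .quoted (.union M N) a (.union M N')
  | qBindL {A M M' N a} : Step δ Ω .quoted M a M' →
      Step δ Ω .quoted (.bind A M N) a (.bind A M' N)
  | qBindR {A M N N' a} : IsQuotVal M → Step δ Ω .quoted N a N' →
      Step δ Ω .quoted (.bind A M N) a (.bind A M N')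
  | qCondL {L L' M a} : Step δ Ω .quoted L a L' → Step δ Ω .quoted (.cond L M) a (.cond L' M)
  | qCondR {L M M' a} : IsQuotVal L → Step δ Ω .quoted M a M' →
      Step δ Ω .quoted (.cond L M) a (.cond L M')

/-- The labelled transition system of Quot (host terms). -/
def lts (δ : (o : S.Op) → (Fin (S.arity o) → S.Const) → S.Const) (Ω : Set (Query S × NVal S)) :
    LTS (QTm S) (Query S × NVal S) where
  tr := Step δ Ω .host

end QTm

/-! ## The splicing translation -/

/-- The translation of types, at a target effect. -/
def ETy.splice {S : Signature} : Effect → ETy S → QTy S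
  | _, .base O => .base O
  | X, .rcd l A => .rcd l fun i => (A i).splice X
  | X, .bag A => .bag (A.splice X)
  | .pl, .fn A .pl B => .fn (A.splice .pl) (B.splice .pl)
  | .db, .fn A .db B => .fn (A.splice .db) (B.splice .db)
  | .pl, .fn A .db B => .quot (.fn (A.splice .db) (B.splice .db))
  | .db, .fn _ .pl _ => .unit

/-- Reification: from a host term of type `A.splice .pl` to a query term of type `A.splice .db`. -/
def reify {S : Signature} : ETy S → QTm S → QTm S
  | .base _, M => .antiquote (.lift M)
  | .fn _ .pl _, _ => .unit
  | .fn _ .db _, M => .antiquote M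
  | .rcd l A, M => .record l fun i => reify (A i) (.proj M (l i))
  | .bag A, M => .antiquote (.fold M (.quote .empty)
      (.lam (A.splice .pl) (.lam (.quot (.bag (A.splice .db)))
        (.quote (.union (.sing (reify A (.var 1))) (.antiquote (.var 0)))))))

/-- The diverging term of type `A`. -/
def errorTm {S : Signature} (A : QTy S) : QTm S :=
  .app (.fix .unit A (.app (.var 1) (.var 0))) .unit

/-- What an effect environment records about one variable `x` of the source term: the type and the
effect at which it was bound, the index of its counterpart in the target term, and, if it was
bound at effect `pl`, the index of the shadow variable that holds its reified value. -/
structure Entry (S : Signature) where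
  ty : ETy S
  eff : Effect
  idx : ℕ
  shadow : ℕ

/-- Effect environments; position `i` of the list describes the variable with index `i`. -/
abbrev EffEnv (S : Signature) := List (Entry S)

namespace EffEnv

variable {S : Signature}

/-- The environment seen from below `k` further binders of the target term. -/
def weaken (k : ℕ) (ρ : EffEnv S) : EffEnv S :=
  List.map (fun e => { e with idx := e.idx + k, shadow := e.shadow + k }) ρ

/-- Extension by `x : A` bound at `pl`; the target binds `x` and then its shadow. -/
def bindPl (A : ETy S) (ρ : EffEnv S) : EffEnv S :=
  ⟨A, .pl, 1, 0⟩ :: weaken 2 ρ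

/-- Extension by `x : A` bound at `db`; the target binds `x` only. -/
def bindDb (A : ETy S) (ρ : EffEnv S) : EffEnv S :=
  ⟨A, .db, 0, 0⟩ :: weaken 1 ρ

/-- Extension by `f : A → B` and `x : A` bound at `pl`; the target binds `f`, `x`, the shadow of
`f` and the shadow of `x`, in this order. -/
def bindFix (A B : ETy S) (ρ : EffEnv S) : EffEnv S :=
  ⟨A, .pl, 2, 0⟩ :: ⟨.fn A .pl B, .pl, 3, 1⟩ :: weaken 4 ρ

/-- The coercion of a variable to a target effect. The value on variables outside of the
environment is irrelevant. -/
def lookup (ρ : EffEnv S) (i : ℕ) (X : Effect) : QTm S :=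
  match ρ[i]? with
  | none => .var i
  | some e =>
    match e.eff, X with
    | .pl, .pl => .var e.idx
    | .db, .db => .var e.idx
    | .db, .pl => errorTm (e.ty.splice .pl)
    | .pl, .db => .antiquote (.var e.shadow)

end EffEnv

/-- The splicing translation of terms, at a target effect and in an effect environment. The clauses
for `table` at `pl`, and for `fold` and `query` at `db`, are never reached from a well-typed
term. -/
def ETm.splice {S : Signature} : ETm S → Effect → EffEnv S → QTm S
  | .var i, X, ρ => ρ.lookup i X
  | .const c, _, _ => .const c
  | .op o M, X, ρ => .op o fun i => (M i).splice X ρ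
  | .lam .pl A M, .pl, ρ =>
      .lam (A.splice .pl) (.letIn (.quot (A.splice .db)) (.quote (reify A (.var 0)))
        (M.splice .pl (ρ.bindPl A)))
  | .lam .db A M, .pl, ρ => .quote (.lam (A.splice .db) (M.splice .db (ρ.bindDb A)))
  | .lam .pl _ _, .db, _ => .unit
  | .lam .db A M, .db, ρ => .lam (A.splice .db) (M.splice .db (ρ.bindDb A))
  | .app M N, X, ρ => .app (M.splice X ρ) (N.splice X ρ)
  | .cond L M, X, ρ => .cond (L.splice X ρ) (M.splice X ρ)
  | .record l M, X, ρ => .record l fun i => (M i).splice X ρ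
  | .proj M l, X, ρ => .proj (M.splice X ρ) l
  | .empty, _, _ => .empty
  | .sing M, X, ρ => .sing (M.splice X ρ)
  | .union M N, X, ρ => .union (M.splice X ρ) (N.splice X ρ)
  | .bind A M N, .pl, ρ =>
      .bind (A.splice .pl) (M.splice .pl ρ)
        (.letIn (.quot (A.splice .db)) (.quote (reify A (.var 0))) (N.splice .pl (ρ.bindPl A)))
  | .bind A M N, .db, ρ => .bind (A.splice .db) (M.splice .db ρ) (N.splice .db (ρ.bindDb A))
  | .fix A B M, .pl, ρ =>
      .fix (A.splice .pl) (B.splice .pl)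
        (.letIn (.quot .unit) (.quote (reify (.fn A .pl B) (.var 1)))
          (.letIn (.quot (A.splice .db)) (.quote (reify A (.var 1)))
            (M.splice .pl (ρ.bindFix A B))))
  | .fix _ _ _, .db, _ => .unit
  | .fold L M N, X, ρ => .fold (L.splice X ρ) (M.splice X ρ) (N.splice X ρ)
  | .query M, _, ρ => .query (.quote (M.splice .db ρ))
  | .table t, _, _ => .table t

end LIQ

/-! ### Renaming and substitution in Quot -/

namespace LIQ

variable {S : Signature}

/-! A relation `Rel` between running Eff terms and running Quot terms contains every closed typed
term with its translation (`ETm.HasTy.rel_splice`). It is a simulation in both directions for the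
transitions "finitely many silent steps, then one visible step". Finite and infinite traces depend
only on such transitions, so related terms have the same traces.

`Rel` has to be larger than the graph of the translation. When a value V replaces a variable bound
at pl, its occurrences at db become V in Eff, but in Quot they become an antiquotation of the quoted
reification of V. For closed V this quotation is given by `erase`, the translation at db without an
environment, which turns functions of effect pl into the empty record. So `Rel` is the translation
in which closed terms may already have been spliced in as erasures. It is stable under substitutions
that supply both a value and its quoted erasure (`Rel.subst`).

Two evaluation facts drive the simulation: below a quotation, a term related to M at db evaluates to
`erase M` (`Rel.quotedSteps`), and the reification of a value V evaluates to `erase V`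
(`Rel.reify_steps`). They give the case analysis `Rel.outcome`: two related terms both reach values,
or singletons of values, or both move silently to related terms (Quot at least once), or both are
about to run the same query, or both are stuck.

At a query, Eff normalises M and Quot normalises `erase M`. Every rewrite of `erase M` comes from
one of M, and every rewrite of M is seen by `erase M` unless it takes place in an erased function
body. At a flat bag type a normal form contains no function, hence no erased part, so the normal
forms are the same queries (`ETm.norm_erase`). Both sides then accept the same responses, and type
safety of the responses makes them related again.

From Quot to Eff a termination argument is needed, since one Eff step may cost many Quot steps.
Silent steps are deterministic, so a Quot term that can reach a visible step has only one, finite,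
silent run before it, and every matched Eff step uses up a nonempty part of this run. -/

theorem upRen_comp (r r' : ℕ → ℕ) : (fun i => upRen r (upRen r' i)) = upRen fun i => r (r' i) := by
  funext i; cases i <;> rfl

namespace QTm

theorem up_var : up (var : ℕ → QTm S) = var := by
  funext i; cases i <;> rfl

theorem up_var_comp (r : ℕ → ℕ) : up (fun i => (var (r i) : QTm S)) = fun i => var (upRen r i) := by
  funext i; cases i <;> rfl

theorem subst_var (M : QTm S) : subst var M = M := by
  induction M <;> simp_all [subst, up_var]

theorem rename_eq_subst (r : ℕ → ℕ) (M : QTm S) : rename r M = subst (fun i => var (r i)) M := by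
  induction M generalizing r <;> simp_all [subst, rename, up_var_comp]

theorem up_comp_upRen (s : ℕ → QTm S) (r : ℕ → ℕ) :
    (fun i => up s (upRen r i)) = up fun i => s (r i) := by
  funext i; cases i <;> rfl

theorem subst_rename (s : ℕ → QTm S) (r : ℕ → ℕ) (M : QTm S) :
    subst s (rename r M) = subst (fun i => s (r i)) M := by
  induction M generalizing r s <;> simp_all [subst, rename, up_comp_upRen]

theorem rename_rename (r r' : ℕ → ℕ) (M : QTm S) :
    rename r (rename r' M) = rename (fun i => r (r' i)) M := by
  rw [rename_eq_subst, subst_rename, rename_eq_subst (fun i => r (r' i))]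

theorem rename_up (r : ℕ → ℕ) (s : ℕ → QTm S) :
    (fun i => rename (upRen r) (up s i)) = up fun i => rename r (s i) := by
  funext i
  cases i with
  | zero => rfl
  | succ n => simp only [up, rename_rename]; rfl

theorem rename_subst (r : ℕ → ℕ) (s : ℕ → QTm S) (M : QTm S) :
    rename r (subst s M) = subst (fun i => rename r (s i)) M := by
  induction M generalizing r s <;> simp_all [subst, rename, rename_up]

theorem subst_up (t s : ℕ → QTm S) :
    (fun i => subst (up t) (up s i)) = up fun i => subst t (s i) := by
  funext i
  cases i with
  | zero => rfl
  | succ n => simp only [up, subst_rename, rename_subst]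

theorem subst_subst (t s : ℕ → QTm S) (M : QTm S) :
    subst t (subst s M) = subst (fun i => subst t (s i)) M := by
  induction M generalizing t s <;> simp_all [subst, subst_up]

theorem subst_one_rename_succ (V M : QTm S) : subst (one V) (rename Nat.succ M) = M := by
  rw [subst_rename]; exact subst_var M

/-- Not definitional: two functions out of `Fin 0` have to be identified. -/
theorem rename_unit (r : ℕ → ℕ) : rename r (unit : QTm S) = unit := by
  simp only [unit, rename]; congr 1; funext i; exact i.elim0

theorem subst_unit (s : ℕ → QTm S) : subst s (unit : QTm S) = unit := by
  simp only [unit, subst]; congr 1; funext i; exact i.elim0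

theorem isQuotVal_unit : IsQuotVal (unit : QTm S) := .record fun i => i.elim0

end QTm

/-! ### Erasure, and typing of what it keeps -/

namespace ETm

/-- The translation at target `db` of a term without variables bound at `pl`. -/
def erase : ETm S → QTm S
  | var i => .var i
  | const c => .const c
  | op o M => .op o fun i => erase (M i)
  | lam .db A M => .lam (A.splice .db) (erase M)
  | lam .pl _ _ => .unit
  | app M N => .app (erase M) (erase N)
  | cond L M => .cond (erase L) (erase M)
  | record l M => .record l fun i => erase (M i)
  | proj M l => .proj (erase M) l
  | empty => .empty
  | sing M => .sing (erase M)
  | union M N => .union (erase M) (erase N)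
  | bind A M N => .bind (A.splice .db) (erase M) (erase N)
  | fix _ _ _ => .unit
  | fold L M N => .fold (erase L) (erase M) (erase N)
  | query M => .query (erase M)
  | table t => .table t

theorem erase_rename (r : ℕ → ℕ) (M : ETm S) : erase (rename r M) = (erase M).rename r := by
  induction M generalizing r with
  | lam E A M ih => cases E <;> simp [erase, rename, QTm.rename, ih, QTm.rename_unit]
  | fix => simp [erase, rename, QTm.rename_unit]
  | _ => simp_all [erase, rename, QTm.rename]

theorem erase_up (s : ℕ → ETm S) : (fun i => erase (up s i)) = QTm.up fun i => erase (s i) := by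
  funext i
  cases i with
  | zero => rfl
  | succ n => exact erase_rename _ _

theorem erase_subst (s : ℕ → ETm S) (M : ETm S) :
    erase (subst s M) = (erase M).subst fun i => erase (s i) := by
  induction M generalizing s with
  | lam E A M ih => cases E <;> simp [erase, subst, QTm.subst, ih, QTm.subst_unit, erase_up]
  | fix => simp [erase, subst, QTm.subst_unit]
  | _ => simp_all [erase, subst, QTm.subst, erase_up]

theorem erase_one (M N : ETm S) : erase (subst (one N) M) = (erase M).subst (QTm.one (erase N)) := by
  rw [erase_subst]; congr 1; funext i; cases i <;> rfl

theorem erase_conj (L M : ETm S) : erase (conj L M) = QTm.conj (erase L) (erase M) := by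
  simp only [conj, erase, QTm.conj]; congr 1; funext i; split <;> rfl

theorem erase_update {n : ℕ} (M : Fin n → ETm S) (i : Fin n) (N : ETm S) :
    (fun j => erase (Function.update M i N j)) =
      Function.update (fun j => erase (M j)) i (erase N) := by
  funext j
  by_cases h : j = i
  · subst h; simp
  · simp [h]

/-- Typing of the part of a term that the translation at target `db` keeps. -/
inductive DbTyped : List (ETy S) → ETm S → ETy S → Prop
  | var {Γ i A} : Γ[i]? = some A → DbTyped Γ (.var i) A
  | const {Γ c O} : S.constTy c = O → DbTyped Γ (.const c) (.base O)
  | op {Γ o M O} : (∀ i, DbTyped Γ (M i) (.base (S.argTy o i))) → S.resTy o = O →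
      DbTyped Γ (.op o M) (.base O)
  | lamDb {Γ A B M} : DbTyped (A :: Γ) M B → DbTyped Γ (.lam .db A M) (.fn A .db B)
  | lamPl {Γ A B M} : DbTyped Γ (.lam .pl A M) (.fn A .pl B)
  | fix {Γ A B M} : DbTyped Γ (.fix A B M) (.fn A .pl B)
  | app {Γ M N A B} : DbTyped Γ M (.fn A .db B) → DbTyped Γ N A → DbTyped Γ (.app M N) B
  | cond {Γ L M A} : DbTyped Γ L (.base S.bool) → DbTyped Γ M (.bag A) →
      DbTyped Γ (.cond L M) (.bag A)
  | record {Γ n} {l : Fin n ↪ String} {M A} : (∀ i, DbTyped Γ (M i) (A i)) →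
      DbTyped Γ (.record l M) (.rcd l A)
  | proj {Γ M n} {l : Fin n ↪ String} {A s B} (i : Fin n) : DbTyped Γ M (.rcd l A) → l i = s →
      A i = B → DbTyped Γ (.proj M s) B
  | empty {Γ A} : DbTyped Γ .empty (.bag A)
  | sing {Γ M A} : DbTyped Γ M A → DbTyped Γ (.sing M) (.bag A)
  | union {Γ M N A} : DbTyped Γ M (.bag A) → DbTyped Γ N (.bag A) → DbTyped Γ (.union M N) (.bag A)
  | bind {Γ M N A B} : DbTyped Γ M (.bag A) → DbTyped (A :: Γ) N (.bag B) →
      DbTyped Γ (.bind A M N) (.bag B)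
  | table {Γ t A} : .bag (.row (S.col t) (S.colTy t)) = A → DbTyped Γ (.table t) A

namespace DbTyped

theorem rename {Γ Δ : List (ETy S)} {M : ETm S} {A : ETy S} (h : DbTyped Γ M A) {r : ℕ → ℕ}
    (hr : ∀ i A, Γ[i]? = some A → Δ[r i]? = some A) : DbTyped Δ (M.rename r) A := by
  have key : ∀ {Γ Δ : List (ETy S)} {r : ℕ → ℕ} (B : ETy S),
      (∀ i A, Γ[i]? = some A → Δ[r i]? = some A) →
      ∀ i A, (B :: Γ)[i]? = some A → (B :: Δ)[upRen r i]? = some A := by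
    intro Γ Δ r B h i A hi
    cases i with
    | zero => simpa [upRen] using hi
    | succ n => simpa [upRen] using h n A (by simpa using hi)
  induction h generalizing Δ r with
  | var h => exact .var (hr _ _ h)
  | const h => exact .const h
  | op _ h ih => exact .op (fun i => ih i hr) h
  | lamDb _ ih => exact .lamDb (ih (key _ hr))
  | lamPl => exact .lamPl
  | fix => exact .fix
  | app _ _ ih1 ih2 => exact .app (ih1 hr) (ih2 hr)
  | cond _ _ ih1 ih2 => exact .cond (ih1 hr) (ih2 hr)
  | record _ ih => exact .record fun i => ih i hr
  | proj i _ h1 h2 ih => exact .proj i (ih hr) h1 h2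
  | empty => exact .empty
  | sing _ ih => exact .sing (ih hr)
  | union _ _ ih1 ih2 => exact .union (ih1 hr) (ih2 hr)
  | bind _ _ ih1 ih2 => exact .bind (ih1 hr) (ih2 (key _ hr))
  | table h => exact .table h

theorem weaken {Γ : List (ETy S)} {M : ETm S} {A : ETy S} (h : DbTyped Γ M A) (B : ETy S) :
    DbTyped (B :: Γ) (M.rename Nat.succ) A :=
  h.rename fun i A hi => by simpa using hi

theorem subst {Γ Δ : List (ETy S)} {M : ETm S} {A : ETy S} (h : DbTyped Γ M A) {s : ℕ → ETm S}
    (hs : ∀ i A, Γ[i]? = some A → DbTyped Δ (s i) A) : DbTyped Δ (M.subst s) A := by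
  have key : ∀ {Γ Δ : List (ETy S)} {s : ℕ → ETm S} (B : ETy S),
      (∀ i A, Γ[i]? = some A → DbTyped Δ (s i) A) →
      ∀ i A, (B :: Γ)[i]? = some A → DbTyped (B :: Δ) (up s i) A := by
    intro Γ Δ r B h i A hi
    cases i with
    | zero => exact .var (by simpa using hi)
    | succ n => exact (h n A (by simpa using hi)).weaken B
  induction h generalizing Δ s with
  | var h => exact hs _ _ h
  | const h => exact .const h
  | op _ h ih => exact .op (fun i => ih i hs) h
  | lamDb _ ih => exact .lamDb (ih (key _ hs))
  | lamPl => exact .lamPl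
  | fix => exact .fix
  | app _ _ ih1 ih2 => exact .app (ih1 hs) (ih2 hs)
  | cond _ _ ih1 ih2 => exact .cond (ih1 hs) (ih2 hs)
  | record _ ih => exact .record fun i => ih i hs
  | proj i _ h1 h2 ih => exact .proj i (ih hs) h1 h2
  | empty => exact .empty
  | sing _ ih => exact .sing (ih hs)
  | union _ _ ih1 ih2 => exact .union (ih1 hs) (ih2 hs)
  | bind _ _ ih1 ih2 => exact .bind (ih1 hs) (ih2 (key _ hs))
  | table h => exact .table h

theorem subst_one {Γ : List (ETy S)} {M N : ETm S} {A B : ETy S} (h : DbTyped (A :: Γ) M B)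
    (hN : DbTyped Γ N A) : DbTyped Γ (M.subst (one N)) B := by
  refine h.subst fun i C hi => ?_
  cases i with
  | zero => simp at hi; subst hi; exact hN
  | succ n => exact .var (by simpa using hi)

/-- Serves to move closed terms into an arbitrary context without renaming them. -/
theorem mono {Γ Δ : List (ETy S)} {M : ETm S} {A : ETy S} (h : DbTyped Γ M A)
    (hr : ∀ (i : ℕ) (A : ETy S), Γ[i]? = some A → Δ[i]? = some A) : DbTyped Δ M A := by
  have key : ∀ {Γ Δ : List (ETy S)} (B : ETy S),
      (∀ (i : ℕ) (A : ETy S), Γ[i]? = some A → Δ[i]? = some A) →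
      ∀ (i : ℕ) (A : ETy S), (B :: Γ)[i]? = some A → (B :: Δ)[i]? = some A := by
    intro Γ Δ B h i A hi
    cases i with
    | zero => simpa using hi
    | succ n => simpa using h n A (by simpa using hi)
  induction h generalizing Δ with
  | var h => exact .var (hr _ _ h)
  | const h => exact .const h
  | op _ h ih => exact .op (fun i => ih i hr) h
  | lamDb _ ih => exact .lamDb (ih (key _ hr))
  | lamPl => exact .lamPl
  | fix => exact .fix
  | app _ _ ih1 ih2 => exact .app (ih1 hr) (ih2 hr)
  | cond _ _ ih1 ih2 => exact .cond (ih1 hr) (ih2 hr)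
  | record _ ih => exact .record fun i => ih i hr
  | proj i _ h1 h2 ih => exact .proj i (ih hr) h1 h2
  | empty => exact .empty
  | sing _ ih => exact .sing (ih hr)
  | union _ _ ih1 ih2 => exact .union (ih1 hr) (ih2 hr)
  | bind _ _ ih1 ih2 => exact .bind (ih1 hr) (ih2 (key _ hr))
  | table h => exact .table h

theorem of_nil {Γ : List (ETy S)} {M : ETm S} {A : ETy S} (h : DbTyped [] M A) : DbTyped Γ M A :=
  h.mono (by simp)

/-- `DbTyped` has no rule for `fold` or `query`, and `fix` is erased, so only constructors allowed
in a quotation remain. -/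
theorem isQuotVal_erase {Γ : List (ETy S)} {M : ETm S} {A : ETy S} (h : DbTyped Γ M A) :
    QTm.IsQuotVal (erase M) := by
  induction h with
  | lamPl => exact QTm.isQuotVal_unit
  | fix => exact QTm.isQuotVal_unit
  | _ => constructor <;> assumption

/-- `DbTyped` says nothing about the bodies of erased functions, which may have free variables
outside of `Γ`. These variables disappear with the bodies, so `t` matters only on the variables that
`Γ` types. -/
theorem subst_erase {Γ : List (ETy S)} {M : ETm S} {A : ETy S} (h : DbTyped Γ M A)
    {t : ℕ → QTm S} (ht : ∀ i A, Γ[i]? = some A → t i = .var i) :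
    (erase M).subst t = erase M := by
  have key : ∀ {Γ : List (ETy S)} {t : ℕ → QTm S} (B : ETy S),
      (∀ i A, Γ[i]? = some A → t i = .var i) →
      ∀ i A, (B :: Γ)[i]? = some A → QTm.up t i = .var i := by
    intro Γ t B h i A hi
    cases i with
    | zero => rfl
    | succ n => simp [QTm.up, h n A (by simpa using hi), QTm.rename]
  induction h generalizing t with
  | var h => exact ht _ _ h
  | lamPl => exact QTm.subst_unit _
  | fix => exact QTm.subst_unit _
  | lamDb _ ih => simp [erase, QTm.subst, ih (key _ ht)]
  | bind _ _ ih1 ih2 => simp [erase, QTm.subst, ih1 ht, ih2 (key _ ht)]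
  | op _ h ih => simp [erase, QTm.subst, fun i => ih i ht]
  | record _ ih => simp [erase, QTm.subst, fun i => ih i ht]
  | app _ _ ih1 ih2 => simp [erase, QTm.subst, ih1 ht, ih2 ht]
  | cond _ _ ih1 ih2 => simp [erase, QTm.subst, ih1 ht, ih2 ht]
  | union _ _ ih1 ih2 => simp [erase, QTm.subst, ih1 ht, ih2 ht]
  | sing _ ih => simp [erase, QTm.subst, ih ht]
  | proj _ _ _ _ ih => simp [erase, QTm.subst, ih ht]
  | _ => rfl

theorem subst_erase_nil {M : ETm S} {A : ETy S} (h : DbTyped [] M A) (t : ℕ → QTm S) :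
    (erase M).subst t = erase M := h.subst_erase (by simp)

theorem rename_erase_nil {M : ETm S} {A : ETy S} (h : DbTyped [] M A) (r : ℕ → ℕ) :
    (erase M).rename r = erase M := by
  rw [QTm.rename_eq_subst, h.subst_erase_nil]

/-- Typing is essential for β: it forces the head of an application to be an abstraction of effect
db. The redex of an abstraction of effect pl would be translated to an application of the empty
record, which is not a redex. -/
theorem symRule {Γ : List (ETy S)} {M N : ETm S} {A : ETy S} (h : DbTyped Γ M A)
    (hr : SymRule M N) : QTm.SymRule (erase M) (erase N) ∧ DbTyped Γ N A := by
  cases hr with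
  | beta E A M N =>
    cases h with
    | app h1 h2 =>
      cases h1 with
      | lamDb h1 => exact ⟨by rw [erase_one]; exact .beta _ _ _, h1.subst_one h2⟩
  | proj l M i =>
    cases h with
    | proj j h1 h2 h3 =>
      cases h1 with
      | record h1 =>
        have := l.injective h2
        subst this; subst h3
        exact ⟨.proj l (fun i => erase (M i)) j, h1 j⟩
  | forSing A M N =>
    cases h with
    | bind h1 h2 =>
      cases h1 with
      | sing h1 => exact ⟨by rw [erase_one]; exact .forSing _ _ _, h2.subst_one h1⟩
  | forFor A B L M N =>
    cases h with
    | bind h1 h2 =>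
      cases h1 with
      | bind h0 h1 =>
        refine ⟨by simp only [erase, erase_rename]; exact .forFor _ _ _ _ _,
          .bind h0 (.bind h1 (h2.rename fun i C hi => ?_))⟩
        cases i with
        | zero => simpa [upRen] using hi
        | succ n => simpa [upRen] using hi
  | forCond A L M N =>
    cases h with
    | bind h1 h2 =>
      cases h1 with
      | cond h0 h1 => exact ⟨.forCond _ _ _ _, .cond h0 (.bind h1 h2)⟩
  | forEmpty A N =>
    cases h with
    | bind h1 h2 => exact ⟨.forEmpty _ _, .empty⟩
  | forUnion A L M N =>
    cases h with
    | bind h1 h2 =>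
      cases h1 with
      | union h0 h1 => exact ⟨.forUnion _ _ _ _, .union (.bind h0 h2) (.bind h1 h2)⟩
  | condTrue =>
    cases h with
    | cond h1 h2 => exact ⟨.condTrue _, h2⟩
  | condFalse =>
    cases h with
    | cond h1 h2 => exact ⟨.condFalse _, .empty⟩

theorem conj {Γ : List (ETy S)} {L M : ETm S} (hL : DbTyped Γ L (.base S.bool))
    (hM : DbTyped Γ M (.base S.bool)) : DbTyped Γ (conj L M) (.base S.bool) := by
  refine .op (fun i => ?_) S.conj_resTy
  rw [S.conj_argTy]
  split <;> assumption

theorem adhocRule {Γ : List (ETy S)} {M N : ETm S} {A : ETy S} (h : DbTyped Γ M A)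
    (hr : AdhocRule M N) : QTm.AdhocRule (erase M) (erase N) ∧ DbTyped Γ N A := by
  cases hr with
  | forUnion A L M N =>
    cases h with
    | bind h1 h2 =>
      cases h2 with
      | union h2 h3 => exact ⟨.forUnion _ _ _ _, .union (.bind h1 h2) (.bind h1 h3)⟩
  | forEmpty A L =>
    cases h with
    | bind h1 h2 => exact ⟨.forEmpty _ _, .empty⟩
  | condUnion L M N =>
    cases h with
    | cond h1 h2 =>
      cases h2 with
      | union h2 h3 => exact ⟨.condUnion _ _ _, .union (.cond h1 h2) (.cond h1 h3)⟩
  | condEmpty L =>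
    cases h with
    | cond h1 h2 => exact ⟨.condEmpty _, .empty⟩
  | condCond L M N =>
    cases h with
    | cond h1 h2 =>
      cases h2 with
      | cond h2 h3 =>
        exact ⟨by simp only [erase, erase_conj]; exact .condCond _ _ _, .cond (h1.conj h2) h3⟩
  | condFor A L M N =>
    cases h with
    | cond h1 h2 =>
      cases h2 with
      | bind h2 h3 =>
        exact ⟨by simp only [erase, erase_rename]; exact .condFor _ _ _ _,
          .bind h2 (.cond (h1.weaken _) h3)⟩

theorem forall_update {Γ : List (ETy S)} {n : ℕ} {M : Fin n → ETm S} {A : Fin n → ETy S}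
    (h : ∀ i, DbTyped Γ (M i) (A i)) {i : Fin n} {N : ETm S} (hN : DbTyped Γ N (A i)) (j : Fin n) :
    DbTyped Γ (Function.update M i N j) (A j) := by
  by_cases hj : j = i
  · subst hj; simpa using hN
  · simpa [hj] using h j

/-- Rewriting preserves types, and the translation follows it unless it happens in an erased
subterm. -/
theorem rewrite {R : ETm S → ETm S → Prop} {R' : QTm S → QTm S → Prop}
    (hR : ∀ {Γ A M N}, DbTyped Γ M A → R M N → R' (erase M) (erase N) ∧ DbTyped Γ N A)
    {Γ : List (ETy S)} {M N : ETm S} {A : ETy S} (h : DbTyped Γ M A) (hr : Rewrite R M N) :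
    (QTm.Rewrite R' (erase M) (erase N) ∨ erase M = erase N) ∧ DbTyped Γ N A := by
  induction hr generalizing Γ A with
  | rule hr => exact ⟨.inl (.rule (hR h hr).1), (hR h hr).2⟩
  | op _ ih =>
    cases h with
    | op h1 h2 =>
      refine ⟨?_, .op (forall_update h1 (ih (h1 _)).2) h2⟩
      simp only [erase, erase_update]
      refine (ih (h1 _)).1.imp .op fun h => ?_
      rw [← h, Function.update_eq_self]
  | record _ ih =>
    cases h with
    | record h1 =>
      refine ⟨?_, .record (forall_update h1 (ih (h1 _)).2)⟩
      simp only [erase, erase_update]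
      refine (ih (h1 _)).1.imp .record fun h => ?_
      rw [← h, Function.update_eq_self]
  | lam _ ih =>
    cases h with
    | lamDb h => exact ⟨(ih h).1.imp .lam fun h => by simp [erase, h], .lamDb (ih h).2⟩
    | lamPl => exact ⟨.inr rfl, .lamPl⟩
  | fix =>
    cases h with
    | fix => exact ⟨.inr rfl, .fix⟩
  | appL _ ih =>
    cases h with
    | app h h' => exact ⟨(ih h).1.imp .appL fun h => by simp [erase, h], .app (ih h).2 h'⟩
  | appR _ ih =>
    cases h with
    | app h' h => exact ⟨(ih h).1.imp .appR fun h => by simp [erase, h], .app h' (ih h).2⟩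
  | condL _ ih =>
    cases h with
    | cond h h' => exact ⟨(ih h).1.imp .condL fun h => by simp [erase, h], .cond (ih h).2 h'⟩
  | condR _ ih =>
    cases h with
    | cond h' h => exact ⟨(ih h).1.imp .condR fun h => by simp [erase, h], .cond h' (ih h).2⟩
  | unionL _ ih =>
    cases h with
    | union h h' => exact ⟨(ih h).1.imp .unionL fun h => by simp [erase, h], .union (ih h).2 h'⟩
  | unionR _ ih =>
    cases h with
    | union h' h => exact ⟨(ih h).1.imp .unionR fun h => by simp [erase, h], .union h' (ih h).2⟩
  | bindL _ ih =>
    cases h with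
    | bind h h' => exact ⟨(ih h).1.imp .bindL fun h => by simp [erase, h], .bind (ih h).2 h'⟩
  | bindR _ ih =>
    cases h with
    | bind h' h => exact ⟨(ih h).1.imp .bindR fun h => by simp [erase, h], .bind h' (ih h).2⟩
  | proj _ ih =>
    cases h with
    | proj i h h1 h2 =>
      exact ⟨(ih h).1.imp .proj fun h => by simp [erase, h], .proj i (ih h).2 h1 h2⟩
  | sing _ ih =>
    cases h with
    | sing h => exact ⟨(ih h).1.imp .sing fun h => by simp [erase, h], .sing (ih h).2⟩
  | _ => cases h

theorem rewrite_star {R : ETm S → ETm S → Prop} {R' : QTm S → QTm S → Prop}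
    (hR : ∀ {Γ A M N}, DbTyped Γ M A → R M N → R' (erase M) (erase N) ∧ DbTyped Γ N A)
    {Γ : List (ETy S)} {M N : ETm S} {A : ETy S} (h : DbTyped Γ M A)
    (hr : Relation.ReflTransGen (Rewrite R) M N) :
    Relation.ReflTransGen (QTm.Rewrite R') (erase M) (erase N) ∧ DbTyped Γ N A := by
  induction hr with
  | refl => exact ⟨.refl, h⟩
  | tail _ hr ih =>
    obtain ⟨h1, h2⟩ := ih.2.rewrite hR hr
    exact ⟨h1.elim (fun h => ih.1.tail h) (fun h => h ▸ ih.1), h2⟩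

end DbTyped

/-! ### Reflection of rewriting along the translation -/

theorem erase_eq_lam {M : ETm S} {A N} (h : erase M = .lam A N) :
    ∃ A' M', M = .lam .db A' M' ∧ N = erase M' := by
  cases M with
  | lam E A M => cases E <;> simp_all [erase, QTm.unit]
  | _ => simp_all [erase, QTm.unit]

theorem erase_eq_const {M : ETm S} {c} (h : erase M = .const c) : M = .const c := by
  cases M with
  | lam E A M => cases E <;> simp_all [erase, QTm.unit]
  | _ => simp_all [erase, QTm.unit]

theorem erase_eq_empty {M : ETm S} (h : erase M = .empty) : M = .empty := by
  cases M with
  | lam E A M => cases E <;> simp_all [erase, QTm.unit]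
  | _ => simp_all [erase, QTm.unit]

theorem erase_eq_sing {M : ETm S} {N} (h : erase M = .sing N) :
    ∃ M', M = .sing M' ∧ N = erase M' := by
  cases M with
  | lam E A M => cases E <;> simp_all [erase, QTm.unit]
  | _ => simp_all [erase, QTm.unit]

theorem erase_eq_union {M : ETm S} {N P} (h : erase M = .union N P) :
    ∃ M' M'', M = .union M' M'' ∧ N = erase M' ∧ P = erase M'' := by
  cases M with
  | lam E A M => cases E <;> simp_all [erase, QTm.unit]
  | _ => simp_all [erase, QTm.unit]

theorem erase_eq_cond {M : ETm S} {N P} (h : erase M = .cond N P) :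
    ∃ M' M'', M = .cond M' M'' ∧ N = erase M' ∧ P = erase M'' := by
  cases M with
  | lam E A M => cases E <;> simp_all [erase, QTm.unit]
  | _ => simp_all [erase, QTm.unit]

theorem erase_eq_bind {M : ETm S} {A N P} (h : erase M = .bind A N P) :
    ∃ A' M' M'', M = .bind A' M' M'' ∧ A = A'.splice .db ∧ N = erase M' ∧ P = erase M'' := by
  cases M with
  | lam E A M => cases E <;> simp_all [erase, QTm.unit]
  | _ => simp_all [erase, QTm.unit]

theorem erase_eq_app {M : ETm S} {N P} (h : erase M = .app N P) :
    ∃ M' M'', M = .app M' M'' ∧ N = erase M' ∧ P = erase M'' := by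
  cases M with
  | lam E A M => cases E <;> simp_all [erase, QTm.unit]
  | _ => simp_all [erase, QTm.unit]

theorem erase_eq_proj {M : ETm S} {N l} (h : erase M = .proj N l) :
    ∃ M', M = .proj M' l ∧ N = erase M' := by
  cases M with
  | lam E A M => cases E <;> simp_all [erase, QTm.unit]
  | _ => simp_all [erase, QTm.unit]

/-- The argument `i` makes the record nonempty; the empty record is also the erasure of every
function of effect pl. -/
theorem erase_eq_record {M : ETm S} {n} {l : Fin n ↪ String} {N} (h : erase M = .record l N)
    (i : Fin n) : ∃ M', M = .record l M' ∧ N = fun i => erase (M' i) := by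
  cases M with
  | record l' M' =>
    simp only [erase] at h
    cases h
    exact ⟨M', rfl, rfl⟩
  | lam E A M =>
    cases E
    · simp only [erase, QTm.unit] at h
      cases h
      exact i.elim0
    · simp [erase] at h
  | fix =>
    simp only [erase, QTm.unit] at h
    cases h
    exact i.elim0
  | _ => simp [erase] at h

/-- No typing is needed in this direction. The left-hand sides of the rules inspect only
constructors whose preimage under `erase` is determined; in the projection rule, the projected label
shows that the record is nonempty. -/
theorem symRule_reflect {M : ETm S} {P : QTm S} (h : QTm.SymRule (erase M) P) :
    ∃ N, SymRule M N ∧ erase N = P := by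
  generalize hX : erase M = X at h
  cases h with
  | beta A N N' =>
    obtain ⟨M1, M2, rfl, h1, rfl⟩ := erase_eq_app hX
    obtain ⟨A', M', rfl, rfl⟩ := erase_eq_lam h1.symm
    exact ⟨_, .beta _ _ _ _, erase_one _ _⟩
  | proj l N i =>
    obtain ⟨M', rfl, h1⟩ := erase_eq_proj hX
    obtain ⟨M', rfl, rfl⟩ := erase_eq_record h1.symm i
    exact ⟨_, .proj _ _ _, rfl⟩
  | forSing A N N' =>
    obtain ⟨A', M1, M2, rfl, -, h1, rfl⟩ := erase_eq_bind hX
    obtain ⟨M', rfl, rfl⟩ := erase_eq_sing h1.symm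
    exact ⟨_, .forSing _ _ _, erase_one _ _⟩
  | forFor A B L N N' =>
    obtain ⟨A', M1, M2, rfl, rfl, h1, rfl⟩ := erase_eq_bind hX
    obtain ⟨A', M1, M2, rfl, rfl, rfl, rfl⟩ := erase_eq_bind h1.symm
    exact ⟨_, .forFor _ _ _ _ _, by simp only [erase, erase_rename]⟩
  | forCond A L N N' =>
    obtain ⟨A', M1, M2, rfl, rfl, h1, rfl⟩ := erase_eq_bind hX
    obtain ⟨M1, M2, rfl, rfl, rfl⟩ := erase_eq_cond h1.symm
    exact ⟨_, .forCond _ _ _ _, rfl⟩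
  | forEmpty A N =>
    obtain ⟨A', M1, M2, rfl, rfl, h1, rfl⟩ := erase_eq_bind hX
    cases erase_eq_empty h1.symm
    exact ⟨_, .forEmpty _ _, rfl⟩
  | forUnion A L N N' =>
    obtain ⟨A', M1, M2, rfl, rfl, h1, rfl⟩ := erase_eq_bind hX
    obtain ⟨M1, M2, rfl, rfl, rfl⟩ := erase_eq_union h1.symm
    exact ⟨_, .forUnion _ _ _ _, rfl⟩
  | condTrue =>
    obtain ⟨M1, M2, rfl, h1, rfl⟩ := erase_eq_cond hX
    cases erase_eq_const h1.symm
    exact ⟨_, .condTrue _, rfl⟩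
  | condFalse =>
    obtain ⟨M1, M2, rfl, h1, rfl⟩ := erase_eq_cond hX
    cases erase_eq_const h1.symm
    exact ⟨_, .condFalse _, rfl⟩

theorem adhocRule_reflect {M : ETm S} {P : QTm S} (h : QTm.AdhocRule (erase M) P) :
    ∃ N, AdhocRule M N ∧ erase N = P := by
  generalize hX : erase M = X at h
  cases h with
  | forUnion A L N N' =>
    obtain ⟨A', M1, M2, rfl, rfl, rfl, h1⟩ := erase_eq_bind hX
    obtain ⟨M1, M2, rfl, rfl, rfl⟩ := erase_eq_union h1.symm
    exact ⟨_, .forUnion _ _ _ _, rfl⟩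
  | forEmpty A L =>
    obtain ⟨A', M1, M2, rfl, rfl, rfl, h1⟩ := erase_eq_bind hX
    cases erase_eq_empty h1.symm
    exact ⟨_, .forEmpty _ _, rfl⟩
  | condUnion L N N' =>
    obtain ⟨M1, M2, rfl, rfl, h1⟩ := erase_eq_cond hX
    obtain ⟨M1, M2, rfl, rfl, rfl⟩ := erase_eq_union h1.symm
    exact ⟨_, .condUnion _ _ _, rfl⟩
  | condEmpty L =>
    obtain ⟨M1, M2, rfl, rfl, h1⟩ := erase_eq_cond hX
    cases erase_eq_empty h1.symm
    exact ⟨_, .condEmpty _, rfl⟩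
  | condCond L N N' =>
    obtain ⟨M1, M2, rfl, rfl, h1⟩ := erase_eq_cond hX
    obtain ⟨M1, M2, rfl, rfl, rfl⟩ := erase_eq_cond h1.symm
    exact ⟨_, .condCond _ _ _, by simp only [erase, erase_conj]⟩
  | condFor A L N N' =>
    obtain ⟨M1, M2, rfl, rfl, h1⟩ := erase_eq_cond hX
    obtain ⟨A', M1, M2, rfl, rfl, rfl, rfl⟩ := erase_eq_bind h1.symm
    exact ⟨_, .condFor _ _ _ _, by simp only [erase, erase_rename]⟩

/-- The induction is on the source term: away from its root, a rewrite lies in an immediate subterm,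
which is itself an erasure. An erased function becomes the empty record, which has no components
and, by `hunit`, is no redex, so nothing is to be reflected there. -/
theorem rewrite_reflect {R : ETm S → ETm S → Prop} {R' : QTm S → QTm S → Prop}
    (hR : ∀ {M P}, R' (erase M) P → ∃ N, R M N ∧ erase N = P)
    (hunit : ∀ P, ¬ R' .unit P)
    {M : ETm S} {P : QTm S} (h : QTm.Rewrite R' (erase M) P) :
    ∃ N, Rewrite R M N ∧ erase N = P := by
  have hu : ∀ P, ¬ QTm.Rewrite R' .unit P := by
    intro P h
    generalize hX : QTm.unit = X at h
    cases h with
    | rule h => exact hunit _ (hX ▸ h)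
    | @record _ _ _ i _ h =>
      cases hX
      exact i.elim0
    | _ => cases hX
  have hrule : ∀ {M : ETm S} {P X}, R' X P → erase M = X → ∃ N, Rewrite R M N ∧ erase N = P := by
    rintro M P _ h rfl
    obtain ⟨N, h1, h2⟩ := hR h
    exact ⟨N, .rule h1, h2⟩
  induction M generalizing P with
  | lam E A M ih =>
    cases E with
    | pl => exact absurd h (hu _)
    | db =>
      generalize hX : erase (lam .db A M) = X at h
      cases h with
      | rule h => exact hrule h hX
      | lam h =>
        cases hX
        obtain ⟨N, h1, rfl⟩ := ih h
        exact ⟨_, .lam h1, rfl⟩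
      | _ => cases hX
  | fix A B M ih => exact absurd h (hu _)
  | op o M ih =>
    generalize hX : erase (op o M) = X at h
    cases h with
    | rule h => exact hrule h hX
    | op h =>
      cases hX
      obtain ⟨N, h1, rfl⟩ := ih _ h
      exact ⟨_, .op h1, by simp only [erase, erase_update]⟩
    | _ => cases hX
  | record l M ih =>
    generalize hX : erase (record l M) = X at h
    cases h with
    | rule h => exact hrule h hX
    | record h =>
      cases hX
      obtain ⟨N, h1, rfl⟩ := ih _ h
      exact ⟨_, .record h1, by simp only [erase, erase_update]⟩
    | _ => cases hX
  | fold L M N ih1 ih2 ih3 =>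
    generalize hX : erase (fold L M N) = X at h
    cases h with
    | rule h => exact hrule h hX
    | foldL h =>
      cases hX
      obtain ⟨N, h1, rfl⟩ := ih1 h
      exact ⟨_, .foldL h1, rfl⟩
    | foldM h =>
      cases hX
      obtain ⟨N, h1, rfl⟩ := ih2 h
      exact ⟨_, .foldM h1, rfl⟩
    | foldR h =>
      cases hX
      obtain ⟨N, h1, rfl⟩ := ih3 h
      exact ⟨_, .foldR h1, rfl⟩
    | _ => cases hX
  | app M N ih1 ih2 =>
    generalize hX : erase (app M N) = X at h
    cases h with
    | rule h => exact hrule h hX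
    | appL h =>
      cases hX
      obtain ⟨N, h1, rfl⟩ := ih1 h
      exact ⟨_, .appL h1, rfl⟩
    | appR h =>
      cases hX
      obtain ⟨N, h1, rfl⟩ := ih2 h
      exact ⟨_, .appR h1, rfl⟩
    | _ => cases hX
  | cond M N ih1 ih2 =>
    generalize hX : erase (cond M N) = X at h
    cases h with
    | rule h => exact hrule h hX
    | condL h =>
      cases hX
      obtain ⟨N, h1, rfl⟩ := ih1 h
      exact ⟨_, .condL h1, rfl⟩
    | condR h =>
      cases hX
      obtain ⟨N, h1, rfl⟩ := ih2 h
      exact ⟨_, .condR h1, rfl⟩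
    | _ => cases hX
  | union M N ih1 ih2 =>
    generalize hX : erase (union M N) = X at h
    cases h with
    | rule h => exact hrule h hX
    | unionL h =>
      cases hX
      obtain ⟨N, h1, rfl⟩ := ih1 h
      exact ⟨_, .unionL h1, rfl⟩
    | unionR h =>
      cases hX
      obtain ⟨N, h1, rfl⟩ := ih2 h
      exact ⟨_, .unionR h1, rfl⟩
    | _ => cases hX
  | bind A M N ih1 ih2 =>
    generalize hX : erase (bind A M N) = X at h
    cases h with
    | rule h => exact hrule h hX
    | bindL h =>
      cases hX
      obtain ⟨N, h1, rfl⟩ := ih1 h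
      exact ⟨_, .bindL h1, rfl⟩
    | bindR h =>
      cases hX
      obtain ⟨N, h1, rfl⟩ := ih2 h
      exact ⟨_, .bindR h1, rfl⟩
    | _ => cases hX
  | sing M ih =>
    generalize hX : erase (sing M) = X at h
    cases h with
    | rule h => exact hrule h hX
    | sing h =>
      cases hX
      obtain ⟨N, h1, rfl⟩ := ih h
      exact ⟨_, .sing h1, rfl⟩
    | _ => cases hX
  | query M ih =>
    generalize hX : erase (query M) = X at h
    cases h with
    | rule h => exact hrule h hX
    | query h =>
      cases hX
      obtain ⟨N, h1, rfl⟩ := ih h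
      exact ⟨_, .query h1, rfl⟩
    | _ => cases hX
  | proj M l ih =>
    generalize hX : erase (proj M l) = X at h
    cases h with
    | rule h => exact hrule h hX
    | proj h =>
      cases hX
      obtain ⟨N, h1, rfl⟩ := ih h
      exact ⟨_, .proj h1, rfl⟩
    | _ => cases hX
  | var i =>
    generalize hX : erase (var i) = X at h
    cases h with
    | rule h => exact hrule h hX
    | _ => cases hX
  | const c =>
    generalize hX : erase (const c) = X at h
    cases h with
    | rule h => exact hrule h hX
    | _ => cases hX
  | empty =>
    generalize hX : erase empty = X at h
    cases h with
    | rule h => exact hrule h hX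
    | _ => cases hX
  | table t =>
    generalize hX : erase (table t) = X at h
    cases h with
    | rule h => exact hrule h hX
    | _ => cases hX

theorem rewrite_symRule_reflect {M : ETm S} {P : QTm S}
    (h : QTm.Rewrite QTm.SymRule (erase M) P) : ∃ N, Rewrite SymRule M N ∧ erase N = P :=
  rewrite_reflect symRule_reflect (fun P h => by generalize hX : QTm.unit = X at h; cases h <;> cases hX) h

theorem rewrite_adhocRule_reflect {M : ETm S} {P : QTm S}
    (h : QTm.Rewrite QTm.AdhocRule (erase M) P) : ∃ N, Rewrite AdhocRule M N ∧ erase N = P :=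
  rewrite_reflect adhocRule_reflect (fun P h => by generalize hX : QTm.unit = X at h; cases h <;> cases hX) h

theorem star_reflect {R : ETm S → ETm S → Prop} {R' : QTm S → QTm S → Prop}
    (hR : ∀ {M P}, R' (erase M) P → ∃ N, R M N ∧ erase N = P) {M : ETm S} {P : QTm S}
    (h : Relation.ReflTransGen R' (erase M) P) :
    ∃ N, Relation.ReflTransGen R M N ∧ erase N = P := by
  induction h with
  | refl => exact ⟨M, .refl, rfl⟩
  | tail _ h ih =>
    obtain ⟨N, h1, rfl⟩ := ih
    obtain ⟨N', h2, rfl⟩ := hR h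
    exact ⟨N', h1.tail h2, rfl⟩

end ETm
end LIQ

/-! ### Normal forms of first-order type, and agreement of normalisation -/

namespace LIQ

variable {S : Signature}

/-- No function type occurs in the type. -/
def ETy.FirstOrder : ETy S → Prop
  | .base _ => True
  | .rcd _ A => ∀ i, (A i).FirstOrder
  | .bag A => A.FirstOrder
  | .fn _ _ _ => False

namespace ETm

/-- Terms built from the constructors of queries. -/
inductive Pure : ETm S → Prop
  | var (i) : Pure (.var i)
  | const (c) : Pure (.const c)
  | op {o M} : (∀ i, Pure (M i)) → Pure (.op o M)
  | cond {L M} : Pure L → Pure M → Pure (.cond L M)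
  | record {n} {l : Fin n ↪ String} {M : Fin n → ETm S} : (∀ i, Pure (M i)) → Pure (.record l M)
  | proj {M l} : Pure M → Pure (.proj M l)
  | empty : Pure .empty
  | sing {M} : Pure M → Pure (.sing M)
  | union {M N} : Pure M → Pure N → Pure (.union M N)
  | bind {A M N} : Pure M → Pure N → Pure (.bind A M N)
  | table (t) : Pure (.table t)

namespace Pure

theorem rename {M : ETm S} (h : Pure M) (r : ℕ → ℕ) : Pure (M.rename r) := by
  induction h generalizing r with
  | op _ ih => exact .op fun i => ih i r
  | record _ ih => exact .record fun i => ih i r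
  | bind _ _ ih1 ih2 => exact .bind (ih1 _) (ih2 _)
  | union _ _ ih1 ih2 => exact .union (ih1 _) (ih2 _)
  | cond _ _ ih1 ih2 => exact .cond (ih1 _) (ih2 _)
  | sing _ ih => exact .sing (ih _)
  | proj _ ih => exact .proj (ih _)
  | _ => constructor

theorem forall_update {n : ℕ} {M : Fin n → ETm S} (h : ∀ i, Pure (M i)) {i : Fin n} {N : ETm S}
    (hN : Pure N) (j : Fin n) : Pure (Function.update M i N j) := by
  by_cases hj : j = i
  · subst hj; simpa using hN
  · simpa [hj] using h j

theorem adhocRule {M N : ETm S} (h : Pure M) (hr : AdhocRule M N) : Pure N := by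
  cases hr with
  | forUnion =>
    obtain _ | _ | _ | _ | _ | _ | _ | _ | _ | ⟨h1, h2⟩ := h
    cases h2 with
    | union h2 h3 => exact .union (.bind h1 h2) (.bind h1 h3)
  | forEmpty => exact .empty
  | condEmpty => exact .empty
  | condUnion =>
    cases h with
    | cond h1 h2 =>
      cases h2 with
      | union h2 h3 => exact .union (.cond h1 h2) (.cond h1 h3)
  | condCond =>
    cases h with
    | cond h1 h2 =>
      cases h2 with
      | cond h2 h3 => exact .cond (.op fun i => by split <;> assumption) h3
  | condFor =>
    cases h with
    | cond h1 h2 =>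
      cases h2 with
      | bind h2 h3 => exact .bind h2 (.cond (h1.rename _) h3)

theorem rewrite_adhocRule {M N : ETm S} (h : Pure M) (hr : Rewrite AdhocRule M N) : Pure N := by
  induction hr with
  | rule hr => exact h.adhocRule hr
  | op _ ih => cases h with | op h => exact .op (forall_update h (ih (h _)))
  | record _ ih => cases h with | record h => exact .record (forall_update h (ih (h _)))
  | condL _ ih => cases h with | cond h1 h2 => exact .cond (ih h1) h2
  | condR _ ih => cases h with | cond h1 h2 => exact .cond h1 (ih h2)
  | unionL _ ih => cases h with | union h1 h2 => exact .union (ih h1) h2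
  | unionR _ ih => cases h with | union h1 h2 => exact .union h1 (ih h2)
  | bindL _ ih => cases h with | bind h1 h2 => exact .bind (ih h1) h2
  | bindR _ ih => cases h with | bind h1 h2 => exact .bind h1 (ih h2)
  | sing _ ih => cases h with | sing h => exact .sing (ih h)
  | proj _ ih => cases h with | proj h => exact .proj (ih h)
  | _ => cases h

theorem rewrite_adhocRule_star {M N : ETm S} (h : Pure M)
    (hr : Relation.ReflTransGen (Rewrite AdhocRule) M N) : Pure N := by
  induction hr with
  | refl => exact h
  | tail _ hr ih => exact ih.rewrite_adhocRule hr

/-- No subterm of a pure term is erased. -/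
theorem rewrite_erase {R : ETm S → ETm S → Prop} {R' : QTm S → QTm S → Prop}
    (hR : ∀ {M N}, Pure M → R M N → R' (erase M) (erase N)) {M N : ETm S} (h : Pure M)
    (hr : Rewrite R M N) : QTm.Rewrite R' (erase M) (erase N) := by
  induction hr with
  | rule hr => exact .rule (hR h hr)
  | op _ ih =>
    cases h with
    | op h => simp only [erase, erase_update]; exact .op (ih (h _))
  | record _ ih =>
    cases h with
    | record h => simp only [erase, erase_update]; exact .record (ih (h _))
  | condL _ ih => cases h with | cond h1 h2 => exact .condL (ih h1)
  | condR _ ih => cases h with | cond h1 h2 => exact .condR (ih h2)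
  | unionL _ ih => cases h with | union h1 h2 => exact .unionL (ih h1)
  | unionR _ ih => cases h with | union h1 h2 => exact .unionR (ih h2)
  | bindL _ ih => cases h with | bind h1 h2 => exact .bindL (ih h1)
  | bindR _ ih => cases h with | bind h1 h2 => exact .bindR (ih h2)
  | sing _ ih => cases h with | sing h => exact .sing (ih h)
  | proj _ ih => cases h with | proj h => exact .proj (ih h)
  | _ => cases h

theorem symRule_erase {M N : ETm S} (h : Pure M) (hr : SymRule M N) :
    QTm.SymRule (erase M) (erase N) := by
  cases hr with
  | beta => obtain _ | _ := h
  | forSing => rw [erase_one]; exact .forSing _ _ _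
  | forFor => simp only [erase, erase_rename]; exact .forFor _ _ _ _ _
  | proj l M i => exact .proj l (fun i => erase (M i)) i
  | _ => constructor

theorem adhocRule_erase {M N : ETm S} (hr : AdhocRule M N) :
    QTm.AdhocRule (erase M) (erase N) := by
  cases hr with
  | condCond => simp only [erase, erase_conj]; exact .condCond _ _ _
  | condFor => simp only [erase, erase_rename]; exact .condFor _ _ _ _
  | _ => constructor

theorem isQuery_of_erase {M : ETm S} {q : Query S} (h : Pure M) (hq : QTm.IsQuery (erase M) q) :
    IsQuery M q := by
  induction h generalizing q with
  | op _ ih => cases hq with | op hq => exact .op fun i => ih i (hq i)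
  | record _ ih => cases hq with | record hq => exact .record fun i => ih i (hq i)
  | cond _ _ ih1 ih2 => cases hq with | cond h1 h2 => exact .cond (ih1 h1) (ih2 h2)
  | union _ _ ih1 ih2 => cases hq with | union h1 h2 => exact .union (ih1 h1) (ih2 h2)
  | bind _ _ ih1 ih2 => cases hq with | bind h1 h2 => exact .bind (ih1 h1) (ih2 h2)
  | sing _ ih => cases hq with | sing h => exact .sing (ih h)
  | proj _ ih => cases hq with | proj h => exact .proj (ih h)
  | _ => cases hq; constructor

end Pure

theorem IsQuery.erase {M : ETm S} {q : Query S} (h : IsQuery M q) : QTm.IsQuery (erase M) q := by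
  induction h <;> constructor <;> assumption

/-- The possible head constructors of a normal form of a given type. -/
def NormalShape : ETm S → ETy S → Prop
  | _, .base _ => True
  | M, .rcd _ _ => (∃ (n : ℕ) (l : Fin n ↪ String) (N : Fin n → ETm S), M = record l N) ∨
      ∃ i, M = var i
  | M, .bag _ => match M with
    | empty | sing _ | union _ _ | cond _ _ | bind _ _ _ | table _ => True
    | _ => False
  | M, .fn _ .db _ => ∃ A N, M = lam .db A N
  | _, .fn _ .pl _ => True

/-- A canonical-forms argument: in a normal term an eliminator never meets an introduction form, and
the only other candidates are variables and tables. Variables have row types because they are bound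
by comprehensions over tables. Hence functions occur only where the type shows them, and a
first-order type leaves none. Normality is assumed of the erasure alone, as bodies of erased
functions may contain redexes until purity has excluded them. -/
theorem DbTyped.pure_of_normal {Γ : List (ETy S)} {M : ETm S} {A : ETy S} (h : DbTyped Γ M A)
    (hΓ : ∀ (i : ℕ) A, Γ[i]? = some A → ∃ (n : ℕ) (l : Fin n ↪ String) (O : Fin n → S.Base),
      A = .row l O)
    (hn : ∀ P, ¬ QTm.Rewrite QTm.SymRule (erase M) P) :
    (A.FirstOrder → Pure M) ∧ NormalShape M A := by
  induction h with
  | var h =>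
    obtain ⟨n, l, O, rfl⟩ := hΓ _ _ h
    exact ⟨fun _ => .var _, .inr ⟨_, rfl⟩⟩
  | const => exact ⟨fun _ => .const _, trivial⟩
  | op _ _ ih =>
    exact ⟨fun _ => .op fun i => (ih i hΓ fun P h =>
      hn _ (.op (M := fun i => erase _) h)).1 trivial, trivial⟩
  | lamDb => exact ⟨False.elim, _, _, rfl⟩
  | lamPl => exact ⟨False.elim, trivial⟩
  | fix => exact ⟨False.elim, trivial⟩
  | app _ _ ih1 ih2 =>
    -- A normal function of effect db is an abstraction, so no application is normal.
    obtain ⟨A, N, rfl⟩ := (ih1 hΓ fun P h => hn _ (.appL h)).2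
    exact absurd (.rule (.beta _ _ _)) (hn _)
  | cond _ _ ih1 ih2 =>
    exact ⟨fun hA => .cond ((ih1 hΓ fun P h => hn _ (.condL h)).1 trivial)
      ((ih2 hΓ fun P h => hn _ (.condR h)).1 hA), trivial⟩
  | record _ ih =>
    exact ⟨fun hA => .record fun i => (ih i hΓ fun P h =>
      hn _ (.record (M := fun i => erase _) h)).1 (hA i), .inl ⟨_, _, _, rfl⟩⟩
  | proj i h h1 h2 ih =>
    subst h1 h2
    obtain ⟨n, l, N, rfl⟩ | ⟨j, rfl⟩ := (ih hΓ fun P h => hn _ (.proj h)).2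
    · cases h
      exact absurd (.rule (.proj _ _ i)) (hn _)
    · cases h with
      | var h =>
        obtain ⟨n, l, O, h⟩ := hΓ _ _ h
        cases h
        exact ⟨fun _ => .proj (.var _), trivial⟩
  | empty => exact ⟨fun _ => .empty, trivial⟩
  | sing _ ih => exact ⟨fun hA => .sing ((ih hΓ fun P h => hn _ (.sing h)).1 hA), trivial⟩
  | union _ _ ih1 ih2 =>
    exact ⟨fun hA => .union ((ih1 hΓ fun P h => hn _ (.unionL h)).1 hA)
      ((ih2 hΓ fun P h => hn _ (.unionR h)).1 hA), trivial⟩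
  | @bind Γ M N A B h1 _ ih1 ih2 =>
    have hM := (ih1 hΓ fun P h => hn _ (.bindL h)).2
    cases M with
    | empty => exact absurd (.rule (.forEmpty _ _)) (hn _)
    | sing => exact absurd (.rule (.forSing _ _ _)) (hn _)
    | union => exact absurd (.rule (.forUnion _ _ _ _)) (hn _)
    | cond => exact absurd (.rule (.forCond _ _ _ _)) (hn _)
    | bind => exact absurd (.rule (.forFor _ _ _ _ _)) (hn _)
    -- Every other normal bag is the source of a commuting rule. The rows of a table are records of
    -- base types, so the hypothesis on the context passes under the binder.
    | table t =>
      cases h1 with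
      | table h1 =>
        cases h1
        refine ⟨fun hA => .bind (.table t) ((ih2 (fun i C hi => ?_) fun P h =>
          hn _ (.bindR h)).1 hA), trivial⟩
        cases i with
        | zero => exact ⟨_, S.col t, S.colTy t, by simpa using hi.symm⟩
        | succ i => exact hΓ i C (by simpa using hi)
    | _ => exact hM.elim
  | table h =>
    subst h
    exact ⟨fun _ => .table _, trivial⟩

/-- Reflection of rewrites lifts a normalisation of `erase M` to M and shows that erasures of normal
forms are normal. The converse, that a term with normal erasure is normal, fails in general; it
holds here because a normal erasure of first-order type comes from a pure term, and ad hoc rewriting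
keeps it pure. -/
theorem norm_erase {M : ETm S} {A : ETy S} (hM : DbTyped [] M A) (hA : A.FirstOrder)
    (q : Query S) : QTm.Norm (erase M) q ↔ Norm M q := by
  constructor
  · rintro ⟨P, P', h1, h2, h3, h4, h5⟩
    obtain ⟨N, k1, rfl⟩ := star_reflect rewrite_symRule_reflect h1
    obtain ⟨N', k3, rfl⟩ := star_reflect rewrite_adhocRule_reflect h3
    have hN := (hM.rewrite_star DbTyped.symRule k1).2
    have hp := (hN.pure_of_normal (by simp) h2).1 hA
    have hp' := hp.rewrite_adhocRule_star k3
    exact ⟨N, N', k1, fun P h => h2 _ (hp.rewrite_erase Pure.symRule_erase h), k3,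
      fun P h => h4 _ (hp'.rewrite_erase (fun _ => Pure.adhocRule_erase) h), hp'.isQuery_of_erase h5⟩
  · rintro ⟨N, N', h1, h2, h3, h4, h5⟩
    obtain ⟨k1, hN⟩ := hM.rewrite_star DbTyped.symRule h1
    obtain ⟨k3, -⟩ := hN.rewrite_star DbTyped.adhocRule h3
    refine ⟨_, _, k1, fun P h => ?_, k3, fun P h => ?_, h5.erase⟩
    · obtain ⟨P, h, -⟩ := rewrite_symRule_reflect h
      exact h2 _ h
    · obtain ⟨P, h, -⟩ := rewrite_adhocRule_reflect h
      exact h4 _ h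

end ETm

/-- The types of queries as types of Eff, with function types collapsed. -/
def ETy.toNTy : ETy S → NTy S
  | .base O => .base O
  | .rcd l A => .rcd l fun i => (A i).toNTy
  | .bag A => .bag A.toNTy
  -- A dummy: queries neither form nor apply functions, so any fixed type preserves their typing.
  | .fn _ _ _ => .base S.bool

namespace ETm

theorem IsQuery.hasTy {Γ : List (ETy S)} {M : ETm S} {A : ETy S} {q : Query S}
    (hq : IsQuery M q) (h : DbTyped Γ M A) : Query.HasTy (Γ.map ETy.toNTy) q A.toNTy := by
  induction hq generalizing Γ A with
  | var => cases h with | var h => exact .var (by simp [h])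
  | const => cases h with | const h => subst h; exact .const
  | op _ ih => cases h with | op h h' => subst h'; exact .op fun i => ih i (h i)
  | cond _ _ ih1 ih2 => cases h with | cond h1 h2 => exact .cond (ih1 h1) (ih2 h2)
  | record _ ih => cases h with | record h => exact .record fun i => ih i (h i)
  | proj _ ih =>
    cases h with
    | @proj _ _ _ _ A _ _ i h h1 h2 =>
      subst h1 h2
      exact .proj (A := fun i => (A i).toNTy) i (ih h)
  | empty => cases h with | empty => exact .empty
  | sing _ ih => cases h with | sing h => exact .sing (ih h)
  | union _ _ ih1 ih2 => cases h with | union h1 h2 => exact .union (ih1 h1) (ih2 h2)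
  | bind _ _ ih1 ih2 => cases h with | bind h1 h2 => exact .bind (ih1 h1) (ih2 h2)
  | table => cases h with | table h => subst h; exact .table

/-- Subject reduction for both stages; this makes type safety of the responses applicable to the
query that is run. -/
theorem Norm.hasTy {M : ETm S} {A : ETy S} {q : Query S} (hq : Norm M q) (h : DbTyped [] M A) :
    Query.HasTy [] q A.toNTy := by
  obtain ⟨N, N', h1, -, h3, -, h5⟩ := hq
  exact h5.hasTy (((h.rewrite_star DbTyped.symRule h1).2).rewrite_star DbTyped.adhocRule h3).2

end ETm
end LIQ

/-! ### The simulation relation and its substitution lemma -/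

namespace LIQ

variable {S : Signature}

open ETm (DbTyped erase)

/-- Reification is a closed template around its argument: the element and the accumulator of the
fold are bound inside the template. -/
theorem subst_reify (s : ℕ → QTm S) (A : ETy S) (M : QTm S) :
    (reify A M).subst s = reify A (M.subst s) := by
  induction A generalizing s M with
  | base => rfl
  | rcd l A ih => simp only [reify, QTm.subst, ih]
  | bag A ih => simp only [reify, QTm.subst, ih]; rfl
  | fn A E B =>
    cases E
    · exact QTm.subst_unit s
    · rfl

theorem rename_reify (r : ℕ → ℕ) (A : ETy S) (M : QTm S) :
    (reify A M).rename r = reify A (M.rename r) := by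
  rw [QTm.rename_eq_subst, subst_reify, ← QTm.rename_eq_subst]

/-- `Rel X ρ M A N`: the term `N` is a translation at target `X` of the term `M` of type `A`, in
which some closed terms may already have been spliced in. -/
inductive Rel : Effect → EffEnv S → ETm S → ETy S → QTm S → Prop
  | var {X ρ i A k s} : ρ[i]? = some ⟨A, X, k, s⟩ → Rel X ρ (.var i) A (.var k)
  | shadow {ρ i A k s} : ρ[i]? = some ⟨A, .pl, k, s⟩ → Rel .db ρ (.var i) A (.antiquote (.var s))
  | spliced {ρ M A} : DbTyped [] M A → Rel .db ρ M A (.antiquote (.quote (erase M)))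
  | const {X ρ c O} : S.constTy c = O → Rel X ρ (.const c) (.base O) (.const c)
  | op {X ρ o M N O} : (∀ i, Rel X ρ (M i) (.base (S.argTy o i)) (N i)) → S.resTy o = O →
      Rel X ρ (.op o M) (.base O) (.op o N)
  | lamPl {ρ A B M N} : Rel .pl (ρ.bindPl A) M B N → Rel .pl ρ (.lam .pl A M) (.fn A .pl B)
      (.lam (A.splice .pl) (.letIn (.quot (A.splice .db)) (.quote (reify A (.var 0))) N))
  | lamDb {ρ A B M N} : Rel .db (ρ.bindDb A) M B N →
      Rel .db ρ (.lam .db A M) (.fn A .db B) (.lam (A.splice .db) N)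
  | quoteLam {ρ A B M N} : Rel .db (ρ.bindDb A) M B N →
      Rel .pl ρ (.lam .db A M) (.fn A .db B) (.quote (.lam (A.splice .db) N))
  | quoteErase {ρ A B M} : DbTyped [] (.lam .db A M) (.fn A .db B) →
      Rel .pl ρ (.lam .db A M) (.fn A .db B) (.quote (erase (.lam .db A M)))
  | lamUnit {ρ A B M} : Rel .db ρ (.lam .pl A M) (.fn A .pl B) .unit
  | fix {ρ A B M N} : Rel .pl (ρ.bindFix A B) M B N → Rel .pl ρ (.fix A B M) (.fn A .pl B)
      (.fix (A.splice .pl) (B.splice .pl) (.letIn (.quot .unit) (.quote .unit)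
        (.letIn (.quot (A.splice .db)) (.quote (reify A (.var 1))) N)))
  | fixUnit {ρ A B M} : Rel .db ρ (.fix A B M) (.fn A .pl B) .unit
  | app {X ρ A B M M' N N'} : Rel X ρ M (.fn A X B) M' → Rel X ρ N A N' →
      Rel X ρ (.app M N) B (.app M' N')
  | cond {X ρ A L L' M M'} : Rel X ρ L (.base S.bool) L' → Rel X ρ M (.bag A) M' →
      Rel X ρ (.cond L M) (.bag A) (.cond L' M')
  | record {X ρ n} {l : Fin n ↪ String} {M A N} : (∀ i, Rel X ρ (M i) (A i) (N i)) →
      Rel X ρ (.record l M) (.rcd l A) (.record l N)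
  | proj {X ρ n} {l : Fin n ↪ String} {M A N s B} (i : Fin n) : Rel X ρ M (.rcd l A) N →
      l i = s → A i = B → Rel X ρ (.proj M s) B (.proj N s)
  | empty {X ρ A} : Rel X ρ .empty (.bag A) .empty
  | sing {X ρ M A N} : Rel X ρ M A N → Rel X ρ (.sing M) (.bag A) (.sing N)
  | union {X ρ A M M' N N'} : Rel X ρ M (.bag A) M' → Rel X ρ N (.bag A) N' →
      Rel X ρ (.union M N) (.bag A) (.union M' N')
  | bindPl {ρ A B M M' N N'} : Rel .pl ρ M (.bag A) M' → Rel .pl (ρ.bindPl A) N (.bag B) N' →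
      Rel .pl ρ (.bind A M N) (.bag B) (.bind (A.splice .pl) M'
        (.letIn (.quot (A.splice .db)) (.quote (reify A (.var 0))) N'))
  | bindDb {ρ A B M M' N N'} : Rel .db ρ M (.bag A) M' → Rel .db (ρ.bindDb A) N (.bag B) N' →
      Rel .db ρ (.bind A M N) (.bag B) (.bind (A.splice .db) M' N')
  | fold {ρ A B L L' M M' N N'} : Rel .pl ρ L (.bag A) L' → Rel .pl ρ M B M' →
      Rel .pl ρ N (.fn A .pl (.fn B .pl B)) N' → Rel .pl ρ (.fold L M N) B (.fold L' M' N')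
  | query {ρ M N A n} {l : Fin n ↪ String} {O : Fin n → S.Base} :
      Rel .db ρ M (.bag (.row l O)) N → .bag (.row l O) = A →
      Rel .pl ρ (.query M) A (.query (.quote N))
  | table {ρ t A} : .bag (.row (S.col t) (S.colTy t)) = A → Rel .db ρ (.table t) A (.table t)

namespace EffEnv

theorem weaken_some {n : ℕ} {ρ : EffEnv S} {i : ℕ} {A X k s} :
    (weaken n ρ)[i]? = some ⟨A, X, k, s⟩ ↔
      ∃ k' s', ρ[i]? = some ⟨A, X, k', s'⟩ ∧ k = k' + n ∧ s = s' + n := by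
  simp only [weaken, List.getElem?_map, Option.map_eq_some_iff]
  constructor
  · rintro ⟨⟨A', X', k', s'⟩, h, h'⟩
    cases h'
    exact ⟨k', s', h, rfl, rfl⟩
  · rintro ⟨k', s', h, rfl, rfl⟩
    exact ⟨_, h, rfl⟩

/-- The renaming `r` of the source and `r'` of the target lead from `ρ` to `ρ'`. -/
def Renames (r r' : ℕ → ℕ) (ρ ρ' : EffEnv S) : Prop :=
  ∀ i A X k s, ρ[i]? = some ⟨A, X, k, s⟩ → ρ'[r i]? = some ⟨A, X, r' k, r' s⟩

theorem Renames.bindPl {r r' : ℕ → ℕ} {ρ ρ' : EffEnv S} (h : Renames r r' ρ ρ') (A : ETy S) :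
    Renames (upRen r) (upRen (upRen r')) (ρ.bindPl A) (ρ'.bindPl A) := by
  intro i B X k s hi
  cases i with
  | zero => cases hi; rfl
  | succ i =>
    obtain ⟨k, s, hj, rfl, rfl⟩ := weaken_some.1 hi
    exact weaken_some.2 ⟨_, _, h _ _ _ _ _ hj, rfl, rfl⟩

theorem Renames.bindDb {r r' : ℕ → ℕ} {ρ ρ' : EffEnv S} (h : Renames r r' ρ ρ') (A : ETy S) :
    Renames (upRen r) (upRen r') (ρ.bindDb A) (ρ'.bindDb A) := by
  intro i B X k s hi
  cases i with
  | zero => cases hi; rfl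
  | succ i =>
    obtain ⟨k, s, hj, rfl, rfl⟩ := weaken_some.1 hi
    exact weaken_some.2 ⟨_, _, h _ _ _ _ _ hj, rfl, rfl⟩

theorem Renames.bindFix {r r' : ℕ → ℕ} {ρ ρ' : EffEnv S} (h : Renames r r' ρ ρ') (A B : ETy S) :
    Renames (upRen (upRen r)) (upRen (upRen (upRen (upRen r')))) (ρ.bindFix A B)
      (ρ'.bindFix A B) := by
  intro i C X k s hi
  rcases i with _ | _ | i
  · cases hi; rfl
  · cases hi; rfl
  · obtain ⟨k, s, hj, rfl, rfl⟩ := weaken_some.1 hi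
    exact weaken_some.2 ⟨_, _, h _ _ _ _ _ hj, rfl, rfl⟩

theorem map_ty_weaken (n : ℕ) (ρ : EffEnv S) : (weaken n ρ).map Entry.ty = ρ.map Entry.ty := by
  simp [weaken, Function.comp_def]

theorem map_ty_bindPl (A : ETy S) (ρ : EffEnv S) :
    (ρ.bindPl A).map Entry.ty = A :: ρ.map Entry.ty := by
  simp [bindPl, map_ty_weaken]

theorem map_ty_bindDb (A : ETy S) (ρ : EffEnv S) :
    (ρ.bindDb A).map Entry.ty = A :: ρ.map Entry.ty := by
  simp [bindDb, map_ty_weaken]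

theorem map_ty_bindFix (A B : ETy S) (ρ : EffEnv S) :
    (ρ.bindFix A B).map Entry.ty = A :: .fn A .pl B :: ρ.map Entry.ty := by
  simp [bindFix, map_ty_weaken]

end EffEnv

namespace Rel

theorem rename {X : Effect} {ρ ρ' : EffEnv S} {M : ETm S} {A : ETy S} {N : QTm S}
    (h : Rel X ρ M A N) {r r' : ℕ → ℕ} (hr : EffEnv.Renames r r' ρ ρ') :
    Rel X ρ' (M.rename r) A (N.rename r') := by
  induction h generalizing ρ' r r' with
  | var h => exact .var (hr _ _ _ _ _ h)
  | shadow h => exact .shadow (hr _ _ _ _ _ h)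
  | @spliced ρ M A h =>
    -- M may change under the renaming, because erased bodies can have free variables, but its
    -- erasure does not.
    simp only [QTm.rename, h.rename_erase_nil]
    rw [← h.rename_erase_nil r, ← ETm.erase_rename]
    exact .spliced (h.rename (by simp))
  | const h => exact .const h
  | op _ h ih => exact .op (fun i => ih i hr) h
  | @lamPl ρ A _ _ _ _ ih =>
    simp only [ETm.rename, QTm.rename, QTm.letIn, rename_reify]
    exact .lamPl (ih (hr.bindPl A))
  | @lamDb ρ A _ _ _ _ ih => exact .lamDb (ih (hr.bindDb A))
  | @quoteLam ρ A _ _ _ _ ih => exact .quoteLam (ih (hr.bindDb A))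
  | @quoteErase ρ A B M h =>
    simp only [QTm.rename, h.rename_erase_nil]
    rw [← h.rename_erase_nil r, ← ETm.erase_rename]
    exact .quoteErase (h.rename (r := r) (by simp))
  | lamUnit => rw [QTm.rename_unit]; exact .lamUnit
  | @fix ρ A B _ _ _ ih =>
    simp only [ETm.rename, QTm.rename, QTm.letIn, rename_reify, QTm.rename_unit]
    exact .fix (ih (hr.bindFix A B))
  | fixUnit => rw [QTm.rename_unit]; exact .fixUnit
  | app _ _ ih1 ih2 => exact .app (ih1 hr) (ih2 hr)
  | cond _ _ ih1 ih2 => exact .cond (ih1 hr) (ih2 hr)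
  | record _ ih => exact .record fun i => ih i hr
  | proj i _ h1 h2 ih => exact .proj i (ih hr) h1 h2
  | empty => exact .empty
  | sing _ ih => exact .sing (ih hr)
  | union _ _ ih1 ih2 => exact .union (ih1 hr) (ih2 hr)
  | @bindPl ρ A _ _ _ _ _ _ _ ih1 ih2 =>
    simp only [ETm.rename, QTm.rename, QTm.letIn, rename_reify]
    exact .bindPl (ih1 hr) (ih2 (hr.bindPl A))
  | @bindDb ρ A _ _ _ _ _ _ _ ih1 ih2 => exact .bindDb (ih1 hr) (ih2 (hr.bindDb A))
  | fold _ _ _ ih1 ih2 ih3 => exact .fold (ih1 hr) (ih2 hr) (ih3 hr)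
  | query _ h ih => exact .query (ih hr) h
  | table h => exact .table h

/-- The substitutions `s` of the source and `t` of the target lead from `ρ` to `ρ'`. -/
def Substs (s : ℕ → ETm S) (t : ℕ → QTm S) (ρ ρ' : EffEnv S) : Prop :=
  ∀ i A X k sh, ρ[i]? = some ⟨A, X, k, sh⟩ →
    Rel X ρ' (s i) A (t k) ∧ (X = .pl → Rel .db ρ' (s i) A (.antiquote (t sh)))

theorem Substs.bindPl {s : ℕ → ETm S} {t : ℕ → QTm S} {ρ ρ' : EffEnv S} (h : Substs s t ρ ρ')
    (A : ETy S) : Substs (ETm.up s) (QTm.up (QTm.up t)) (ρ.bindPl A) (ρ'.bindPl A) := by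
  intro i B X k sh hi
  cases i with
  | zero => cases hi; exact ⟨.var rfl, fun _ => .shadow rfl⟩
  | succ i =>
    obtain ⟨k, sh, hj, rfl, rfl⟩ := EffEnv.weaken_some.1 hi
    -- One source binder corresponds to two target binders, the variable and its shadow.
    have hr : EffEnv.Renames Nat.succ (fun j => Nat.succ (Nat.succ j)) ρ' (ρ'.bindPl A) :=
      fun i B X k s hi => EffEnv.weaken_some.2 ⟨_, _, hi, rfl, rfl⟩
    obtain ⟨h1, h2⟩ := h _ _ _ _ _ hj
    simp only [QTm.up, QTm.rename_rename]
    exact ⟨h1.rename hr, fun hX => (h2 hX).rename hr⟩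

theorem Substs.bindDb {s : ℕ → ETm S} {t : ℕ → QTm S} {ρ ρ' : EffEnv S} (h : Substs s t ρ ρ')
    (A : ETy S) : Substs (ETm.up s) (QTm.up t) (ρ.bindDb A) (ρ'.bindDb A) := by
  intro i B X k sh hi
  cases i with
  | zero => cases hi; exact ⟨.var rfl, by simp⟩
  | succ i =>
    obtain ⟨k, sh, hj, rfl, rfl⟩ := EffEnv.weaken_some.1 hi
    have hr : EffEnv.Renames Nat.succ Nat.succ ρ' (ρ'.bindDb A) :=
      fun i B X k s hi => EffEnv.weaken_some.2 ⟨_, _, hi, rfl, rfl⟩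
    obtain ⟨h1, h2⟩ := h _ _ _ _ _ hj
    exact ⟨h1.rename hr, fun hX => (h2 hX).rename hr⟩

theorem Substs.bindFix {s : ℕ → ETm S} {t : ℕ → QTm S} {ρ ρ' : EffEnv S} (h : Substs s t ρ ρ')
    (A B : ETy S) : Substs (ETm.up (ETm.up s)) (QTm.up (QTm.up (QTm.up (QTm.up t))))
      (ρ.bindFix A B) (ρ'.bindFix A B) := by
  intro i C X k sh hi
  rcases i with _ | _ | i
  · cases hi; exact ⟨.var rfl, fun _ => .shadow rfl⟩
  · cases hi; exact ⟨.var rfl, fun _ => .shadow rfl⟩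
  · obtain ⟨k, sh, hj, rfl, rfl⟩ := EffEnv.weaken_some.1 hi
    have hr : EffEnv.Renames (fun j => Nat.succ (Nat.succ j))
        (fun j => Nat.succ (Nat.succ (Nat.succ (Nat.succ j)))) ρ' (ρ'.bindFix A B) :=
      fun i B X k s hi => EffEnv.weaken_some.2 ⟨_, _, hi, rfl, rfl⟩
    obtain ⟨h1, h2⟩ := h _ _ _ _ _ hj
    -- The two source binders have to be passed in one renaming, to match the four target binders.
    have e : ETm.up (ETm.up s) (i + 1 + 1) = (s i).rename fun j => Nat.succ (Nat.succ j) := by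
      have e' : ∀ (M : ETm S) (r r' : ℕ → ℕ),
          (M.rename r').rename r = M.rename fun i => r (r' i) := by
        intro M
        induction M <;> simp_all [ETm.rename, upRen_comp]
      simp only [ETm.up, e']
    rw [e]
    simp only [QTm.up, QTm.rename_rename]
    exact ⟨h1.rename hr, fun hX => (h2 hX).rename hr⟩

/-- A variable bound at pl has two kinds of target occurrences: itself at pl, and an antiquoted
shadow at db. `Substs` asks for a related term for each of them, and the erasure of a closed value
will serve for the second. -/
theorem subst {X : Effect} {ρ ρ' : EffEnv S} {M : ETm S} {A : ETy S} {N : QTm S}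
    (h : Rel X ρ M A N) {s : ℕ → ETm S} {t : ℕ → QTm S} (hs : Substs s t ρ ρ') :
    Rel X ρ' (M.subst s) A (N.subst t) := by
  induction h generalizing ρ' s t with
  | var h => exact (hs _ _ _ _ _ h).1
  | shadow h => exact (hs _ _ _ _ _ h).2 rfl
  | @spliced ρ M A h =>
    simp only [QTm.subst, h.subst_erase_nil]
    rw [← h.subst_erase_nil fun i => erase (s i), ← ETm.erase_subst]
    exact .spliced (h.subst (by simp))
  | const h => exact .const h
  | op _ h ih => exact .op (fun i => ih i hs) h
  | @lamPl ρ A _ _ _ _ ih =>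
    simp only [ETm.subst, QTm.subst, QTm.letIn, subst_reify]
    exact .lamPl (ih (hs.bindPl A))
  | @lamDb ρ A _ _ _ _ ih => exact .lamDb (ih (hs.bindDb A))
  | @quoteLam ρ A _ _ _ _ ih => exact .quoteLam (ih (hs.bindDb A))
  | @quoteErase ρ A B M h =>
    simp only [QTm.subst, h.subst_erase_nil]
    rw [← h.subst_erase_nil fun i => erase (s i), ← ETm.erase_subst]
    exact .quoteErase (h.subst (s := s) (by simp))
  | lamUnit => rw [QTm.subst_unit]; exact .lamUnit
  | @fix ρ A B _ _ _ ih =>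
    simp only [ETm.subst, QTm.subst, QTm.letIn, subst_reify, QTm.subst_unit]
    exact .fix (ih (hs.bindFix A B))
  | fixUnit => rw [QTm.subst_unit]; exact .fixUnit
  | app _ _ ih1 ih2 => exact .app (ih1 hs) (ih2 hs)
  | cond _ _ ih1 ih2 => exact .cond (ih1 hs) (ih2 hs)
  | record _ ih => exact .record fun i => ih i hs
  | proj i _ h1 h2 ih => exact .proj i (ih hs) h1 h2
  | empty => exact .empty
  | sing _ ih => exact .sing (ih hs)
  | union _ _ ih1 ih2 => exact .union (ih1 hs) (ih2 hs)
  | @bindPl ρ A _ _ _ _ _ _ _ ih1 ih2 =>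
    simp only [ETm.subst, QTm.subst, QTm.letIn, subst_reify]
    exact .bindPl (ih1 hs) (ih2 (hs.bindPl A))
  | @bindDb ρ A _ _ _ _ _ _ _ ih1 ih2 => exact .bindDb (ih1 hs) (ih2 (hs.bindDb A))
  | fold _ _ _ ih1 ih2 ih3 => exact .fold (ih1 hs) (ih2 hs) (ih3 hs)
  | query _ h ih => exact .query (ih hs) h
  | table h => exact .table h

/-- Relatedness at db thus carries all the typing that the normalisation results use. The contexts
of spliced terms are empty, so they fit any environment. -/
theorem dbTyped {ρ : EffEnv S} {M : ETm S} {A : ETy S} {N : QTm S} (h : Rel .db ρ M A N) :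
    DbTyped (ρ.map Entry.ty) M A := by
  generalize hX : Effect.db = X at h
  induction h with
  | var h => exact .var (by simp [h])
  | shadow h => exact .var (by simp [h])
  | spliced h => exact h.of_nil
  | const h => exact .const h
  | op _ h ih => exact .op (fun i => ih i hX) h
  | lamDb _ ih => exact .lamDb (by simpa [EffEnv.map_ty_bindDb] using ih hX)
  | lamUnit => exact .lamPl
  | fixUnit => exact .fix
  | app _ _ ih1 ih2 => subst hX; exact .app (ih1 rfl) (ih2 rfl)
  | cond _ _ ih1 ih2 => exact .cond (ih1 hX) (ih2 hX)
  | record _ ih => exact .record fun i => ih i hX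
  | proj i _ h1 h2 ih => exact .proj i (ih hX) h1 h2
  | empty => exact .empty
  | sing _ ih => exact .sing (ih hX)
  | union _ _ ih1 ih2 => exact .union (ih1 hX) (ih2 hX)
  | bindDb _ _ ih1 ih2 => exact .bind (ih1 hX) (by simpa [EffEnv.map_ty_bindDb] using ih2 hX)
  | table h => exact .table h
  | _ => cases hX

/-- A value can contain a `fold` or `query` related at pl only inside a function of effect pl, and
this is what erasure discards. So values produced at pl are legitimate query terms. -/
theorem dbTyped_of_isVal {V : ETm S} {A : ETy S} {N : QTm S} (h : Rel .pl [] V A N)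
    (hV : ETm.IsVal V) : DbTyped [] V A := by
  induction hV generalizing A N with
  | const => cases h with | const h => exact .const h
  | lam =>
    cases h with
    | lamPl h => exact .lamPl
    | quoteLam h => exact .lamDb (by simpa [EffEnv.map_ty_bindDb] using h.dbTyped)
    | quoteErase h => exact h
  | fix => cases h with | fix h => exact .fix
  | record _ _ ih => cases h with | record h => exact .record fun i => ih i (h i)
  | nil => cases h with | empty => exact .empty
  | cons _ _ _ ih1 ih2 =>
    cases h with
    | union h1 h2 => cases h1 with | sing h1 => exact .union (.sing (ih1 h1)) (ih2 h2)

end Rel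

/-- The translation may pass from pl to db, but never back: at db, functions of effect pl become the
empty record. Hence at target pl all variables in scope were bound at pl, which is the invariant
`hρ`. -/
theorem ETm.HasTy.rel_splice {Γ : List (ETy S)} {M : ETm S} {A : ETy S} {X : Effect}
    (h : ETm.HasTy Γ M A X) {ρ : EffEnv S} (hΓ : ρ.map Entry.ty = Γ)
    (hρ : X = .pl → ∀ e ∈ ρ, e.eff = .pl) : Rel X ρ M A (M.splice X ρ) := by
  have hw : ∀ {n : ℕ} {ρ : EffEnv S}, (∀ e ∈ ρ, e.eff = .pl) →
      ∀ e ∈ EffEnv.weaken n ρ, e.eff = .pl := by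
    intro n ρ h e he
    simp only [EffEnv.weaken, List.mem_map] at he
    obtain ⟨e, he, rfl⟩ := he
    exact h e he
  have hb : ∀ {A : ETy S} {ρ : EffEnv S}, (∀ e ∈ ρ, e.eff = .pl) →
      ∀ e ∈ EffEnv.bindPl A ρ, e.eff = .pl := by
    intro A ρ h e he
    rcases List.mem_cons.1 he with rfl | he
    · rfl
    · exact hw h e he
  induction h generalizing ρ with
  | @var Γ i A X h =>
    subst hΓ
    simp only [List.getElem?_map, Option.map_eq_some_iff] at h
    obtain ⟨⟨A, Y, k, s⟩, h, rfl⟩ := h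
    simp only [splice, EffEnv.lookup, h]
    cases Y <;> cases X
    · exact .var h
    · exact .shadow h
    -- The diverging term would arise here, and the invariant excludes it.
    · exact absurd (hρ rfl _ (List.mem_of_getElem? h)) (by simp)
    · exact .var h
  | const => exact .const rfl
  | op _ ih => exact .op (fun i => ih i hΓ hρ) rfl
  | @lam Γ E A B M X h ih =>
    cases E <;> cases X
    · exact .lamPl (ih (by rw [EffEnv.map_ty_bindPl, hΓ]) fun _ => hb (hρ rfl))
    · exact .lamUnit
    · exact .quoteLam (ih (by rw [EffEnv.map_ty_bindDb, hΓ]) (by simp))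
    · exact .lamDb (ih (by rw [EffEnv.map_ty_bindDb, hΓ]) (by simp))
  | @app Γ M N A B X _ _ ih1 ih2 => cases X <;> exact .app (ih1 hΓ hρ) (ih2 hΓ hρ)
  | cond _ _ ih1 ih2 => exact .cond (ih1 hΓ hρ) (ih2 hΓ hρ)
  | record _ ih => exact .record fun i => ih i hΓ hρ
  | proj i _ ih => exact .proj i (ih hΓ hρ) rfl rfl
  | empty => exact .empty
  | sing _ ih => exact .sing (ih hΓ hρ)
  | union _ _ ih1 ih2 => exact .union (ih1 hΓ hρ) (ih2 hΓ hρ)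
  | @bind Γ M N A B X _ _ ih1 ih2 =>
    cases X
    · exact .bindPl (ih1 hΓ hρ) (ih2 (by rw [EffEnv.map_ty_bindPl, hΓ]) fun _ => hb (hρ rfl))
    · exact .bindDb (ih1 hΓ hρ) (ih2 (by rw [EffEnv.map_ty_bindDb, hΓ]) (by simp))
  | table => exact .table rfl
  | query _ ih => exact .query (ih hΓ (by simp)) rfl
  | @fix Γ A B M X _ ih =>
    cases X
    · refine .fix (ih (by rw [EffEnv.map_ty_bindFix, hΓ]) fun _ e he => ?_)
      rcases List.mem_cons.1 he with rfl | he
      · rfl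
      rcases List.mem_cons.1 he with rfl | he
      · rfl
      exact hw (hρ rfl) e he
    · exact .fixUnit
  | fold _ _ _ ih1 ih2 ih3 => exact .fold (ih1 hΓ hρ) (ih2 hΓ hρ) (ih3 hΓ hρ)

end LIQ

/-! ### Determinism and evaluation contexts of Quot -/

namespace LIQ

variable {S : Signature} {δ : (o : S.Op) → (Fin (S.arity o) → S.Const) → S.Const}
  {Ω : Set (Query S × NVal S)}

namespace QTm

theorem IsQuotVal.not_step {M : QTm S} (h : IsQuotVal M) {a N} : ¬ Step δ Ω .quoted M a N := by
  intro hs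
  induction h generalizing N with
  | op _ ih => cases hs with | qOp _ h => exact ih _ h
  | record _ ih => cases hs with | qRecord _ h => exact ih _ h
  | lam _ ih => cases hs with | qLam h => exact ih h
  | app _ _ ih1 ih2 => cases hs with | qAppL h => exact ih1 h | qAppR _ h => exact ih2 h
  | cond _ _ ih1 ih2 => cases hs with | qCondL h => exact ih1 h | qCondR _ h => exact ih2 h
  | union _ _ ih1 ih2 => cases hs with | qUnionL h => exact ih1 h | qUnionR _ h => exact ih2 h
  | bind _ _ ih1 ih2 => cases hs with | qBindL h => exact ih1 h | qBindR _ h => exact ih2 h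
  | sing _ ih => cases hs with | qSing h => exact ih h
  | proj _ ih => cases hs with | qProj h => exact ih h
  | _ => cases hs

theorem IsVal.not_step {M : QTm S} (h : IsVal M) {a N} : ¬ Step δ Ω .host M a N := by
  intro hs
  induction h generalizing N with
  | record _ _ ih => cases hs with | record _ h => exact ih _ h
  | cons hV _ _ _ ih =>
    cases hs with
    | unionL h => exact h ⟨_, hV, rfl⟩
    | unionR _ h => exact ih h
  | quote h => cases hs with | quote hs => exact h.not_step hs
  | _ => cases hs

theorem isVal_of_cons {V W : QTm S} (h : IsVal (union (sing V) W)) : IsVal V := by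
  cases h; assumption

/-- Silent steps are deterministic. -/
theorem Step.det {L : Level} {M N P : QTm S} {a b} (h : Step δ Ω L M a N) (ha : a = none)
    (h' : Step δ Ω L M b P) : b = none ∧ N = P := by
  induction h generalizing b P with
  | delta o c =>
    generalize hX : (QTm.op o fun i => .const (c i)) = X at h'
    cases h' with
    | delta o' c' =>
      injection hX with h1 h2
      subst h1
      have : c = c' := funext fun i => by simpa using congrFun (eq_of_heq h2) i
      subst this
      exact ⟨rfl, rfl⟩
    | op _ h =>
      cases hX
      exact absurd h (IsVal.const _).not_step
    | _ => cases hX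
  | @projRecord n l V i hV =>
    generalize hX : (QTm.proj (QTm.record l V) (l i)) = X at h'
    cases h' with
    | projRecord j =>
      injection hX with h1 h2
      cases h1
      cases l.injective h2
      exact ⟨rfl, rfl⟩
    | proj h =>
      cases hX
      exact absurd h (IsVal.record _ hV).not_step
    | _ => cases hX
  | runQuery => cases ha
  | condTrue =>
    generalize hX : QTm.cond _ _ = X at h'
    cases h' with
    | condTrue => cases hX; exact ⟨rfl, rfl⟩
    | condFalse =>
      simp only [QTm.cond.injEq, QTm.const.injEq] at hX
      exact absurd hX.1 S.tt_ne_ff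
    | cond h => cases hX; exact absurd h (IsVal.const _).not_step
    | _ => cases hX
  | condFalse =>
    generalize hX : QTm.cond _ _ = X at h'
    cases h' with
    | condFalse => cases hX; exact ⟨rfl, rfl⟩
    | condTrue =>
      simp only [QTm.cond.injEq, QTm.const.injEq] at hX
      exact absurd hX.1.symm S.tt_ne_ff
    | cond h => cases hX; exact absurd h (IsVal.const _).not_step
    | _ => cases hX
  | @op o M i a N hv h ih =>
    generalize hX : QTm.op o M = X at h'
    cases h' with
    | delta =>
      cases hX
      exact absurd h (IsVal.const _).not_step
    | @op _ _ j _ _ hv' h' =>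
      cases hX
      rcases lt_trichotomy i j with hij | rfl | hij
      · exact absurd h (hv' _ hij).not_step
      · obtain ⟨rfl, rfl⟩ := ih ha h'
        exact ⟨rfl, rfl⟩
      · exact absurd h' (hv _ hij).not_step
    | _ => cases hX
  | @record n l M i a N hv h ih =>
    generalize hX : QTm.record l M = X at h'
    cases h' with
    | @record _ _ _ j _ _ hv' h' =>
      cases hX
      rcases lt_trichotomy i j with hij | rfl | hij
      · exact absurd h (hv' _ hij).not_step
      · obtain ⟨rfl, rfl⟩ := ih ha h'
        exact ⟨rfl, rfl⟩
      · exact absurd h' (hv _ hij).not_step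
    | _ => cases hX
  | @qOp o M i a N hv h ih =>
    generalize hX : QTm.op o M = X at h'
    cases h' with
    | @qOp _ _ j _ _ hv' h' =>
      cases hX
      rcases lt_trichotomy i j with hij | rfl | hij
      · exact absurd h (hv' _ hij).not_step
      · obtain ⟨rfl, rfl⟩ := ih ha h'
        exact ⟨rfl, rfl⟩
      · exact absurd h' (hv _ hij).not_step
    | _ => cases hX
  | @qRecord n l M i a N hv h ih =>
    generalize hX : QTm.record l M = X at h'
    cases h' with
    | @qRecord _ _ _ j _ _ hv' h' =>
      cases hX
      rcases lt_trichotomy i j with hij | rfl | hij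
      · exact absurd h (hv' _ hij).not_step
      · obtain ⟨rfl, rfl⟩ := ih ha h'
        exact ⟨rfl, rfl⟩
      · exact absurd h' (hv _ hij).not_step
    | _ => cases hX
  | proj h ih =>
    generalize hX : QTm.proj _ _ = X at h'
    cases h' with
    | projRecord _ hV =>
      cases hX
      exact absurd h (IsVal.record _ hV).not_step
    | proj h' =>
      cases hX
      obtain ⟨rfl, rfl⟩ := ih ha h'
      exact ⟨rfl, rfl⟩
    | _ => cases hX
  | _ =>
    cases h' <;> grind [IsVal.not_step, IsQuotVal.not_step, IsVal.lam, IsVal.fix,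
      IsVal.const, IsVal.nil, IsVal.quote, isVal_of_cons, IsValSing]

/-- Evaluation frames; the flag singles out the left operand of a union, in which the singleton of
a value does not step. -/
inductive Frame : Bool → (QTm S → QTm S) → Prop
  | op {o} {M : Fin (S.arity o) → QTm S} {i} : (∀ j, j < i → IsVal (M j)) →
      Frame false fun P => .op o (Function.update M i P)
  | lift : Frame false .lift
  | appL (N) : Frame false fun P => .app P N
  | appR {V} : IsVal V → Frame false fun P => .app V P
  | record {n} {l : Fin n ↪ String} {M : Fin n → QTm S} {i} : (∀ j, j < i → IsVal (M j)) →
      Frame false fun P => .record l (Function.update M i P)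
  | proj (l) : Frame false fun P => .proj P l
  | sing : Frame false .sing
  | unionL (N) : Frame true fun P => .union P N
  | unionR {V} : IsVal V ∨ IsValSing V → Frame false fun P => .union V P
  | bind (A N) : Frame false fun P => .bind A P N
  | cond (M) : Frame false fun P => .cond P M
  | fold (M N) : Frame false fun P => .fold P M N
  | query : Frame false .query

theorem Frame.step {F : QTm S → QTm S} {b} (hF : Frame b F) {M N a} (hM : b = true → ¬ IsValSing M)
    (h : Step δ Ω .host M a N) : Step δ Ω .host (F M) a (F N) := by
  cases hF with
  | op hv =>
    have := Step.op (M := Function.update _ _ M) (N := N) (fun j hj => by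
      rw [Function.update_of_ne (ne_of_lt hj)]; exact hv j hj) (by simpa using h)
    simpa using this
  | @record n l _ _ hv =>
    have := Step.record (l := l) (M := Function.update _ _ M) (N := N) (fun j hj => by
      rw [Function.update_of_ne (ne_of_lt hj)]; exact hv j hj) (by simpa using h)
    simpa using this
  | unionL => exact .unionL (hM rfl) h
  | unionR hV => exact .unionR hV h
  | appR hV => exact .appR hV h
  | _ => constructor; assumption

/-- A rule at the root of `F M`, or a step in an operand after the hole, needs the hole to contain a
value or, to the left of a union, a singleton of a value. The operands before the hole are finished
and do not step. So only M can move. -/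
theorem Frame.inv {F : QTm S → QTm S} {b} (hF : Frame b F) {M P a} (hM : ¬ IsVal M) (hM' : ¬ IsValSing M)
    (h : Step δ Ω .host (F M) a P) : ∃ N, Step δ Ω .host M a N ∧ P = F N := by
  cases hF with
  | @op o K i hv =>
    beta_reduce at h
    generalize hX : QTm.op o (Function.update K i M) = X at h
    cases h with
    | delta o' c =>
      injection hX with h1 h2
      subst h1
      have := congrFun (eq_of_heq h2) i
      simp only [Function.update_self] at this
      exact absurd (this ▸ IsVal.const _) hM
    | @op _ _ j _ _ hv' h' =>
      cases hX
      rcases lt_trichotomy i j with hij | rfl | hij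
      · exact absurd (by simpa using hv' _ hij) hM
      · rw [Function.update_self] at h'
        exact ⟨_, h', by simp⟩
      · rw [Function.update_of_ne (ne_of_lt hij)] at h'
        exact absurd h' (hv _ hij).not_step
    | _ => cases hX
  | @record n l K i hv =>
    beta_reduce at h
    generalize hX : QTm.record l (Function.update K i M) = X at h
    cases h with
    | @record _ _ _ j _ _ hv' h' =>
      cases hX
      rcases lt_trichotomy i j with hij | rfl | hij
      · exact absurd (by simpa using hv' _ hij) hM
      · rw [Function.update_self] at h'
        exact ⟨_, h', by simp⟩
      · rw [Function.update_of_ne (ne_of_lt hij)] at h'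
        exact absurd h' (hv _ hij).not_step
    | _ => cases hX
  | proj =>
    cases h with
    | projRecord i hV => exact absurd (.record _ hV) hM
    | proj h => exact ⟨_, h, rfl⟩
  | _ =>
    cases h <;> grind [IsVal.not_step, IsVal.lam, IsVal.fix,
      IsVal.const, IsVal.nil, IsVal.quote, IsValSing]

/-- Evaluation contexts. -/
inductive Ctx : (QTm S → QTm S) → Prop
  | hole : Ctx fun P => P
  | frame {b F C} : Frame b F → Ctx C → Ctx fun P => F (C P)

theorem Frame.not_isVal {F : QTm S → QTm S} {b} (hF : Frame b F) {M} (hM : ¬ IsVal M)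
    (hM' : b = true → ¬ IsValSing M) : ¬ IsVal (F M) ∧ ¬ IsValSing (F M) := by
  cases hF with
  | @record n l K i =>
    refine ⟨fun h => ?_, by simp [IsValSing]⟩
    cases h with
    | record _ h => exact hM (by simpa using h i)
  | sing => exact ⟨nofun, by rintro ⟨V, hV, h⟩; cases h; exact hM hV⟩
  | unionL =>
    refine ⟨fun h => ?_, by simp [IsValSing]⟩
    cases h with
    | cons h => exact hM' rfl ⟨_, h, rfl⟩
  | unionR =>
    refine ⟨fun h => ?_, by simp [IsValSing]⟩
    cases h with
    | cons _ h => exact hM h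
  | _ => exact ⟨nofun, by simp [IsValSing]⟩

theorem Ctx.not_isVal {C : QTm S → QTm S} (hC : Ctx C) (M) :
    ¬ IsVal (C (.query M)) ∧ ¬ IsValSing (C (.query M)) := by
  induction hC with
  | hole => exact ⟨nofun, by simp [IsValSing]⟩
  | frame hF _ ih => exact hF.not_isVal ih.1 fun _ => ih.2

theorem Ctx.step {C : QTm S → QTm S} (hC : Ctx C) {M N a}
    (h : Step δ Ω .host (.query M) a N) : Step δ Ω .host (C (.query M)) a (C N) := by
  induction hC with
  | hole => exact h
  | @frame b F C hF hC ih => exact hF.step (fun _ => (hC.not_isVal M).2) ih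

theorem Ctx.inv {C : QTm S → QTm S} (hC : Ctx C) {M P a}
    (h : Step δ Ω .host (C (.query M)) a P) : ∃ N, Step δ Ω .host (.query M) a N ∧ P = C N := by
  induction hC generalizing P with
  | hole => exact ⟨P, h, rfl⟩
  | @frame b F C hF hC ih =>
    obtain ⟨N, h1, rfl⟩ := hF.inv (hC.not_isVal M).1 (hC.not_isVal M).2 h
    obtain ⟨N, h2, rfl⟩ := ih h1
    exact ⟨N, h2, rfl⟩

/-- A quotation value does not step, so running the query is the only move, and it is visible. -/
theorem Ctx.step_query_quote {C : QTm S → QTm S} (hC : Ctx C) {Q P a} (hQ : IsQuotVal Q)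
    (h : Step δ Ω .host (C (.query (.quote Q))) a P) :
    ∃ q V, Norm Q q ∧ (q, V) ∈ Ω ∧ a = some (q, V) ∧ P = C (ofVal V) := by
  obtain ⟨N, h1, rfl⟩ := hC.inv h
  cases h1 with
  | runQuery _ h1 h2 => exact ⟨_, _, h1, h2, rfl, rfl⟩
  | query h1 => exact absurd h1 (IsVal.quote hQ).not_step

end QTm
end LIQ

/-! ### Determinism and evaluation contexts of Eff -/

namespace LIQ

variable {S : Signature} {δ : (o : S.Op) → (Fin (S.arity o) → S.Const) → S.Const}
  {Ω : Set (Query S × NVal S)}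

namespace ETm

theorem IsVal.not_step {M : ETm S} (h : IsVal M) {a N} : ¬ Step δ Ω M a N := by
  intro hs
  induction h generalizing N with
  | record _ _ ih => cases hs with | record _ h => exact ih _ h
  | cons hV _ _ _ ih =>
    cases hs with
    | unionL h => exact h ⟨_, hV, rfl⟩
    | unionR _ h => exact ih h
  | _ => cases hs

theorem IsValSing.not_isVal {M : ETm S} (h : IsValSing M) : ¬ IsVal M := by
  obtain ⟨V, -, rfl⟩ := h
  intro h
  cases h

/-- Silent steps are deterministic. -/
theorem Step.det {M N P : ETm S} {a b} (h : Step δ Ω M a N) (ha : a = none)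
    (h' : Step δ Ω M b P) : b = none ∧ N = P := by
  induction h generalizing b P with
  | delta o c =>
    generalize hX : (ETm.op o fun i => .const (c i)) = X at h'
    cases h' with
    | delta o' c' =>
      injection hX with h1 h2
      subst h1
      have : c = c' := funext fun i => by simpa using congrFun (eq_of_heq h2) i
      subst this
      exact ⟨rfl, rfl⟩
    | op _ h =>
      cases hX
      exact absurd h (IsVal.const _).not_step
    | _ => cases hX
  | @projRecord n l V i hV =>
    generalize hX : (ETm.proj (ETm.record l V) (l i)) = X at h'
    cases h' with
    | projRecord j =>
      injection hX with h1 h2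
      cases h1
      cases l.injective h2
      exact ⟨rfl, rfl⟩
    | proj h =>
      cases hX
      exact absurd h (IsVal.record _ hV).not_step
    | _ => cases hX
  | runQuery => cases ha
  | condTrue =>
    generalize hX : ETm.cond _ _ = X at h'
    cases h' with
    | condTrue => cases hX; exact ⟨rfl, rfl⟩
    | condFalse =>
      simp only [ETm.cond.injEq, ETm.const.injEq] at hX
      exact absurd hX.1 S.tt_ne_ff
    | cond h => cases hX; exact absurd h (IsVal.const _).not_step
    | _ => cases hX
  | condFalse =>
    generalize hX : ETm.cond _ _ = X at h'
    cases h' with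
    | condFalse => cases hX; exact ⟨rfl, rfl⟩
    | condTrue =>
      simp only [ETm.cond.injEq, ETm.const.injEq] at hX
      exact absurd hX.1.symm S.tt_ne_ff
    | cond h => cases hX; exact absurd h (IsVal.const _).not_step
    | _ => cases hX
  | @op o M i a N hv h ih =>
    generalize hX : ETm.op o M = X at h'
    cases h' with
    | delta =>
      cases hX
      exact absurd h (IsVal.const _).not_step
    | @op _ _ j _ _ hv' h' =>
      cases hX
      rcases lt_trichotomy i j with hij | rfl | hij
      · exact absurd h (hv' _ hij).not_step
      · obtain ⟨rfl, rfl⟩ := ih ha h'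
        exact ⟨rfl, rfl⟩
      · exact absurd h' (hv _ hij).not_step
    | _ => cases hX
  | @record n l M i a N hv h ih =>
    generalize hX : ETm.record l M = X at h'
    cases h' with
    | @record _ _ _ j _ _ hv' h' =>
      cases hX
      rcases lt_trichotomy i j with hij | rfl | hij
      · exact absurd h (hv' _ hij).not_step
      · obtain ⟨rfl, rfl⟩ := ih ha h'
        exact ⟨rfl, rfl⟩
      · exact absurd h' (hv _ hij).not_step
    | _ => cases hX
  | proj h ih =>
    generalize hX : ETm.proj _ _ = X at h'
    cases h' with
    | projRecord _ hV =>
      cases hX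
      exact absurd h (IsVal.record _ hV).not_step
    | proj h' =>
      cases hX
      obtain ⟨rfl, rfl⟩ := ih ha h'
      exact ⟨rfl, rfl⟩
    | _ => cases hX
  | _ =>
    cases h' <;> grind [IsVal.not_step, IsValSing.not_isVal, IsVal.lam, IsVal.fix,
      IsVal.const, IsVal.nil, IsValSing]

/-- Evaluation frames; the flag singles out the left operand of a union, in which the singleton of
a value does not step. -/
inductive Frame : Bool → (ETm S → ETm S) → Prop
  | op {o} {M : Fin (S.arity o) → ETm S} {i} : (∀ j, j < i → IsVal (M j)) →
      Frame false fun P => .op o (Function.update M i P)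
  | appL (N) : Frame false fun P => .app P N
  | appR {V} : IsVal V → Frame false fun P => .app V P
  | record {n} {l : Fin n ↪ String} {M : Fin n → ETm S} {i} : (∀ j, j < i → IsVal (M j)) →
      Frame false fun P => .record l (Function.update M i P)
  | proj (l) : Frame false fun P => .proj P l
  | sing : Frame false .sing
  | unionL (N) : Frame true fun P => .union P N
  | unionR {V} : IsVal V ∨ IsValSing V → Frame false fun P => .union V P
  | bind (A N) : Frame false fun P => .bind A P N
  | cond (M) : Frame false fun P => .cond P M
  | fold (M N) : Frame false fun P => .fold P M N

theorem Frame.step {F : ETm S → ETm S} {b} (hF : Frame b F) {M N a} (hM : b = true → ¬ IsValSing M)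
    (h : Step δ Ω M a N) : Step δ Ω (F M) a (F N) := by
  cases hF with
  | op hv =>
    have := Step.op (M := Function.update _ _ M) (N := N) (fun j hj => by
      rw [Function.update_of_ne (ne_of_lt hj)]; exact hv j hj) (by simpa using h)
    simpa using this
  | @record n l _ _ hv =>
    have := Step.record (l := l) (M := Function.update _ _ M) (N := N) (fun j hj => by
      rw [Function.update_of_ne (ne_of_lt hj)]; exact hv j hj) (by simpa using h)
    simpa using this
  | unionL => exact .unionL (hM rfl) h
  | unionR hV => exact .unionR hV h
  | appR hV => exact .appR hV h
  | _ => constructor; assumption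

theorem Frame.inv {F : ETm S → ETm S} {b} (hF : Frame b F) {M P a} (hM : ¬ IsVal M) (hM' : ¬ IsValSing M)
    (h : Step δ Ω (F M) a P) : ∃ N, Step δ Ω M a N ∧ P = F N := by
  cases hF with
  | @op o K i hv =>
    beta_reduce at h
    generalize hX : ETm.op o (Function.update K i M) = X at h
    cases h with
    | delta o' c =>
      injection hX with h1 h2
      subst h1
      have := congrFun (eq_of_heq h2) i
      simp only [Function.update_self] at this
      exact absurd (this ▸ IsVal.const _) hM
    | @op _ _ j _ _ hv' h' =>
      cases hX
      rcases lt_trichotomy i j with hij | rfl | hij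
      · exact absurd (by simpa using hv' _ hij) hM
      · rw [Function.update_self] at h'
        exact ⟨_, h', by simp⟩
      · rw [Function.update_of_ne (ne_of_lt hij)] at h'
        exact absurd h' (hv _ hij).not_step
    | _ => cases hX
  | @record n l K i hv =>
    beta_reduce at h
    generalize hX : ETm.record l (Function.update K i M) = X at h
    cases h with
    | @record _ _ _ j _ _ hv' h' =>
      cases hX
      rcases lt_trichotomy i j with hij | rfl | hij
      · exact absurd (by simpa using hv' _ hij) hM
      · rw [Function.update_self] at h'
        exact ⟨_, h', by simp⟩
      · rw [Function.update_of_ne (ne_of_lt hij)] at h'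
        exact absurd h' (hv _ hij).not_step
    | _ => cases hX
  | proj =>
    cases h with
    | projRecord i hV => exact absurd (.record _ hV) hM
    | proj h => exact ⟨_, h, rfl⟩
  | _ =>
    cases h <;> grind [IsVal.not_step, IsValSing.not_isVal, IsVal.lam, IsVal.fix,
      IsVal.const, IsVal.nil, IsValSing]

/-- Evaluation contexts. -/
inductive Ctx : (ETm S → ETm S) → Prop
  | hole : Ctx fun P => P
  | frame {b F C} : Frame b F → Ctx C → Ctx fun P => F (C P)

theorem Frame.not_isVal {F : ETm S → ETm S} {b} (hF : Frame b F) {M} (hM : ¬ IsVal M)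
    (hM' : b = true → ¬ IsValSing M) : ¬ IsVal (F M) ∧ ¬ IsValSing (F M) := by
  cases hF with
  | @record n l K i =>
    refine ⟨fun h => ?_, by simp [IsValSing]⟩
    cases h with
    | record _ h => exact hM (by simpa using h i)
  | sing => exact ⟨nofun, by rintro ⟨V, hV, h⟩; cases h; exact hM hV⟩
  | unionL =>
    refine ⟨fun h => ?_, by simp [IsValSing]⟩
    cases h with
    | cons h => exact hM' rfl ⟨_, h, rfl⟩
  | unionR =>
    refine ⟨fun h => ?_, by simp [IsValSing]⟩
    cases h with
    | cons _ h => exact hM h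
  | _ => exact ⟨nofun, by simp [IsValSing]⟩

theorem Ctx.not_isVal {C : ETm S → ETm S} (hC : Ctx C) (M) :
    ¬ IsVal (C (.query M)) ∧ ¬ IsValSing (C (.query M)) := by
  induction hC with
  | hole => exact ⟨nofun, by simp [IsValSing]⟩
  | frame hF _ ih => exact hF.not_isVal ih.1 fun _ => ih.2

theorem Ctx.step {C : ETm S → ETm S} (hC : Ctx C) {M N a}
    (h : Step δ Ω (.query M) a N) : Step δ Ω (C (.query M)) a (C N) := by
  induction hC with
  | hole => exact h
  | @frame b F C hF hC ih => exact hF.step (fun _ => (hC.not_isVal M).2) ih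

theorem Ctx.step_query {C : ETm S → ETm S} (hC : Ctx C) {M P a}
    (h : Step δ Ω (C (.query M)) a P) :
    ∃ q V, Norm M q ∧ (q, V) ∈ Ω ∧ a = some (q, V) ∧ P = C (ofVal V) := by
  induction hC generalizing P with
  | hole => cases h with | runQuery h1 h2 => exact ⟨_, _, h1, h2, rfl, rfl⟩
  | @frame b F C hF hC ih =>
    obtain ⟨N, h1, rfl⟩ := hF.inv (hC.not_isVal M).1 (hC.not_isVal M).2 h
    exact (ih h1).imp fun q ⟨V, k1, k2, k3, k4⟩ => ⟨V, k1, k2, k3, by rw [k4]⟩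

end ETm
end LIQ

/-! ### Evaluation of splices and of reification -/

namespace LIQ

variable {S : Signature} {δ : (o : S.Op) → (Fin (S.arity o) → S.Const) → S.Const}
  {Ω : Set (Query S × NVal S)}

open ETm (DbTyped erase)
open Relation (ReflTransGen TransGen)

theorem star_lift {α : Type} {r R : α → α → Prop} (f : α → α) (hf : ∀ a b, r a b → R (f a) (f b))
    {a b : α} (h : ReflTransGen r a b) : ReflTransGen R (f a) (f b) := by
  induction h with
  | refl => exact .refl
  | tail _ h ih => exact ih.tail (hf _ _ h)

/-- Left-to-right evaluation of the operands of a constructor `F`: at stage `k` exactly the first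
`k` operands have been evaluated. `V` is the condition that lets evaluation pass on, values at host
level and quotation values below a quotation. -/
theorem star_family {n : ℕ} {r R : QTm S → QTm S → Prop} {V : QTm S → Prop}
    {F : (Fin n → QTm S) → QTm S}
    (hF : ∀ M i N, (∀ j, j < i → V (M j)) → r (M i) N → R (F M) (F (Function.update M i N)))
    {M M' : Fin n → QTm S} (k : ℕ)
    (hM : ∀ j : Fin n, j.val < k → ReflTransGen r (M j) (M' j) ∧ V (M' j)) :
    ReflTransGen R (F M) (F fun j => if j.val < k then M' j else M j) := by
  induction k with
  | zero => simpa using ReflTransGen.refl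
  | succ k ih =>
    refine (ih fun j hj => hM j (by omega)).trans ?_
    by_cases hk : k < n
    · set st : Fin n → QTm S := fun j => if j.val < k then M' j else M j with hst
      have hlift : ∀ P, ReflTransGen r (M ⟨k, hk⟩) P →
          ReflTransGen R (F st) (F (Function.update st ⟨k, hk⟩ P)) := by
        intro P hP
        induction hP with
        | refl =>
          have : Function.update st ⟨k, hk⟩ (M ⟨k, hk⟩) = st := by
            rw [Function.update_eq_self_iff]; simp [hst]
          rw [this]
        | tail _ h ih =>
          refine ih.tail ?_
          have := hF (Function.update st ⟨k, hk⟩ _) ⟨k, hk⟩ _ (fun j hj => ?_)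
            (by rwa [Function.update_self])
          · rwa [Function.update_idem] at this
          · rw [Function.update_of_ne (ne_of_lt hj)]
            have hj' : j.val < k := hj
            simp only [hst, hj', if_true]
            exact (hM j (by omega)).2
      have := hlift _ (hM ⟨k, hk⟩ (by simp)).1
      convert this using 2
      funext j
      by_cases hj : j = ⟨k, hk⟩
      · subst hj; simp
      · have hj' : j.val ≠ k := fun h => hj (Fin.ext h)
        rw [Function.update_of_ne hj]
        have : (j.val < k + 1) = (j.val < k) := by simp; omega
        simp only [hst, this]
    · convert ReflTransGen.refl using 2
      funext j
      have := j.isLt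
      have h1 : j.val < k := by omega
      have h2 : j.val < k + 1 := by omega
      simp [h1, h2]

theorem star_family_all {n : ℕ} {r R : QTm S → QTm S → Prop} {V : QTm S → Prop}
    {F : (Fin n → QTm S) → QTm S}
    (hF : ∀ M i N, (∀ j, j < i → V (M j)) → r (M i) N → R (F M) (F (Function.update M i N)))
    {M M' : Fin n → QTm S} (hM : ∀ j : Fin n, ReflTransGen r (M j) (M' j) ∧ V (M' j)) :
    ReflTransGen R (F M) (F M') := by
  simpa using star_family hF n fun j _ => hM j

namespace QTm

/-- Silent host steps. -/
abbrev HostSteps (δ : (o : S.Op) → (Fin (S.arity o) → S.Const) → S.Const)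
    (Ω : Set (Query S × NVal S)) : QTm S → QTm S → Prop :=
  ReflTransGen fun M N => Step δ Ω .host M none N

/-- Silent steps below a quotation. -/
abbrev QuotedSteps (δ : (o : S.Op) → (Fin (S.arity o) → S.Const) → S.Const)
    (Ω : Set (Query S × NVal S)) : QTm S → QTm S → Prop :=
  ReflTransGen fun M N => Step δ Ω .quoted M none N

/-- Silent host steps that also take place in the left operand of a union. -/
def SStep (δ : (o : S.Op) → (Fin (S.arity o) → S.Const) → S.Const)
    (Ω : Set (Query S × NVal S)) (M N : QTm S) : Prop :=
  Step δ Ω .host M none N ∧ ¬ IsValSing M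

/-- Sequences of such steps. -/
abbrev Steps (δ : (o : S.Op) → (Fin (S.arity o) → S.Const) → S.Const)
    (Ω : Set (Query S × NVal S)) : QTm S → QTm S → Prop :=
  ReflTransGen (SStep δ Ω)

theorem HostSteps.lift (f : QTm S → QTm S) {L : Level}
    (hf : ∀ M N, Step δ Ω .host M none N → Step δ Ω L (f M) none (f N)) {M N : QTm S}
    (h : HostSteps δ Ω M N) : ReflTransGen (fun M N => Step δ Ω L M none N) (f M) (f N) :=
  star_lift f hf h

theorem QuotedSteps.lift (f : QTm S → QTm S) {L : Level}
    (hf : ∀ M N, Step δ Ω .quoted M none N → Step δ Ω L (f M) none (f N)) {M N : QTm S}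
    (h : QuotedSteps δ Ω M N) : ReflTransGen (fun M N => Step δ Ω L M none N) (f M) (f N) :=
  star_lift f hf h

theorem QuotedSteps.quote {M N : QTm S} (h : QuotedSteps δ Ω M N) :
    Steps δ Ω (.quote M) (.quote N) :=
  star_lift QTm.quote (fun _ _ h => ⟨Step.quote h, by simp [IsValSing]⟩) h

theorem Steps.host {M N : QTm S} (h : Steps δ Ω M N) : HostSteps δ Ω M N :=
  star_lift id (fun _ _ h => h.1) h

/-- Excluding singletons of values from the sources makes these steps pass through every frame,
including the left operand of a union. The framed source is again no such singleton, since a term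
that steps is not a value. -/
theorem SStep.frame {b F} (hF : Frame b F) {M N : QTm S} (h : SStep δ Ω M N) :
    SStep δ Ω (F M) (F N) :=
  ⟨hF.step (fun _ => h.2) h.1, (hF.not_isVal (fun hv => hv.not_step h.1) fun _ => h.2).2⟩

theorem Steps.frame {b F} (hF : Frame b F) {M N : QTm S} (h : Steps δ Ω M N) :
    Steps δ Ω (F M) (F N) :=
  star_lift F (fun _ _ h => h.frame hF) h

end QTm

open QTm

namespace EffEnv

/-- All variables are bound at `db`, and keep their indices. -/
def IsDb (ρ : EffEnv S) : Prop := ∀ (i : ℕ) (A : ETy S) (X : Effect) (k s : ℕ),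
  ρ[i]? = some ⟨A, X, k, s⟩ → X = .db ∧ k = i

theorem isDb_nil : IsDb ([] : EffEnv S) := by simp [IsDb]

theorem IsDb.bindDb {ρ : EffEnv S} (h : IsDb ρ) (A : ETy S) : IsDb (ρ.bindDb A) := by
  intro i B X k s hi
  cases i with
  | zero => cases hi; exact ⟨rfl, rfl⟩
  | succ i =>
    obtain ⟨k, s, hj, rfl, rfl⟩ := weaken_some.1 hi
    obtain ⟨rfl, rfl⟩ := h _ _ _ _ _ hj
    exact ⟨rfl, rfl⟩

end EffEnv

/-- The splices of a query term are evaluated. -/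
theorem Rel.quotedSteps {ρ : EffEnv S} {M : ETm S} {A : ETy S} {N : QTm S} (h : Rel .db ρ M A N)
    (hρ : ρ.IsDb) : QuotedSteps δ Ω N (erase M) := by
  generalize hX : Effect.db = X at h
  induction h with
  | var h => rw [(hρ _ _ _ _ _ h).2]; exact .refl
  | shadow h => exact absurd (hρ _ _ _ _ _ h).1 (by simp)
  | spliced h => exact .single (.splice h.isQuotVal_erase)
  | const h => exact .refl
  | op h _ ih =>
    subst hX
    exact star_family_all (F := QTm.op _) (fun M i N => Step.qOp)
      fun i => ⟨ih i hρ rfl, (h i).dbTyped.isQuotVal_erase⟩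
  | record h ih =>
    subst hX
    exact star_family_all (F := QTm.record _) (fun M i N => Step.qRecord)
      fun i => ⟨ih i hρ rfl, (h i).dbTyped.isQuotVal_erase⟩
  | lamDb _ ih => exact (ih (hρ.bindDb _) hX).lift _ fun _ _ => .qLam
  | app h _ ih1 ih2 =>
    subst hX
    exact ((ih1 hρ rfl).lift (fun M => .app M _) fun _ _ => .qAppL).trans
      ((ih2 hρ rfl).lift (fun M => .app _ M) fun _ _ => .qAppR h.dbTyped.isQuotVal_erase)
  | cond h _ ih1 ih2 =>
    subst hX
    exact ((ih1 hρ rfl).lift (fun M => .cond M _) fun _ _ => .qCondL).trans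
      ((ih2 hρ rfl).lift (fun M => .cond _ M) fun _ _ => .qCondR h.dbTyped.isQuotVal_erase)
  | union h _ ih1 ih2 =>
    subst hX
    exact ((ih1 hρ rfl).lift (fun M => .union M _) fun _ _ => .qUnionL).trans
      ((ih2 hρ rfl).lift (fun M => .union _ M) fun _ _ => .qUnionR h.dbTyped.isQuotVal_erase)
  | bindDb h _ ih1 ih2 =>
    exact ((ih1 hρ rfl).lift (fun M => .bind _ M _) fun _ _ => .qBindL).trans
      ((ih2 (hρ.bindDb _) rfl).lift (fun M => .bind _ _ M) fun _ _ =>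
        .qBindR h.dbTyped.isQuotVal_erase)
  | proj i _ h1 h2 ih => exact (ih hρ hX).lift (fun M => .proj M _) fun _ _ => .qProj
  | sing _ ih => exact (ih hρ hX).lift _ fun _ _ => .qSing
  | empty => exact .refl
  | lamUnit => exact .refl
  | fixUnit => exact .refl
  | table => exact .refl
  | _ => cases hX

/-- Reification of a value evaluates to its translation. -/
theorem Rel.reify_steps {V : ETm S} {A : ETy S} {V' N : QTm S} (h : Rel .pl [] V A V')
    (hV : ETm.IsVal V) (hV' : IsVal V') (hN : HostSteps δ Ω N V') :
    QuotedSteps δ Ω (reify A N) (erase V) := by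
  induction A generalizing V V' N with
  | base O =>
    cases hV <;> cases h
    exact ((hN.lift _ fun _ _ => .lift).lift _ fun _ _ => .antiquote).trans
      ((ReflTransGen.single (.antiquote (.liftConst _))).tail (.splice (.const _)))
  | fn A E B =>
    cases E
    · cases hV <;> cases h <;> exact .refl
    -- A value of a function type of effect db is represented by a quotation, so reifying it is a
    -- splice.
    · refine (hN.lift _ fun _ _ => .antiquote).trans ?_
      cases hV <;> cases h
      · rename_i h
        have h' := h.lamDb
        exact ((h'.quotedSteps EffEnv.isDb_nil).quote.host.lift _ fun _ _ => .antiquote).tail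
          (.splice h'.dbTyped.isQuotVal_erase)
      · rename_i h
        exact .single (.splice h.isQuotVal_erase)
  | rcd l A ih =>
    cases hV <;> cases h
    rename_i hV _ h
    cases hV' with
    | record _ hV' =>
      exact star_family_all (F := QTm.record _) (fun M i N => Step.qRecord)
        fun i => ⟨ih i (h i) (hV i) (hV' i) ((hN.lift (fun M => .proj M _) fun _ _ => .proj).tail
          (.projRecord _ hV')), ((h i).dbTyped_of_isVal (hV i)).isQuotVal_erase⟩
  | bag A ih =>
    refine ((hN.lift (fun M => .fold M _ _) fun _ _ => .fold).lift _ fun _ _ => .antiquote).trans ?_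
    -- The fold computes the quotation of `erase V`, and this last step splices it; it remains to
    -- evaluate the fold, by induction on the bag.
    refine ReflTransGen.tail ?_ (.splice (h.dbTyped_of_isVal hV).isQuotVal_erase)
    refine HostSteps.lift _ (fun _ _ => .antiquote) ?_
    clear hN
    generalize hA : ETy.bag A = B at h
    induction hV generalizing V' with
    | nil =>
      subst hA
      cases h
      exact .single (.foldNil _ _)
    | @cons V W hV _ _ _ ih' =>
      subst hA
      have ht := h.dbTyped_of_isVal (.cons hV ‹_› ‹_›)
      cases h with
      | union h1 h2 =>
      cases h1 with
      | sing h1 =>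
      have hW := h2.dbTyped_of_isVal ‹_›
      have hVV := h1.dbTyped_of_isVal ‹_›
      have hc := hV'
      cases hV' with
      | cons hV1 hW1 =>
      refine (ReflTransGen.single (.foldCons hc)).tail (.appL (.beta hV1)) |>.trans ?_
      refine (HostSteps.lift (fun M => .app _ M) (fun _ _ => .appR (.lam _ _))
        (ih' hW1 h2)).trans ?_
      refine ReflTransGen.head (.beta (.quote hW.isQuotVal_erase)) ?_
      -- Index 1 has received the first element and index 0 the quoted erasure of the tail. What
      -- remains below the quotation is to reify the element, by the outer induction hypothesis, and
      -- to splice the tail.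
      simp only [QTm.subst, subst_reify, QTm.up, QTm.one]
      rw [subst_one_rename_succ]
      refine Steps.host (QuotedSteps.quote ?_)
      refine (QuotedSteps.lift (fun M => .union (.sing M) _) (fun _ _ h => .qUnionL (.qSing h))
        (ih h1 hV hV1 .refl)).tail (.qUnionR (.sing hVV.isQuotVal_erase) (.splice hW.isQuotVal_erase))
    | _ => subst hA; cases h

/-- The argument of the `let` evaluates to the quoted erasure, and a β step stores it in the shadow.
-/
theorem letIn_steps {V : ETm S} {A : ETy S} {V' : QTm S} (h : Rel .pl [] V A V')
    (hV : ETm.IsVal V) (hV' : IsVal V') (T : QTy S) (K : QTm S) :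
    Steps δ Ω (.letIn T (.quote (reify A V')) K) (K.subst (one (.quote (erase V)))) :=
  ((h.reify_steps hV hV' .refl).quote.frame (.appR (.lam _ _))).tail
    ⟨.beta (.quote (h.dbTyped_of_isVal hV).isQuotVal_erase), by simp [IsValSing]⟩

namespace Rel

/-- Shared by β and by the unfolding of a comprehension. After the `let`, index 1 holds V' and the
shadow at index 0 holds the quotation of `erase V`, which are the two components that `Substs`
requires. -/
theorem let_body {V K : ETm S} {A B : ETy S} {V' K' : QTm S}
    (hK : Rel .pl (EffEnv.bindPl A []) K B K') (h : Rel .pl [] V A V') (hV : ETm.IsVal V)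
    (hV' : IsVal V') :
    ∃ N, Steps δ Ω ((QTm.letIn (.quot (A.splice .db)) (.quote (reify A (.var 0))) K').subst
      (one V')) N ∧ Rel .pl [] (K.subst (ETm.one V)) B N := by
  simp only [QTm.letIn, QTm.subst, subst_reify]
  refine ⟨_, letIn_steps h hV hV' _ _, ?_⟩
  rw [subst_subst]
  refine hK.subst fun i C X k sh hi => ?_
  cases i with
  | zero =>
    cases hi
    simp only [QTm.up, QTm.one, QTm.subst, subst_one_rename_succ]
    exact ⟨h, fun _ => .spliced (h.dbTyped_of_isVal hV)⟩
  | succ i => simp [EffEnv.bindPl, EffEnv.weaken] at hi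

/-- The variant of `let_body` with two shadows. The shadow of the function holds the quoted empty
record, which by `hFe` is the quoted erasure of F. -/
theorem fix_body {V K F : ETm S} {A B : ETy S} {V' K' F' : QTm S}
    (hK : Rel .pl (EffEnv.bindFix A B []) K B K') (h : Rel .pl [] V A V') (hV : ETm.IsVal V)
    (hV' : IsVal V') (hF : Rel .pl [] F (.fn A .pl B) F') (hFV : ETm.IsVal F)
    (hFe : erase F = .unit) :
    ∃ N, Steps δ Ω ((QTm.letIn (.quot .unit) (.quote .unit)
        (.letIn (.quot (A.splice .db)) (.quote (reify A (.var 1))) K')).subst (two V' F')) N ∧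
      Rel .pl [] (K.subst (ETm.two V F)) B N := by
  simp only [QTm.letIn, QTm.subst, subst_reify, subst_unit]
  -- The shadow of the function is quoted already, so its `let` is contracted first, by one β step.
  refine Exists.imp (p := fun N => Steps δ Ω (QTm.subst (one (.quote .unit)) _) N ∧
    Rel .pl [] _ B N) (fun N h => ⟨.head ⟨.beta (.quote isQuotVal_unit), by simp [IsValSing]⟩ h.1,
      h.2⟩) ?_
  simp only [QTm.subst, subst_reify, QTm.up, QTm.two, subst_one_rename_succ]
  refine ⟨_, letIn_steps h hV hV' _ _, ?_⟩
  rw [subst_subst, subst_subst]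
  refine hK.subst fun i C X k sh hi => ?_
  rcases i with _ | _ | i
  · cases hi
    simp only [QTm.up, QTm.one, QTm.two, QTm.subst, subst_rename, subst_var]
    exact ⟨h, fun _ => .spliced (h.dbTyped_of_isVal hV)⟩
  · cases hi
    simp only [QTm.up, QTm.one, QTm.two, QTm.rename, QTm.subst, subst_rename, subst_var]
    refine ⟨hF, fun _ => ?_⟩
    rw [← hFe]
    exact .spliced (hF.dbTyped_of_isVal hFV)
  · simp [EffEnv.bindFix, EffEnv.weaken] at hi

end Rel
end LIQ

/-! ### Joint progress of related terms -/

namespace LIQ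

variable {S : Signature} {δ : (o : S.Op) → (Fin (S.arity o) → S.Const) → S.Const}
  {Ω : Set (Query S × NVal S)}

open ETm (DbTyped erase)
open QTm (IsVal IsValSing SStep Steps)
open Relation (ReflTransGen TransGen)

/-- What a closed term and its translation do next: they are values up to silent steps of the
translation, or a singleton of such values, or both make silent steps to related terms, or both
are about to run the same query, or both are stuck. -/
inductive Outcome (δ : (o : S.Op) → (Fin (S.arity o) → S.Const) → S.Const)
    (Ω : Set (Query S × NVal S)) : ETm S → ETy S → QTm S → Prop
  | value {M A N N'} : ETm.IsVal M → Steps δ Ω N N' → IsVal N' → Rel .pl [] M A N' →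
      Outcome δ Ω M A N
  | sing {V A N N'} : ETm.IsVal V → Steps δ Ω N (.sing N') → IsVal N' → Rel .pl [] V A N' →
      Outcome δ Ω (.sing V) (.bag A) N
  | step {M M' A N N'} : ETm.Step δ Ω M none M' → ¬ ETm.IsValSing M →
      TransGen (SStep δ Ω) N N' → Rel .pl [] M' A N' → Outcome δ Ω M A N
  | query {M A N C C' n} {l : Fin n ↪ String} {O : Fin n → S.Base} : ETm.Ctx C → QTm.Ctx C' →
      Steps δ Ω N (C' (.query (.quote (erase M)))) → DbTyped [] M (.bag (.row l O)) →
      (∀ P P', Rel .pl [] P (.bag (.row l O)) P' → Rel .pl [] (C P) A (C' P')) →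
      Outcome δ Ω (C (.query M)) A N
  | stuck {M A N N'} : ¬ ETm.IsVal M → ¬ ETm.IsValSing M → (∀ a P, ¬ ETm.Step δ Ω M a P) →
      Steps δ Ω N N' → ¬ IsVal N' → ¬ IsValSing N' → (∀ a P, ¬ QTm.Step δ Ω .host N' a P) →
      Outcome δ Ω M A N

namespace Outcome

theorem of_steps {M : ETm S} {A : ETy S} {N N' : QTm S} (h : Outcome δ Ω M A N')
    (hN : Steps δ Ω N N') : Outcome δ Ω M A N := by
  cases h with
  | value h1 h2 h3 h4 => exact .value h1 (hN.trans h2) h3 h4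
  | sing h1 h2 h3 h4 => exact .sing h1 (hN.trans h2) h3 h4
  | step h1 h2 h3 h4 => exact .step h1 h2 (h3.trans_right hN) h4
  | query h1 h2 h3 h4 h5 => exact .query h1 h2 (hN.trans h3) h4 h5
  | stuck h1 h2 h3 h4 h5 h6 h7 => exact .stuck h1 h2 h3 (hN.trans h4) h5 h6 h7

theorem of_isVal {M : ETm S} {A : ETy S} {N : QTm S} (h : Outcome δ Ω M A N) (hM : ETm.IsVal M) :
    ∃ N', Steps δ Ω N N' ∧ IsVal N' ∧ Rel .pl [] M A N' := by
  cases h with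
  | value _ h2 h3 h4 => exact ⟨_, h2, h3, h4⟩
  | sing => cases hM
  | step h => exact absurd h hM.not_step
  | query h => exact absurd hM (h.not_isVal _).1
  | stuck h => exact absurd hM h

theorem of_isValSing {M V : ETm S} {A : ETy S} {N : QTm S} (h : Outcome δ Ω M (.bag A) N)
    (hM : M = .sing V) (hV : ETm.IsVal V) :
    ∃ N', Steps δ Ω N (.sing N') ∧ IsVal N' ∧ Rel .pl [] V A N' := by
  have hS : ETm.IsValSing M := ⟨V, hV, hM⟩
  cases h with
  | value h => exact absurd h hS.not_isVal
  | sing _ h2 h3 h4 => cases hM; exact ⟨_, h2, h3, h4⟩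
  | step _ h => exact absurd hS h
  | query h => exact absurd hS (h.not_isVal _).2
  | stuck _ h => exact absurd hS h

/-- The outcome of the term in the hole determines that of the framed term, as long as this term is
not finished. The frame adds a step in the singleton case: outside of a left operand of a union,
`[V]` still becomes `[V] ⊎ []`, on both sides. -/
theorem frame {b : Bool} {F : ETm S → ETm S} {F' : QTm S → QTm S} {M : ETm S} {A B : ETy S}
    {N : QTm S} (h : Outcome δ Ω M A N) (hF : ETm.Frame b F) (hF' : QTm.Frame b F')
    (hR : ∀ P P', Rel .pl [] P A P' → Rel .pl [] (F P) B (F' P')) (hM : ¬ ETm.IsVal M)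
    (hb : b = true → ¬ ETm.IsValSing M) : Outcome δ Ω (F M) B (F' N) := by
  cases h with
  | value h => exact absurd h hM
  | @sing V A _ N' h1 h2 h3 h4 =>
    have hb' : b = true → ¬ IsValSing (QTm.sing N') := fun hb' => absurd ⟨V, h1, rfl⟩ (hb hb')
    exact .step (hF.step hb (.singEta h1)) (hF.not_isVal hM hb).2
      (TransGen.tail' (h2.frame hF') ⟨hF'.step hb' (.singEta h3), (hF'.not_isVal (fun h => by cases h) hb').2⟩)
      (hR _ _ (.union (.sing h4) .empty))
  | step h1 h2 h3 h4 =>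
    refine .step (hF.step hb h1) (hF.not_isVal hM hb).2 ?_ (hR _ _ h4)
    obtain ⟨N, h5, h6⟩ := TransGen.tail'_iff.1 h3
    exact TransGen.tail' (Steps.frame hF' h5) (h6.frame hF')
  | query h1 h2 h3 h4 h5 =>
    exact .query (.frame hF h1) (.frame hF' h2) (h3.frame hF') h4 fun P P' h => hR _ _ (h5 _ _ h)
  | stuck h1 h2 h3 h4 h5 h6 h7 =>
    have k1 := hF.not_isVal hM hb
    have k2 := hF'.not_isVal h5 fun _ => h6
    refine .stuck k1.1 k1.2 (fun a P h => ?_) (h4.frame hF') k2.1 k2.2 fun a P h => ?_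
    · obtain ⟨P, h, -⟩ := hF.inv h1 h2 h
      exact h3 _ _ h
    · obtain ⟨P, h, -⟩ := hF'.inv h5 h6 h
      exact h7 _ _ h

/-- A redex on both sides, where the translation makes further steps. -/
theorem redex {M M' : ETm S} {A : ETy S} {N N' N'' : QTm S} (hM : ETm.Step δ Ω M none M')
    (hs : ¬ ETm.IsValSing M) (hN : QTm.Step δ Ω .host N none N') (hs' : ¬ IsValSing N)
    (h : Steps δ Ω N' N'') (hR : Rel .pl [] M' A N'') : Outcome δ Ω M A N :=
  .step hM hs (TransGen.head' ⟨hN, hs'⟩ h) hR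

/-- Either all operands are values, and the translation evaluates all of its operands, or the
leftmost one that is not a value decides, once the translation has evaluated those before it. -/
theorem family {n : ℕ} {A : Fin n → ETy S} {B : ETy S} {G : (Fin n → ETm S) → ETm S}
    {G' : (Fin n → QTm S) → QTm S}
    (hG : ∀ M i, (∀ j, j < i → ETm.IsVal (M j)) →
      ETm.Frame false fun P => G (Function.update M i P))
    (hG' : ∀ M i, (∀ j, j < i → IsVal (M j)) → QTm.Frame false fun P => G' (Function.update M i P))
    (hR : ∀ M N, (∀ i, Rel .pl [] (M i) (A i) (N i)) → Rel .pl [] (G M) B (G' N))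
    {M : Fin n → ETm S} {N : Fin n → QTm S} (hMN : ∀ i, Rel .pl [] (M i) (A i) (N i))
    (h : ∀ i, Outcome δ Ω (M i) (A i) (N i)) :
    Outcome δ Ω (G M) B (G' N) ∨ ((∀ i, ETm.IsVal (M i)) ∧
      ∃ N', Steps δ Ω (G' N) (G' N') ∧ ∀ i, IsVal (N' i) ∧ Rel .pl [] (M i) (A i) (N' i)) := by
  have hcong : ∀ M i N, (∀ j, j < i → IsVal (M j)) → SStep δ Ω (M i) N →
      SStep δ Ω (G' M) (G' (Function.update M i N)) := by
    intro M i N hv h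
    have := h.frame (hG' M i hv)
    simpa using this
  have hv : ∀ i, ∃ N', ETm.IsVal (M i) →
      Steps δ Ω (N i) N' ∧ IsVal N' ∧ Rel .pl [] (M i) (A i) N' := by
    intro i
    by_cases hi : ETm.IsVal (M i)
    · obtain ⟨N', h⟩ := (h i).of_isVal hi
      exact ⟨N', fun _ => h⟩
    -- A default that makes `N'` total; it is never consulted where the operand is not a value.
    · exact ⟨N i, fun h => absurd h hi⟩
  choose N' hN' using hv
  by_cases hall : ∀ i, ETm.IsVal (M i)
  · exact .inr ⟨hall, N', star_family_all (r := SStep δ Ω) (V := IsVal) hcong fun i =>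
      ⟨(hN' i (hall i)).1, (hN' i (hall i)).2.1⟩, fun i => (hN' i (hall i)).2⟩
  · left
    push Not at hall
    obtain ⟨i, hi, hmin⟩ := wellFounded_lt.has_min {i | ¬ ETm.IsVal (M i)} hall
    have hlt : ∀ j, j < i → ETm.IsVal (M j) := fun j hj => by
      by_contra h
      exact hmin j h hj
    set st : Fin n → QTm S := fun j => if j.val < i.val then N' j else N j with hst
    have hsteps : Steps δ Ω (G' N) (G' st) :=
      star_family (r := SStep δ Ω) (V := IsVal) hcong i.val fun j hj =>
        ⟨(hN' j (hlt j hj)).1, (hN' j (hlt j hj)).2.1⟩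
    have hsti : st i = N i := by simp [hst]
    have := (h i).frame (B := B) (hG M i hlt) (hG' st i fun j hj => by
      have hj' : j.val < i.val := hj
      simp only [hst, hj', if_true]
      exact (hN' j (hlt j hj)).2.1) (fun P P' hP => hR _ _ fun j => by
        by_cases hj : j = i
        · subst hj; simpa using hP
        · rw [Function.update_of_ne hj, Function.update_of_ne hj]
          by_cases hj' : j.val < i.val
          · simp only [hst, hj', if_true]
            exact (hN' j (hlt j hj')).2.2
          · simp only [hst, hj', if_false]
            exact hMN j) hi (by simp)
    rw [← hsti] at this
    simp only [Function.update_eq_self] at this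
    exact this.of_steps hsteps

end Outcome

theorem Rel.bagShape {V : ETm S} {A : ETy S} {N : QTm S} (h : Rel .pl [] V (.bag A) N)
    (hV : ETm.IsVal V) : ETm.IsBagShape V := by
  cases hV <;> cases h <;> trivial

/-- Induction on the relation: the first unfinished operand is handled by `Outcome.frame`, and once
the needed operands are values, their related forms make the two sides contract matching redexes. -/
theorem Rel.outcome (hδ : OpTypeSafe S δ) {M : ETm S} {A : ETy S} {N : QTm S}
    (h : Rel .pl [] M A N) : Outcome δ Ω M A N := by
  generalize hX : Effect.pl = X at h
  generalize hρ : ([] : EffEnv S) = ρ at h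
  induction h with
  | var h => subst hρ; simp at h
  | const h => subst hX hρ; exact .value (.const _) .refl (.const _) (.const h)
  | @op _ _ o M N O h ho ih =>
    subst hX hρ
    obtain h | ⟨hv, N', hs, hN'⟩ := Outcome.family (δ := δ) (Ω := Ω) (G := ETm.op o)
      (G' := QTm.op o) (fun _ _ => .op) (fun _ _ => .op) (fun M N h => .op h ho) h
      fun i => ih i rfl rfl
    · exact h
    · have hc : ∀ i, ∃ c, M i = .const c ∧ N' i = .const c ∧ S.constTy c = S.argTy o i := by
        intro i
        have h1 := hv i
        have h2 := (hN' i).2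
        generalize M i = M at h1 h2
        generalize N' i = N at h2
        cases h1 <;> cases h2
        exact ⟨_, rfl, rfl, ‹_›⟩
      choose c hc1 hc2 hc3 using hc
      obtain rfl : M = fun i => .const (c i) := funext hc1
      obtain rfl : N' = fun i => .const (c i) := funext hc2
      exact (Outcome.redex (.delta _ _) (by simp [ETm.IsValSing]) (.delta _ _)
        (by simp [IsValSing]) .refl (.const (by rw [← ho]; exact hδ o c hc3))).of_steps hs
  | lamPl h => subst hρ; exact .value (.lam _ _ _) .refl (.lam _ _) (.lamPl h)
  | quoteLam h =>
    subst hρ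
    -- The abstraction is already a value in Eff, while Quot still has to evaluate the splices in
    -- its quotation; `quoteErase` relates the result.
    have h' := h.lamDb
    exact .value (.lam _ _ _) (h'.quotedSteps EffEnv.isDb_nil).quote
      (.quote h'.dbTyped.isQuotVal_erase) (.quoteErase h'.dbTyped)
  | quoteErase h =>
    subst hρ
    exact .value (.lam _ _ _) .refl (.quote h.isQuotVal_erase) (.quoteErase h)
  | fix h => subst hρ; exact .value (.fix _ _ _) .refl (.fix _ _ _) (.fix h)
  | @app _ _ A B M M' N N' h1 h2 ih1 ih2 =>
    subst hX hρ
    by_cases hM : ETm.IsVal M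
    · obtain ⟨M1, s1, v1, r1⟩ := (ih1 rfl rfl).of_isVal hM
      refine Outcome.of_steps ?_ (s1.frame (.appL _))
      by_cases hN : ETm.IsVal N
      · obtain ⟨N1, s2, v2, r2⟩ := (ih2 rfl rfl).of_isVal hN
        refine Outcome.of_steps ?_ (s2.frame (.appR v1))
        have r1' := r1
        cases hM <;> cases r1
        · rename_i h
          obtain ⟨P, s, r⟩ := Rel.let_body (δ := δ) (Ω := Ω) h r2 hN v2
          exact .redex (.beta hN) (by simp [ETm.IsValSing]) (.beta v2) (by simp [IsValSing]) s r
        · rename_i h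
          obtain ⟨P, s, r⟩ := Rel.fix_body (δ := δ) (Ω := Ω) h r2 hN v2 r1' (.fix _ _ _) rfl
          exact .redex (.unroll hN) (by simp [ETm.IsValSing]) (.unroll v2) (by simp [IsValSing]) s r
      · exact (ih2 rfl rfl).frame (.appR hM) (.appR v1) (fun P P' h => .app r1 h) hN (by simp)
    · exact (ih1 rfl rfl).frame (.appL N) (.appL N') (fun P P' h => .app h h2) hM (by simp)
  | @cond _ _ A L L' M M' h1 h2 ih1 ih2 =>
    subst hX hρ
    by_cases hL : ETm.IsVal L
    · obtain ⟨M1, s1, v1, r1⟩ := (ih1 rfl rfl).of_isVal hL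
      refine Outcome.of_steps ?_ (s1.frame (.cond _))
      cases hL <;> cases r1
      rename_i c hc
      by_cases ht : c = S.tt
      · subst ht
        exact .redex (.condTrue _) (by simp [ETm.IsValSing]) (.condTrue _)
          (by simp [IsValSing]) .refl h2
      by_cases hf : c = S.ff
      · subst hf
        exact .redex (.condFalse _) (by simp [ETm.IsValSing]) (.condFalse _)
          (by simp [IsValSing]) .refl .empty
      -- The base type of booleans may have constants other than the two truth values; on these,
      -- both conditionals are stuck.
      refine .stuck (fun h => by cases h) (by simp [ETm.IsValSing]) (fun a P h => ?_) .refl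
        (fun h => by cases h) (by simp [IsValSing]) (fun a P h => ?_)
      · generalize hX : ETm.cond _ _ = X at h
        cases h <;> cases hX
        · exact ht rfl
        · exact hf rfl
        · exact ETm.IsVal.not_step (.const _) ‹_›
      · generalize hX : QTm.cond _ _ = X at h
        cases h <;> cases hX
        · exact ht rfl
        · exact hf rfl
        · exact IsVal.not_step (.const _) ‹_›
    · exact (ih1 rfl rfl).frame (.cond M) (.cond M') (fun P P' h => .cond h h2) hL (by simp)
  | @record _ _ n l M A N h ih =>
    subst hX hρ
    obtain h | ⟨hv, N', hs, hN'⟩ := Outcome.family (δ := δ) (Ω := Ω) (G := ETm.record l)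
      (G' := QTm.record l) (fun _ _ => .record) (fun _ _ => .record) (fun M N h => .record h) h
      fun i => ih i rfl rfl
    · exact h
    · exact .value (.record _ hv) hs (.record _ fun i => (hN' i).1) (.record fun i => (hN' i).2)
  | @proj _ _ n l M A N s B i h h1 h2 ih =>
    subst hX hρ h1 h2
    by_cases hM : ETm.IsVal M
    · obtain ⟨M1, s1, v1, r1⟩ := (ih rfl rfl).of_isVal hM
      refine Outcome.of_steps ?_ (s1.frame (.proj _))
      cases hM <;> cases r1
      rename_i hM _ r1
      cases v1 with
      | record _ v1 =>
        exact .redex (.projRecord i hM) (by simp [ETm.IsValSing]) (.projRecord i v1)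
          (by simp [IsValSing]) .refl (r1 i)
    · exact (ih rfl rfl).frame (.proj _) (.proj _) (fun P P' h => .proj i h rfl rfl) hM (by simp)
  | empty => subst hX hρ; exact .value .nil .refl .nil .empty
  | @sing _ _ M A N h ih =>
    subst hX hρ
    by_cases hM : ETm.IsVal M
    · obtain ⟨M1, s1, v1, r1⟩ := (ih rfl rfl).of_isVal hM
      exact .sing hM (s1.frame .sing) v1 r1
    · exact (ih rfl rfl).frame .sing .sing (fun P P' h => .sing h) hM (by simp)
  | @union _ _ A M M' N N' h1 h2 ih1 ih2 =>
    subst hX hρ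
    by_cases hM : ETm.IsVal M
    · obtain ⟨M1, s1, v1, r1⟩ := (ih1 rfl rfl).of_isVal hM
      refine Outcome.of_steps ?_ (s1.frame (.unionL _))
      by_cases hN : ETm.IsVal N
      · obtain ⟨N1, s2, v2, r2⟩ := (ih2 rfl rfl).of_isVal hN
        refine Outcome.of_steps ?_ (s2.frame (.unionR (.inl v1)))
        have hM' := hM
        cases hM <;> cases r1
        · exact .redex (.unionNil hN) (by simp [ETm.IsValSing]) (.unionNil v2)
            (by simp [IsValSing]) .refl r2
        · rename_i r3 r0
          cases r3 with
          | sing r3 =>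
            exact .redex (.unionCons hM' hN) (by simp [ETm.IsValSing]) (.unionCons v1 v2)
              (by simp [IsValSing]) .refl (.union (.sing r3) (.union r0 r2))
      · exact (ih2 rfl rfl).frame (.unionR (.inl hM)) (.unionR (.inl v1))
          (fun P P' h => .union r1 h) hN (by simp)
    · by_cases hM' : ETm.IsValSing M
      · obtain ⟨V, hV, hMV⟩ := hM'
        obtain ⟨M1, s1, v1, r1⟩ := (ih1 rfl rfl).of_isValSing hMV hV
        subst hMV
        refine Outcome.of_steps ?_ (s1.frame (.unionL _))
        by_cases hN : ETm.IsVal N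
        · obtain ⟨N1, s2, v2, r2⟩ := (ih2 rfl rfl).of_isVal hN
          -- A singleton of a value beside an evaluated bag does not step: it is the head of a bag
          -- value.
          refine .value (.cons hV hN (r2.bagShape hN)) (s2.frame (.unionR (.inr ⟨_, v1, rfl⟩)))
            (.cons v1 v2 ?_) (.union (.sing r1) r2)
          cases v2 <;> trivial
        · exact (ih2 rfl rfl).frame (.unionR (.inr ⟨_, hV, rfl⟩)) (.unionR (.inr ⟨_, v1, rfl⟩))
            (fun P P' h => .union (.sing r1) h) hN (by simp)
      · exact (ih1 rfl rfl).frame (.unionL N) (.unionL N') (fun P P' h => .union h h2) hM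
          fun _ => hM'
  | @bindPl _ A B M M' N N' h1 h2 ih1 ih2 =>
    subst hρ
    by_cases hM : ETm.IsVal M
    · obtain ⟨M1, s1, v1, r1⟩ := (ih1 rfl rfl).of_isVal hM
      refine Outcome.of_steps ?_ (s1.frame (.bind _ _))
      have hM' := hM
      cases hM <;> cases r1
      · exact .redex (.forNil _ _) (by simp [ETm.IsValSing]) (.forNil _ _)
          (by simp [IsValSing]) .refl .empty
      · rename_i hV _ _ _ _ r3 r0
        cases r3 with
        | sing r3 =>
          obtain ⟨P, s, r⟩ := Rel.let_body (δ := δ) (Ω := Ω) h2 r3 hV (QTm.isVal_of_cons v1)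
          -- The new copy of the body prepares its shadow while it is the left operand of a union.
          exact .redex (.forCons hM') (by simp [ETm.IsValSing]) (.forCons v1)
            (by simp [IsValSing]) (s.frame (.unionL _)) (.union r (.bindPl r0 h2))
    · exact (ih1 rfl rfl).frame (.bind _ _) (.bind _ _) (fun P P' h => .bindPl h h2) hM (by simp)
  | @fold _ A B L L' M M' N N' h1 h2 h3 ih1 ih2 ih3 =>
    subst hρ
    by_cases hL : ETm.IsVal L
    · obtain ⟨M1, s1, v1, r1⟩ := (ih1 rfl rfl).of_isVal hL
      refine Outcome.of_steps ?_ (s1.frame (.fold _ _))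
      have hL' := hL
      cases hL <;> cases r1
      · exact .redex (.foldNil _ _) (by simp [ETm.IsValSing]) (.foldNil _ _)
          (by simp [IsValSing]) .refl h2
      · rename_i r3 r0
        cases r3 with
        | sing r3 =>
          exact .redex (.foldCons hL') (by simp [ETm.IsValSing]) (.foldCons v1)
            (by simp [IsValSing]) .refl (.app (.app h3 r3) (.fold r0 h2 h3))
    · exact (ih1 rfl rfl).frame (.fold _ _) (.fold _ _) (fun P P' h => .fold h h2 h3) hL (by simp)
  | query h hA =>
    subst hρ hA
    exact .query .hole .hole ((h.quotedSteps EffEnv.isDb_nil).quote.frame .query) h.dbTyped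
      fun P P' h => h
  | _ => cases hX

end LIQ

/-! ### Traces as sequences of visible transitions -/

namespace LIQ

open Relation (ReflTransGen TransGen)

namespace LTS

variable {X Y L : Type}

/-- A visible transition preceded by finitely many silent ones. -/
def Visible (T : LTS X L) (x : X) (l : L) (y : X) : Prop :=
  ∃ x', T.Silent x x' ∧ T.tr x' (some l) y

/-- Finite runs of visible transitions. -/
inductive VisibleRun (T : LTS X L) : X → List L → Prop
  | nil (x) : VisibleRun T x []
  | cons {x y l w} : T.Visible x l y → VisibleRun T y w → VisibleRun T x (l :: w)

theorem Weak.silent {T : LTS X L} {x y : X} (h : T.Weak x none y) : T.Silent x y := by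
  obtain ⟨x', y', h1, h2, h3⟩ := h
  exact (h1.tail h2).trans h3

theorem VisibleRun.silent {T : LTS X L} {x y : X} {w : List L} (hw : T.VisibleRun y w)
    (h : T.Silent x y) : T.VisibleRun x w := by
  cases hw with
  | nil => exact .nil x
  | cons h1 h2 =>
    obtain ⟨y', h3, h4⟩ := h1
    exact .cons ⟨y', h.trans h3, h4⟩ h2

theorem FinRun.visibleRun {T : LTS X L} {x y : X} {as : List (Option L)} (h : T.FinRun x as y) :
    T.VisibleRun x as.reduceOption := by
  induction h with
  | nil x => exact .nil x
  | @cons x y z a as h _ ih =>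
    cases a with
    | none => simpa using ih.silent h.silent
    | some l =>
      obtain ⟨x', y', h1, h2, h3⟩ := h
      simpa using VisibleRun.cons ⟨x', h1, h2⟩ (ih.silent h3)

theorem VisibleRun.finRun {T : LTS X L} {x : X} {w : List L} (h : T.VisibleRun x w) :
    ∃ y, T.FinRun x (w.map some) y := by
  induction h with
  | nil x => exact ⟨x, .nil x⟩
  | cons h _ ih =>
    obtain ⟨x', h1, h2⟩ := h
    obtain ⟨z, hz⟩ := ih
    exact ⟨z, .cons ⟨x', _, h1, h2, .refl⟩ hz⟩

theorem finRun_of_infinite {T : LTS X L} {s : ℕ → X} {a : ℕ → Option L}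
    (h : ∀ i, T.Weak (s i) (a i) (s (i + 1))) (n k : ℕ) :
    T.FinRun (s k) ((List.range n).map fun i => a (k + i)) (s (k + n)) := by
  induction n generalizing k with
  | zero => exact .nil _
  | succ n ih =>
    rw [List.range_succ_eq_map, List.map_cons, List.map_map]
    have := ih (k + 1)
    rw [show k + 1 + n = k + (n + 1) by omega] at this
    refine .cons (h k) ?_
    convert this using 3 with i
    simp only [Function.comp]
    congr 1
    omega

/-- An infinite run with finitely many visible labels adds no finite word, since the run can be cut
off after the last of them. So divergence is not observed. -/
theorem fin_mem_traces {T : LTS X L} {x : X} {w : List L} :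
    .fin w ∈ T.traces x ↔ T.VisibleRun x w := by
  constructor
  · rintro (⟨as, y, h, hw⟩ | ⟨s, a, rfl, h, n, -, rfl⟩)
    · cases hw
      exact h.visibleRun
    · have := (finRun_of_infinite h n 0).visibleRun
      simpa using this
  · intro h
    obtain ⟨y, hy⟩ := h.finRun
    exact .inl ⟨_, y, hy, by rw [List.reduceOption]; simp [List.filterMap_map]⟩

/-- All actions between two consecutive visible labels are silent, and are absorbed by the silent
steps that precede the second label. -/
theorem inf_mem_traces {T : LTS X L} {x : X} {w : ℕ → L} :
    .inf w ∈ T.traces x ↔ ∃ s : ℕ → X, s 0 = x ∧ ∀ i, T.Visible (s i) (w i) (s (i + 1)) := by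
  constructor
  · rintro (⟨as, y, h, hw⟩ | ⟨s, a, rfl, h, p, hp, hpw, hn⟩)
    · cases hw
    · have hsil : ∀ m n, m ≤ n → (∀ i, m ≤ i → i < n → a i = none) → T.Silent (s m) (s n) := by
        intro m n hmn hi
        induction n, hmn using Nat.le_induction with
        | base => exact .refl
        | succ n hmn ih =>
          have h1 := h n
          rw [hi n hmn (by omega)] at h1
          exact (ih fun i h1 h2 => hi i h1 (by omega)).trans h1.silent
      have hx : ∀ k, ∃ x' y', T.Silent (s (p k)) x' ∧ T.tr x' (some (w k)) y' ∧
          T.Silent y' (s (p k + 1)) := fun k => by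
        have := h (p k)
        rwa [hpw] at this
      choose x' y' h1 h2 h3 using hx
      have hgap : ∀ k i, p k < i → i < p (k + 1) → a i = none := by
        intro k i h1 h2
        refine hn i ?_
        rintro ⟨j, rfl⟩
        have h1 := hp.lt_iff_lt.1 h1
        have h2 := hp.lt_iff_lt.1 h2
        omega
      have hgap0 : ∀ i, i < p 0 → a i = none := by
        intro i h1
        refine hn i ?_
        rintro ⟨j, rfl⟩
        exact absurd (hp.lt_iff_lt.1 h1) (by omega)
      -- The new run stops directly after each visible step; the silent steps that follow it belong
      -- to the next transition.
      refine ⟨fun k => match k with | 0 => s 0 | k + 1 => y' k, rfl, fun k => ?_⟩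
      cases k with
      | zero => exact ⟨x' 0, (hsil 0 (p 0) (Nat.zero_le _) fun i _ => hgap0 i).trans (h1 0), h2 0⟩
      | succ k =>
        exact ⟨x' (k + 1), ((h3 k).trans (hsil _ _ (hp (Nat.lt_succ_self k)) fun i hi =>
          hgap k i hi)).trans (h1 (k + 1)), h2 (k + 1)⟩
  · rintro ⟨s, rfl, h⟩
    refine .inr ⟨s, fun i => some (w i), rfl, fun i => ?_, id, strictMono_id, fun _ => rfl,
      fun i hi => absurd ⟨i, rfl⟩ hi⟩
    obtain ⟨x', h1, h2⟩ := h i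
    exact ⟨x', _, h1, h2, .refl⟩

/-- A simulation of visible transitions includes traces. -/
theorem traces_subset {T : LTS X L} {U : LTS Y L} {R : X → Y → Prop}
    (hR : ∀ {x y l x'}, R x y → T.Visible x l x' → ∃ y', U.Visible y l y' ∧ R x' y') {x : X} {y : Y}
    (h : R x y) : T.traces x ⊆ U.traces y := by
  intro w hw
  cases w with
  | fin w =>
    rw [fin_mem_traces] at hw ⊢
    induction hw generalizing y with
    | nil => exact .nil y
    | cons h1 _ ih =>
      obtain ⟨y', h2, h3⟩ := hR h h1
      exact .cons h2 (ih h3)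
  | inf w =>
    rw [inf_mem_traces] at hw ⊢
    obtain ⟨s, rfl, hs⟩ := hw
    -- Stated for all y, with a default outside of `R`, so that the matching run can be defined by
    -- recursion before it is known to be related.
    have hnext : ∀ k y, ∃ y', R (s k) y → U.Visible y (w k) y' ∧ R (s (k + 1)) y' := by
      intro k y
      by_cases hy : R (s k) y
      · obtain ⟨y', h1, h2⟩ := hR hy (hs k)
        exact ⟨y', fun _ => ⟨h1, h2⟩⟩
      · exact ⟨y, fun h => absurd h hy⟩
    choose f hf using hnext
    let t : ℕ → Y := fun k => Nat.rec y (fun k y => f k y) k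
    have ht : ∀ k, R (s k) (t k) := by
      intro k
      induction k with
      | zero => exact h
      | succ k ih => exact (hf k _ ih).2
    exact ⟨t, rfl, fun k => (hf k _ (ht k)).1⟩

end LTS

/-! ### Transfer of visible transitions -/

variable {S : Signature} {δ : (o : S.Op) → (Fin (S.arity o) → S.Const) → S.Const}
  {Ω : Set (Query S × NVal S)}

open ETm (DbTyped erase)

/-- The types of queries as types of Eff. -/
def NTy.toETy : NTy S → ETy S
  | .base O => .base O
  | .rcd l A => .rcd l fun i => (A i).toETy
  | .bag A => .bag A.toETy

/-- Database values contain no functions and are denoted alike in both calculi, so a well-typed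
response restores the relation. -/
theorem NVal.HasTy.rel {V : NVal S} {A : NTy S} (h : NVal.HasTy V A) :
    Rel .pl [] (ETm.ofVal V) A.toETy (QTm.ofVal V) := by
  induction h with
  | const => exact .const rfl
  | record _ ih => exact .record ih
  | @bag n V A _ ih =>
    simp only [ETm.ofVal, QTm.ofVal]
    clear * - ih
    induction n with
    | zero => exact .empty
    | succ n ihn =>
      simp only [List.ofFn_succ, List.foldr_cons]
      exact .union (.sing (ih 0)) (ihn fun i => ih i.succ)

theorem Rel.run_query (hΩ : ResponseTypeSafe S Ω) {M : ETm S} {n : ℕ} {l : Fin n ↪ String}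
    {O : Fin n → S.Base} (h : DbTyped [] M (.bag (.row l O))) {q : Query S} {V : NVal S}
    (hq : ETm.Norm M q) (hV : (q, V) ∈ Ω) :
    Rel .pl [] (ETm.ofVal V) (.bag (.row l O)) (QTm.ofVal V) :=
  (hΩ q V hV n l O (hq.hasTy h)).rel

theorem DbTyped.norm_erase_row {M : ETm S} {n : ℕ} {l : Fin n ↪ String}
    {O : Fin n → S.Base} (h : DbTyped [] M (.bag (.row l O))) (q : Query S) :
    QTm.Norm (erase M) q ↔ ETm.Norm M q :=
  ETm.norm_erase h (fun _ => trivial) q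

/-- Induction on the silent run of Eff. By determinism its first step is the one that the outcome
provides, and Quot follows. At the visible step, agreement of the normal forms lets Quot run the
same query with the same response. -/
theorem Rel.visible (hδ : OpTypeSafe S δ) (hΩ : ResponseTypeSafe S Ω) {M M1 : ETm S} {A : ETy S}
    {N : QTm S} {x} (h : Rel .pl [] M A N) (hv : (ETm.lts δ Ω).Visible M x M1) :
    ∃ N1, (QTm.lts δ Ω).Visible N x N1 ∧ Rel .pl [] M1 A N1 := by
  obtain ⟨M', h1, h2⟩ := hv
  induction h1 using ReflTransGen.head_induction_on generalizing N with
  | refl =>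
    replace h2 : ETm.Step δ Ω M' (some x) M1 := h2
    cases h.outcome (Ω := Ω) hδ with
    | value h => exact absurd h2 h.not_step
    | sing hV => cases (ETm.Step.singEta hV).det rfl h2 |>.1
    | step h => cases (h.det rfl h2).1
    | stuck _ _ h => exact absurd h2 (h _ _)
    | query c1 c2 hs ht hc =>
      obtain ⟨q, V, k1, k2, k3, rfl⟩ := c1.step_query h2
      cases k3
      exact ⟨_, ⟨_, hs.host, c2.step (.runQuery ht.isQuotVal_erase
        ((DbTyped.norm_erase_row ht q).2 k1) k2)⟩, hc _ _ (Rel.run_query hΩ ht k1 k2)⟩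
  | @head M M2 hs1 _ ih =>
    replace hs1 : ETm.Step δ Ω M none M2 := hs1
    have key : ∃ N2, QTm.HostSteps δ Ω N N2 ∧ Rel .pl [] M2 A N2 := by
      cases h.outcome (Ω := Ω) hδ with
      | value h => exact absurd hs1 h.not_step
      | sing hV s v r =>
        obtain ⟨-, rfl⟩ := (ETm.Step.singEta hV).det rfl hs1
        exact ⟨_, s.host.tail (.singEta v), .union (.sing r) .empty⟩
      | step h _ s r =>
        obtain ⟨-, rfl⟩ := h.det rfl hs1
        exact ⟨_, QTm.Steps.host s.to_reflTransGen, r⟩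
      | stuck _ _ h => exact absurd hs1 (h _ _)
      | query c1 =>
        obtain ⟨q, V, -, -, h, -⟩ := c1.step_query hs1
        cases h
    obtain ⟨N2, s, r⟩ := key
    obtain ⟨N1, ⟨N', s', h'⟩, r'⟩ := ih r
    exact ⟨N1, ⟨N', s.trans s', h'⟩, r'⟩

/-- A silent run is a prefix of every run to a visible step. -/
theorem QTm.HostSteps.prefix {N N' N0 N1 : QTm S} {x} (h : QTm.HostSteps δ Ω N N')
    (h0 : QTm.HostSteps δ Ω N N0) (h1 : QTm.Step δ Ω .host N0 (some x) N1) :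
    QTm.HostSteps δ Ω N' N0 := by
  induction h using ReflTransGen.head_induction_on with
  | refl => exact h0
  | head h _ ih =>
    cases h0 using ReflTransGen.head_induction_on with
    | refl => cases (h.det rfl h1).1
    | head h' h0 =>
      obtain ⟨-, rfl⟩ := h.det rfl h'
      exact ih h0

/-- Quot reaches its visible step along a deterministic silent run, so the silent run given by any
outcome is an initial part of it. Each matched silent step of Eff moves Quot strictly along this
run, which gives the well-founded induction; values and stuck terms are impossible, as they block
the run. -/
theorem Rel.visible_inv (hδ : OpTypeSafe S δ) (hΩ : ResponseTypeSafe S Ω) {M : ETm S} {A : ETy S}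
    {N N1 : QTm S} {x} (h : Rel .pl [] M A N) (hv : (QTm.lts δ Ω).Visible N x N1) :
    ∃ M1, (ETm.lts δ Ω).Visible M x M1 ∧ Rel .pl [] M1 A N1 := by
  obtain ⟨N0, h0, h1⟩ := hv
  replace h0 : QTm.HostSteps δ Ω N N0 := h0
  replace h1 : QTm.Step δ Ω .host N0 (some x) N1 := h1
  -- N has no infinite silent run: its silent run is unique, and ends in N0, whose visible step
  -- excludes silent ones.
  have hacc : Acc (fun P P' : QTm S => QTm.Step δ Ω .host P' none P) N := by
    clear h
    induction h0 using ReflTransGen.head_induction_on with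
    | refl => exact ⟨_, fun P h => by cases (h.det rfl h1).1⟩
    | head h _ ih => exact ⟨_, fun P h' => (h.det rfl h').2 ▸ ih⟩
  -- One Eff step may consume several Quot steps.
  replace hacc := hacc.transGen
  induction hacc generalizing M with
  | intro N _ ih =>
  have hstep : ∀ {M' N'}, Rel .pl [] M' A N' →
      TransGen (fun P P' => QTm.Step δ Ω .host P none P') N N' →
      ETm.Step δ Ω M none M' → ∃ M1, (ETm.lts δ Ω).Visible M x M1 ∧ Rel .pl [] M1 A N1 := by
    intro M' N' hR hN hM
    obtain ⟨M1, ⟨M0, k1, k2⟩, k3⟩ := ih N' (TransGen.swap _ _ hN) hR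
      (QTm.HostSteps.prefix hN.to_reflTransGen h0 h1)
    exact ⟨M1, ⟨M0, .head hM k1, k2⟩, k3⟩
  cases h.outcome (Ω := Ω) hδ with
  | value _ s v =>
    rcases (QTm.HostSteps.prefix s.host h0 h1).cases_head with rfl | ⟨P, h, -⟩
    · exact absurd h1 v.not_step
    · exact absurd h v.not_step
  | sing hV s v r =>
    exact hstep (.union (.sing r) .empty) (TransGen.tail' s.host (.singEta v)) (.singEta hV)
  | step h _ s r => exact hstep r (TransGen.mono (fun _ _ h => h.1) _ _ s) h
  | stuck _ _ _ s _ _ hn =>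
    rcases (QTm.HostSteps.prefix s.host h0 h1).cases_head with rfl | ⟨P, h, -⟩
    · exact absurd h1 (hn _ _)
    · exact absurd h (hn _ _)
  | query c1 c2 s ht hc =>
    rcases (QTm.HostSteps.prefix s.host h0 h1).cases_head with rfl | ⟨P, h, -⟩
    · obtain ⟨q, V, k1, k2, k3, rfl⟩ := c2.step_query_quote ht.isQuotVal_erase h1
      cases k3
      have k1 := (DbTyped.norm_erase_row ht q).1 k1
      exact ⟨_, ⟨_, .refl, c1.step (.runQuery k1 k2)⟩, hc _ _ (Rel.run_query hΩ ht k1 k2)⟩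
    · obtain ⟨q, V, -, -, k, -⟩ := c2.step_query_quote ht.isQuotVal_erase h
      cases k

end LIQ

theorem mainTheorem2 (S : LIQ.Signature)
    (δ : (o : S.Op) → (Fin (S.arity o) → S.Const) → S.Const) (hδ : LIQ.OpTypeSafe S δ)
    (Ω : Set (LIQ.Query S × LIQ.NVal S)) (hΩ : LIQ.ResponseTypeSafe S Ω)
    (M : LIQ.ETm S) (A : LIQ.ETy S) (hM : LIQ.ETm.HasTy [] M A .pl) :
    LIQ.LTS.TraceEquiv (LIQ.ETm.lts δ Ω) M (LIQ.QTm.lts δ Ω) (M.splice .pl []) := by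
  have h := hM.rel_splice (ρ := []) rfl (by simp)
  exact Set.Subset.antisymm
    (LIQ.LTS.traces_subset (R := fun M N => LIQ.Rel .pl [] M A N)
      (fun h hv => h.visible hδ hΩ hv) h)
    (LIQ.LTS.traces_subset (R := fun N M => LIQ.Rel .pl [] M A N)
      (fun h hv => h.visible_inv hδ hΩ hv) h)
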